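/- Let $Q=(Q_0,Q_1,s,t)$ be a finite quiver with a twist $\sigma_\alpha\in\mathrm{Gal}(\mathbb{C}/\mathbb{R})$ on every arrow $\alpha$. Let $\mathbb{C}_\sigma Q$ be the semilinear path algebra: the ring over $\mathbb{C}$ generated by the trivial paths $e_i$ ($i\in Q_0$) and the arrows, subject to $e_ie_j=\delta_{ij}e_i$, $\sum_i e_i=1$, $e_{t(\alpha)}\alpha=\alpha=\alpha e_{s(\alpha)}$, $e_ic=ce_i$ and $\alpha c=\sigma_\alpha(c)\alpha$ for $c\in\mathbb{C}$; it is an $\mathbb{R}$-algebra. Let $\mathbb{S}\subseteq Q_1$ be a set of loops (special loops), at most one at each vertex, each with twist the complex conjugation and each associated with $x^2-1$ or $x^2+1$. Let $Q_{\mathbb{R}}$ (resp. $Q_{\mathbb{H}}$) be the set of vertices with a special loop associated with $x^2-1$ (resp. $x^2+1$), let $Q_{\mathbb{C}}$ be the set of the other vertices, let $s_i$ be the special loop at $i\in Q_{\mathbb{R}}\cup Q_{\mathbb{H}}$, and let $$S=\{s_i^2-e_i\mid i\in Q_{\mathbb{R}}\}\cup\{s_j^2+e_j\mid j\in Q_{\mathbb{H}}\}.$$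 Define a modulated quiver $(Q^{\mathrm b},\mathcal M)$ over $\mathbb{R}$ as follows. The vertices of $Q^{\mathrm b}$ are those of $Q$. Every arrow $\alpha\in Q_1\setminus\mathbb{S}$ gives an arrow $\alpha:s(\alpha)\to t(\alpha)$ of $Q^{\mathrm b}$, and a second parallel arrow $\alpha^{\mathbf i}$ if $s(\alpha),t(\alpha)$ both lie in $Q_{\mathbb{R}}$ or both lie in $Q_{\mathbb{H}}$. Put $\mathcal M(i)=D$ for $i\in Q_D$, $D\in\{\mathbb{R},\mathbb{H},\mathbb{C}\}$. For an arrow of $Q^{\mathrm b}$ arising from $\alpha$ let $\mathcal M$ of this arrow be the simple $\mathcal M(t(\alpha))$-$\mathcal M(s(\alpha))$-bimodule (with $\mathbb{R}$ acting centrally), which is unique up to isomorphism unless $s(\alpha),t(\alpha)\in Q_{\mathbb{C}}$; in that case take $\mathbb{C}$ if $\sigma_\alpha=\mathrm{Id}$, and $\overline{\mathbb{C}}$ (that is, $\mathbb{C}$ with right action $m\cdot c=m\overline{c}$) if $\sigma_\alpha$ is the conjugation. Let $T(Q^{\mathrm b},\mathcal M)$ be the tensor algebra of the bimodule $\bigoplus_{\beta\in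 Q^{\mathrm b}_1}\mathcal M(\beta)$ over the ring $\prod_{i}\mathcal M(i)$. Then the $\mathbb{R}$-algebras $A=\mathbb{C}_\sigma Q/\langle S\rangle$ and $T(Q^{\mathrm b},\mathcal M)$ are Morita equivalent. More precisely, there are an idempotent $\epsilon\in A$ with $A\epsilon A=A$ and an isomorphism of $\mathbb{R}$-algebras $\epsilon A\epsilon\cong T(Q^{\mathrm b},\mathcal M)$. -/

import Mathlib

open scoped Quaternion

noncomputable section

/-! ## Tensor rings of bimodules -/

section TensorRing

variable (R B M : Type*) [CommRing R] [Ring B] [Algebra R B] [AddCommGroup M] [Module R M]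
  [Module B M] [Module Bᵐᵒᵖ M]

/-- The relations which turn the tensor algebra of the `R`-module `B × M` into the tensor ring of
the `B`-`B`-bimodule `M`: the multiplication of generators from `B` is the one of `B`, the unit of
`B` is the unit, and the products of elements of `B` and `M` are given by the bimodule structure.
Here `b • m` is the left action and `MulOpposite.op b • m` the right action `m b`. -/
inductive TensorRing.Rel : TensorAlgebra R (B × M) → TensorAlgebra R (B × M) → Prop
  | one : TensorRing.Rel (TensorAlgebra.ι R ((1 : B), (0 : M))) 1
  | mul (b c : B) : TensorRing.Rel (TensorAlgebra.ι R (b * c, (0 : M)))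
      (TensorAlgebra.ι R (b, (0 : M)) * TensorAlgebra.ι R (c, (0 : M)))
  | left (b : B) (m : M) : TensorRing.Rel (TensorAlgebra.ι R ((0 : B), b • m))
      (TensorAlgebra.ι R (b, (0 : M)) * TensorAlgebra.ι R ((0 : B), m))
  | right (m : M) (b : B) : TensorRing.Rel (TensorAlgebra.ι R ((0 : B), MulOpposite.op b • m))
      (TensorAlgebra.ι R ((0 : B), m) * TensorAlgebra.ι R (b, (0 : M)))

/-- The tensor algebra `T_B(M) = B ⊕ M ⊕ (M ⊗_B M) ⊕ ⋯` of a `B`-`B`-bimodule `M` on which the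
commutative ring `R` acts centrally, as the `R`-algebra generated by `B` and `M` in the universal
way. -/
def TensorRing : Type _ := RingQuot (TensorRing.Rel R B M)

instance : Ring (TensorRing R B M) := inferInstanceAs (Ring (RingQuot (TensorRing.Rel R B M)))

instance : Algebra R (TensorRing R B M) :=
  inferInstanceAs (Algebra R (RingQuot (TensorRing.Rel R B M)))

end TensorRing

/-! ## Corner algebras -/

/-- For an idempotent `e` of an `R`-algebra `A`, the corner ring `eAe` (with unit `e`) is an
`R`-algebra through `r ↦ r • e`. -/
instance cornerAlgebra {R A : Type*} [CommRing R] [Ring A] [Algebra R A] {e : A}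
    (he : IsIdempotentElem e) : Algebra R he.Corner where
  smul r x := ⟨r • x.1, by
    obtain ⟨a, ha⟩ := x.2
    exact ⟨r • a, by simp only [← ha, mul_smul_comm, smul_mul_assoc]⟩⟩
  algebraMap :=
    { toFun := fun r => ⟨r • e, r • 1, by
        simp only [mul_smul_comm, smul_mul_assoc, mul_one, he.eq]⟩
      map_one' := Subtype.ext (one_smul R e)
      map_mul' := fun r s => Subtype.ext (by
        change (r * s) • e = (r • e) * (s • e)
        rw [smul_mul_smul_comm, he.eq])
      map_zero' := Subtype.ext (zero_smul R e)
      map_add' := fun r s => Subtype.ext (add_smul r s e) }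
  commutes' r x := Subtype.ext (by
    have h := (Subsemigroup.mem_corner_iff he).mp x.2
    change (r • e) * x.1 = x.1 * (r • e)
    rw [smul_mul_assoc, mul_smul_comm, h.1, h.2])
  smul_def' r x := Subtype.ext (by
    have h := (Subsemigroup.mem_corner_iff he).mp x.2
    change r • x.1 = (r • e) * x.1
    rw [smul_mul_assoc, h.1])

/-! ## Division algebras over the real numbers and their simple bimodules -/

/-- Labels for the finite-dimensional division algebras `ℝ`, `ℂ`, `ℍ` over `ℝ`. -/
inductive DivisionKind : Type
  | real
  | complex
  | quaternion

/-- The division algebra with a given label. -/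
def DivisionKind.Carrier : DivisionKind → Type
  | .real => ℝ
  | .complex => ℂ
  | .quaternion => ℍ[ℝ]

instance (d : DivisionKind) : Ring d.Carrier :=
  match d with
  | .real => inferInstanceAs (Ring ℝ)
  | .complex => inferInstanceAs (Ring ℂ)
  | .quaternion => inferInstanceAs (Ring ℍ[ℝ])

instance (d : DivisionKind) : Algebra ℝ d.Carrier :=
  match d with
  | .real => inferInstanceAs (Algebra ℝ ℝ)
  | .complex => inferInstanceAs (Algebra ℝ ℂ)
  | .quaternion => inferInstanceAs (Algebra ℝ ℍ[ℝ])

/-- The matrices `diag(i, -i)`, `(0, 1; -1, 0)`, `(0, i; i, 0)` satisfy the relations of the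
imaginary units of `ℍ`. -/
def quaternionMatrixBasis :
    QuaternionAlgebra.Basis (Matrix (Fin 2) (Fin 2) ℂ) (-1 : ℝ) (0 : ℝ) (-1 : ℝ) where
  i := !![Complex.I, 0; 0, -Complex.I]
  j := !![0, 1; -1, 0]
  k := !![0, Complex.I; Complex.I, 0]
  i_mul_i := by
    ext a b; fin_cases a <;> fin_cases b <;> simp
  j_mul_j := by
    ext a b; fin_cases a <;> fin_cases b <;> simp
  i_mul_j := by
    ext a b; fin_cases a <;> fin_cases b <;> simp
  j_mul_i := by
    ext a b; fin_cases a <;> fin_cases b <;> simp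

/-- The standard embedding of `ℍ` into the complex `2 × 2` matrices, with image the matrices
`(a, b; -b̄, ā)`. -/
def quaternionToMatrix : ℍ[ℝ] →ₐ[ℝ] Matrix (Fin 2) (Fin 2) ℂ :=
  QuaternionAlgebra.lift quaternionMatrixBasis

/-- The column space `ℂ²` as a left `ℍ`-module, by matrix multiplication. -/
abbrev columnModule : Module ℍ[ℝ] (Matrix (Fin 2) (Fin 1) ℂ) where
  smul q v := quaternionToMatrix q * v
  one_smul v := by change quaternionToMatrix 1 * v = v; rw [map_one, Matrix.one_mul]
  mul_smul p q v := by
    change quaternionToMatrix (p * q) * v = quaternionToMatrix p * (quaternionToMatrix q * v)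
    rw [map_mul, Matrix.mul_assoc]
  smul_zero q := Matrix.mul_zero (quaternionToMatrix q)
  smul_add q v w := Matrix.mul_add (quaternionToMatrix q) v w
  add_smul p q v := by
    change quaternionToMatrix (p + q) * v = quaternionToMatrix p * v + quaternionToMatrix q * v
    rw [map_add, Matrix.add_mul]
  zero_smul v := by change quaternionToMatrix 0 * v = 0; rw [map_zero, Matrix.zero_mul]

/-- The row space `ℂ²` as a right `ℍ`-module, by matrix multiplication. -/
abbrev rowModule : Module ℍ[ℝ]ᵐᵒᵖ (Matrix (Fin 1) (Fin 2) ℂ) where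
  smul q v := v * quaternionToMatrix q.unop
  one_smul v := by
    change v * quaternionToMatrix 1 = v; rw [map_one, Matrix.mul_one]
  mul_smul p q v := by
    change v * quaternionToMatrix (q.unop * p.unop)
      = (v * quaternionToMatrix q.unop) * quaternionToMatrix p.unop
    rw [map_mul, Matrix.mul_assoc]
  smul_zero q := Matrix.zero_mul (quaternionToMatrix q.unop)
  smul_add q v w := Matrix.add_mul v w (quaternionToMatrix q.unop)
  add_smul p q v := by
    change v * quaternionToMatrix (p.unop + q.unop)
      = v * quaternionToMatrix p.unop + v * quaternionToMatrix q.unop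
    rw [map_add, Matrix.mul_add]
  zero_smul v := by change v * quaternionToMatrix 0 = 0; rw [map_zero, Matrix.mul_zero]

/-- Labels for the simple `D`-`D'`-bimodules with `D, D' ∈ {ℝ, ℂ, ℍ}`, on which `ℝ` acts centrally,
up to isomorphism; the first index is the ring acting on the left. There is exactly one for each
pair, except that there are two for `D = D' = ℂ`. -/
inductive SimpleBimodule : DivisionKind → DivisionKind → Type
  | rr : SimpleBimodule .real .real
  | rc : SimpleBimodule .real .complex
  | rh : SimpleBimodule .real .quaternion
  | cr : SimpleBimodule .complex .real
  | cc : SimpleBimodule .complex .complex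
  | ccBar : SimpleBimodule .complex .complex
  | ch : SimpleBimodule .complex .quaternion
  | hr : SimpleBimodule .quaternion .real
  | hc : SimpleBimodule .quaternion .complex
  | hh : SimpleBimodule .quaternion .quaternion

namespace SimpleBimodule

/-- The underlying set of a simple bimodule: `ℝ`, `ℂ`, `ℍ`, the rows of length two over `ℂ` or the
columns of length two over `ℂ`. -/
def Carrier : {d d' : DivisionKind} → SimpleBimodule d d' → Type
  | _, _, rr => ℝ
  | _, _, rc => ℂ
  | _, _, rh => ℍ[ℝ]
  | _, _, cr => ℂ
  | _, _, cc => ℂ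
  | _, _, ccBar => ℂ
  | _, _, ch => Matrix (Fin 1) (Fin 2) ℂ
  | _, _, hr => ℍ[ℝ]
  | _, _, hc => Matrix (Fin 2) (Fin 1) ℂ
  | _, _, hh => ℍ[ℝ]

variable {d d' : DivisionKind}

instance (X : SimpleBimodule d d') : AddCommGroup X.Carrier :=
  match X with
  | rr => inferInstanceAs (AddCommGroup ℝ)
  | rc => inferInstanceAs (AddCommGroup ℂ)
  | rh => inferInstanceAs (AddCommGroup ℍ[ℝ])
  | cr => inferInstanceAs (AddCommGroup ℂ)
  | cc => inferInstanceAs (AddCommGroup ℂ)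
  | ccBar => inferInstanceAs (AddCommGroup ℂ)
  | ch => inferInstanceAs (AddCommGroup (Matrix (Fin 1) (Fin 2) ℂ))
  | hr => inferInstanceAs (AddCommGroup ℍ[ℝ])
  | hc => inferInstanceAs (AddCommGroup (Matrix (Fin 2) (Fin 1) ℂ))
  | hh => inferInstanceAs (AddCommGroup ℍ[ℝ])

instance (X : SimpleBimodule d d') : Module ℝ X.Carrier :=
  match X with
  | rr => inferInstanceAs (Module ℝ ℝ)
  | rc => inferInstanceAs (Module ℝ ℂ)
  | rh => inferInstanceAs (Module ℝ ℍ[ℝ])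
  | cr => inferInstanceAs (Module ℝ ℂ)
  | cc => inferInstanceAs (Module ℝ ℂ)
  | ccBar => inferInstanceAs (Module ℝ ℂ)
  | ch => inferInstanceAs (Module ℝ (Matrix (Fin 1) (Fin 2) ℂ))
  | hr => inferInstanceAs (Module ℝ ℍ[ℝ])
  | hc => inferInstanceAs (Module ℝ (Matrix (Fin 2) (Fin 1) ℂ))
  | hh => inferInstanceAs (Module ℝ ℍ[ℝ])

/-- The left action, by multiplication. -/
instance (X : SimpleBimodule d d') : Module d.Carrier X.Carrier :=
  match X with
  | rr => inferInstanceAs (Module ℝ ℝ)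
  | rc => inferInstanceAs (Module ℝ ℂ)
  | rh => inferInstanceAs (Module ℝ ℍ[ℝ])
  | cr => inferInstanceAs (Module ℂ ℂ)
  | cc => inferInstanceAs (Module ℂ ℂ)
  | ccBar => inferInstanceAs (Module ℂ ℂ)
  | ch => inferInstanceAs (Module ℂ (Matrix (Fin 1) (Fin 2) ℂ))
  | hr => inferInstanceAs (Module ℍ[ℝ] ℍ[ℝ])
  | hc => columnModule
  | hh => inferInstanceAs (Module ℍ[ℝ] ℍ[ℝ])

/-- The right action, by multiplication, except that on the bimodule `ℂ̄` (labelled `ccBar`) a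
complex number `c` acts from the right as the multiplication by its conjugate. -/
instance (X : SimpleBimodule d d') : Module d'.Carrierᵐᵒᵖ X.Carrier :=
  match X with
  | rr => inferInstanceAs (Module ℝᵐᵒᵖ ℝ)
  | rc => inferInstanceAs (Module ℂᵐᵒᵖ ℂ)
  | rh => inferInstanceAs (Module ℍ[ℝ]ᵐᵒᵖ ℍ[ℝ])
  | cr => inferInstanceAs (Module ℝᵐᵒᵖ ℂ)
  | cc => inferInstanceAs (Module ℂᵐᵒᵖ ℂ)
  | ccBar => Module.compHom ℂ (RingHom.op (starRingEnd ℂ))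
  | ch => rowModule
  | hr => inferInstanceAs (Module ℝᵐᵒᵖ ℍ[ℝ])
  | hc => inferInstanceAs (Module ℂᵐᵒᵖ (Matrix (Fin 2) (Fin 1) ℂ))
  | hh => inferInstanceAs (Module ℍ[ℝ]ᵐᵒᵖ ℍ[ℝ])

instance (X : SimpleBimodule d d') : SMulCommClass d.Carrier d'.Carrierᵐᵒᵖ X.Carrier :=
  match X with
  | rr => inferInstanceAs (SMulCommClass ℝ ℝᵐᵒᵖ ℝ)
  | rc => inferInstanceAs (SMulCommClass ℝ ℂᵐᵒᵖ ℂ)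
  | rh => inferInstanceAs (SMulCommClass ℝ ℍ[ℝ]ᵐᵒᵖ ℍ[ℝ])
  | cr => inferInstanceAs (SMulCommClass ℂ ℝᵐᵒᵖ ℂ)
  | cc => inferInstanceAs (SMulCommClass ℂ ℂᵐᵒᵖ ℂ)
  | ccBar => ⟨fun (a : ℂ) (b : ℂᵐᵒᵖ) (m : ℂ) =>
      (mul_assoc a m (starRingEnd ℂ b.unop)).symm⟩
  | ch => ⟨fun (a : ℂ) (b : ℍ[ℝ]ᵐᵒᵖ) (m : Matrix (Fin 1) (Fin 2) ℂ) =>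
      (Matrix.smul_mul a m (quaternionToMatrix b.unop)).symm⟩
  | hr => ⟨fun (a : ℍ[ℝ]) (b : ℝᵐᵒᵖ) (m : ℍ[ℝ]) => by
      have h : ∀ x : ℍ[ℝ], b • x = b.unop • x := fun x => by
        ext <;> simp [mul_comm]
      exact ((congrArg (a * ·) (h m)).trans (mul_smul_comm b.unop a m)).trans (h (a * m)).symm⟩
  | hc => ⟨fun (a : ℍ[ℝ]) (b : ℂᵐᵒᵖ) (m : Matrix (Fin 2) (Fin 1) ℂ) =>
      Matrix.mul_smul (quaternionToMatrix a) b m⟩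
  | hh => inferInstanceAs (SMulCommClass ℍ[ℝ] ℍ[ℝ]ᵐᵒᵖ ℍ[ℝ])

instance (X : SimpleBimodule d d') : IsScalarTower ℝ d.Carrier X.Carrier :=
  match X with
  | rr => inferInstanceAs (IsScalarTower ℝ ℝ ℝ)
  | rc => inferInstanceAs (IsScalarTower ℝ ℝ ℂ)
  | rh => inferInstanceAs (IsScalarTower ℝ ℝ ℍ[ℝ])
  | cr => inferInstanceAs (IsScalarTower ℝ ℂ ℂ)
  | cc => inferInstanceAs (IsScalarTower ℝ ℂ ℂ)
  | ccBar => inferInstanceAs (IsScalarTower ℝ ℂ ℂ)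
  | ch => inferInstanceAs (IsScalarTower ℝ ℂ (Matrix (Fin 1) (Fin 2) ℂ))
  | hr => inferInstanceAs (IsScalarTower ℝ ℍ[ℝ] ℍ[ℝ])
  | hc => ⟨fun r (a : ℍ[ℝ]) (m : Matrix (Fin 2) (Fin 1) ℂ) => by
      change quaternionToMatrix (r • a) * m = r • (quaternionToMatrix a * m)
      rw [map_smul, Matrix.smul_mul]⟩
  | hh => inferInstanceAs (IsScalarTower ℝ ℍ[ℝ] ℍ[ℝ])

instance (X : SimpleBimodule d d') : IsScalarTower ℝ d'.Carrierᵐᵒᵖ X.Carrier :=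
  match X with
  | rr => inferInstanceAs (IsScalarTower ℝ ℝᵐᵒᵖ ℝ)
  | rc => inferInstanceAs (IsScalarTower ℝ ℂᵐᵒᵖ ℂ)
  | rh => inferInstanceAs (IsScalarTower ℝ ℍ[ℝ]ᵐᵒᵖ ℍ[ℝ])
  | cr => inferInstanceAs (IsScalarTower ℝ ℝᵐᵒᵖ ℂ)
  | cc => inferInstanceAs (IsScalarTower ℝ ℂᵐᵒᵖ ℂ)
  | ccBar => ⟨fun r (a : ℂᵐᵒᵖ) (m : ℂ) => by
      change m * starRingEnd ℂ (r • a.unop) = r • (m * starRingEnd ℂ a.unop)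
      simp [mul_left_comm]⟩
  | ch => ⟨fun r (a : ℍ[ℝ]ᵐᵒᵖ) (m : Matrix (Fin 1) (Fin 2) ℂ) => by
      change m * quaternionToMatrix (r • a.unop) = r • (m * quaternionToMatrix a.unop)
      rw [map_smul, Matrix.mul_smul]⟩
  | hr => inferInstanceAs (IsScalarTower ℝ ℝᵐᵒᵖ ℍ[ℝ])
  | hc => inferInstanceAs (IsScalarTower ℝ ℂᵐᵒᵖ (Matrix (Fin 2) (Fin 1) ℂ))
  | hh => inferInstanceAs (IsScalarTower ℝ ℍ[ℝ]ᵐᵒᵖ ℍ[ℝ])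

end SimpleBimodule

/-! ## Modulated quivers and their tensor algebras -/

/-- A modulated quiver over `ℝ` with vertices `V` and arrows `E`: every vertex carries one of the
division algebras `ℝ`, `ℂ`, `ℍ`, and every arrow `a` carries a simple bimodule, with the algebra at
its target acting on the left and the algebra at its source acting on the right. -/
structure ModulatedQuiver (V E : Type*) where
  src : E → V
  tgt : E → V
  ring : V → DivisionKind
  bimodule : (a : E) → SimpleBimodule (ring (tgt a)) (ring (src a))

namespace ModulatedQuiver

variable {V E : Type*} (Γ : ModulatedQuiver V E)

/-- The ring `∏ᵢ M(i)` over the vertices. -/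
abbrev VertexRing : Type _ := (i : V) → (Γ.ring i).Carrier

/-- The sum `⨁ₐ M(a)` over the arrows. (The quivers considered have finitely many arrows, so that
the direct sum is the product.) -/
def ArrowBimodule : Type _ := (a : E) → (Γ.bimodule a).Carrier

instance : AddCommGroup Γ.ArrowBimodule :=
  inferInstanceAs (AddCommGroup ((a : E) → (Γ.bimodule a).Carrier))

instance : Module ℝ Γ.ArrowBimodule :=
  inferInstanceAs (Module ℝ ((a : E) → (Γ.bimodule a).Carrier))

instance : Module Γ.VertexRing Γ.ArrowBimodule where
  smul b m := fun a => b (Γ.tgt a) • m a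
  one_smul m := funext fun a => one_smul _ (m a)
  mul_smul b c m := funext fun a => mul_smul (b (Γ.tgt a)) (c (Γ.tgt a)) (m a)
  smul_zero b := funext fun a => smul_zero (b (Γ.tgt a))
  smul_add b m n := funext fun a => smul_add (b (Γ.tgt a)) (m a) (n a)
  add_smul b c m := funext fun a => add_smul (b (Γ.tgt a)) (c (Γ.tgt a)) (m a)
  zero_smul m := funext fun a => zero_smul _ (m a)

instance : Module Γ.VertexRingᵐᵒᵖ Γ.ArrowBimodule where
  smul b m := fun a => MulOpposite.op (b.unop (Γ.src a)) • m a
  one_smul m := funext fun a => one_smul _ (m a)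
  mul_smul b c m := funext fun a =>
    mul_smul (MulOpposite.op (b.unop (Γ.src a))) (MulOpposite.op (c.unop (Γ.src a))) (m a)
  smul_zero b := funext fun a => smul_zero (MulOpposite.op (b.unop (Γ.src a)))
  smul_add b m n := funext fun a => smul_add (MulOpposite.op (b.unop (Γ.src a))) (m a) (n a)
  add_smul b c m := funext fun a =>
    add_smul (MulOpposite.op (b.unop (Γ.src a))) (MulOpposite.op (c.unop (Γ.src a))) (m a)
  zero_smul m := funext fun a => zero_smul _ (m a)

instance : SMulCommClass Γ.VertexRing Γ.VertexRingᵐᵒᵖ Γ.ArrowBimodule :=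
  ⟨fun b c m => funext fun a =>
    smul_comm (b (Γ.tgt a)) (MulOpposite.op (c.unop (Γ.src a))) (m a)⟩

instance : IsScalarTower ℝ Γ.VertexRing Γ.ArrowBimodule :=
  ⟨fun r b m => funext fun a => smul_assoc r (b (Γ.tgt a)) (m a)⟩

instance : IsScalarTower ℝ Γ.VertexRingᵐᵒᵖ Γ.ArrowBimodule :=
  ⟨fun r b m => funext fun a => smul_assoc r (MulOpposite.op (b.unop (Γ.src a))) (m a)⟩

/-- The tensor algebra `T(Q, M)` of a modulated quiver. -/
abbrev TensorAlg : Type _ := TensorRing ℝ Γ.VertexRing Γ.ArrowBimodule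

end ModulatedQuiver

/-! ## Semilinear path algebras with special loops -/

/-- A quiver with vertices `V` and arrows `E`, a twist in `Gal(ℂ/ℝ)` on every arrow, and a set of
special loops. A special loop is twisted by the complex conjugation, it is associated with one of
the polynomials `x² - 1` and `x² + 1`, written as `x² - sign`, and there is at most one special
loop at every vertex. -/
structure SemilinearQuiver (V E : Type*) where
  src : E → V
  tgt : E → V
  twist : E → (ℂ ≃ₐ[ℝ] ℂ)
  special : Set E
  sign : special → ℤˣ
  loop : ∀ s ∈ special, src s = tgt s
  twist_special : ∀ s ∈ special, twist s = Complex.conjAe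
  unique_special : ∀ s ∈ special, ∀ s' ∈ special, src s = src s' → s = s'

namespace SemilinearQuiver

variable {V E : Type*} (Q : SemilinearQuiver V E)

/-- The generators of a semilinear path algebra: complex numbers, trivial paths, arrows. -/
inductive Gen (V E : Type*)
  | scalar (c : ℂ) : Gen V E
  | vertex (i : V) : Gen V E
  | arrow (a : E) : Gen V E

/-- The defining relations of the semilinear path algebra `ℂ_σQ`. The first three say that the
complex numbers map to it by a ring homomorphism which extends the one of the real numbers. -/
inductive PathRel [Fintype V] : FreeAlgebra ℝ (Gen V E) → FreeAlgebra ℝ (Gen V E) → Prop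
  | scalar_real (r : ℝ) :
      PathRel (FreeAlgebra.ι ℝ (.scalar (r : ℂ))) (algebraMap ℝ (FreeAlgebra ℝ (Gen V E)) r)
  | scalar_add (c d : ℂ) : PathRel (FreeAlgebra.ι ℝ (.scalar (c + d)))
      (FreeAlgebra.ι ℝ (.scalar c) + FreeAlgebra.ι ℝ (.scalar d))
  | scalar_mul (c d : ℂ) : PathRel (FreeAlgebra.ι ℝ (.scalar (c * d)))
      (FreeAlgebra.ι ℝ (.scalar c) * FreeAlgebra.ι ℝ (.scalar d))
  | vertex_mul_self (i : V) : PathRel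
      (FreeAlgebra.ι ℝ (.vertex i) * FreeAlgebra.ι ℝ (.vertex i)) (FreeAlgebra.ι ℝ (.vertex i))
  | vertex_mul_of_ne (i j : V) (h : i ≠ j) : PathRel
      (FreeAlgebra.ι ℝ (.vertex i) * FreeAlgebra.ι ℝ (.vertex j)) 0
  | sum_vertex : PathRel (∑ i : V, FreeAlgebra.ι ℝ (.vertex i)) 1
  | tgt_mul_arrow (a : E) : PathRel
      (FreeAlgebra.ι ℝ (.vertex (Q.tgt a)) * FreeAlgebra.ι ℝ (.arrow a))
      (FreeAlgebra.ι ℝ (.arrow a))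
  | arrow_mul_src (a : E) : PathRel
      (FreeAlgebra.ι ℝ (.arrow a) * FreeAlgebra.ι ℝ (.vertex (Q.src a)))
      (FreeAlgebra.ι ℝ (.arrow a))
  | vertex_mul_scalar (i : V) (c : ℂ) : PathRel
      (FreeAlgebra.ι ℝ (.vertex i) * FreeAlgebra.ι ℝ (.scalar c))
      (FreeAlgebra.ι ℝ (.scalar c) * FreeAlgebra.ι ℝ (.vertex i))
  | arrow_mul_scalar (a : E) (c : ℂ) : PathRel
      (FreeAlgebra.ι ℝ (.arrow a) * FreeAlgebra.ι ℝ (.scalar c))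
      (FreeAlgebra.ι ℝ (.scalar (Q.twist a c)) * FreeAlgebra.ι ℝ (.arrow a))

/-- The semilinear path algebra `ℂ_σQ`, as an algebra over `ℝ`. -/
def PathAlg [Fintype V] : Type _ := RingQuot Q.PathRel

instance [Fintype V] : Ring Q.PathAlg := inferInstanceAs (Ring (RingQuot Q.PathRel))

instance [Fintype V] : Algebra ℝ Q.PathAlg := inferInstanceAs (Algebra ℝ (RingQuot Q.PathRel))

/-- The trivial path at a vertex. -/
def e [Fintype V] (i : V) : Q.PathAlg := RingQuot.mkAlgHom ℝ Q.PathRel (FreeAlgebra.ι ℝ (.vertex i))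

/-- The path of length one given by an arrow. -/
def arrow [Fintype V] (a : E) : Q.PathAlg := RingQuot.mkAlgHom ℝ Q.PathRel (FreeAlgebra.ι ℝ (.arrow a))

/-- The set `S` of the elements `s² - e_i` and `s² + e_i`, where `s` is a special loop at the
vertex `i` associated with `x² - 1`, respectively with `x² + 1`. -/
def S [Fintype V] : Set Q.PathAlg :=
  {x | ∃ s : Q.special, Q.sign s = 1 ∧ x = Q.arrow s ^ 2 - Q.e (Q.src s)} ∪
  {x | ∃ s : Q.special, Q.sign s = -1 ∧ x = Q.arrow s ^ 2 + Q.e (Q.src s)}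

/-- The quotient `ℂ_σQ/⟨S⟩` of `ℂ_σQ` by the two-sided ideal generated by `S`. -/
def QuotAlg [Fintype V] : Type _ := RingQuot (fun x y : Q.PathAlg => x ∈ Q.S ∧ y = 0)

instance [Fintype V] : Ring Q.QuotAlg :=
  inferInstanceAs (Ring (RingQuot (fun x y : Q.PathAlg => x ∈ Q.S ∧ y = 0)))

instance [Fintype V] : Algebra ℝ Q.QuotAlg :=
  inferInstanceAs (Algebra ℝ (RingQuot (fun x y : Q.PathAlg => x ∈ Q.S ∧ y = 0)))

open Classical in
/-- The type of a vertex: `ℝ` or `ℍ` if there is a special loop at it which is associated with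
`x² - 1`, respectively with `x² + 1`, and `ℂ` if there is no special loop at it. -/
def kind (i : V) : DivisionKind :=
  if ∃ s : Q.special, Q.src s = i ∧ Q.sign s = 1 then .real
  else if ∃ s : Q.special, Q.src s = i ∧ Q.sign s = -1 then .quaternion
  else .complex

/-- The ordinary arrows which give two arrows of the quiver `Q^b`: both endpoints have type `ℝ`,
or both have type `ℍ`. -/
def IsDouble (a : E) : Prop :=
  (Q.kind (Q.src a) = .real ∧ Q.kind (Q.tgt a) = .real) ∨
  (Q.kind (Q.src a) = .quaternion ∧ Q.kind (Q.tgt a) = .quaternion)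

/-- The arrows of `Q^b`: an arrow `α` for every ordinary arrow `α` of `Q`, and a second arrow `α^i`
for those ordinary arrows `α` whose endpoints both have type `ℝ` or both have type `ℍ`. -/
abbrev BasicArrow : Type _ := {a : E // a ∉ Q.special} ⊕ {a : E // a ∉ Q.special ∧ Q.IsDouble a}

/-- The arrow of `Q` from which an arrow of `Q^b` arises. -/
def BasicArrow.toArrow : Q.BasicArrow → E
  | .inl a => a.1
  | .inr a => a.1

open Classical in
/-- The simple `D`-`D'`-bimodule; for `D = D' = ℂ` it is `ℂ` if the twist is trivial and `ℂ̄` if it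
is the conjugation. -/
def _root_.SimpleBimodule.ofTwist (σ : ℂ ≃ₐ[ℝ] ℂ) : (d d' : DivisionKind) → SimpleBimodule d d'
  | .real, .real => .rr
  | .real, .complex => .rc
  | .real, .quaternion => .rh
  | .complex, .real => .cr
  | .complex, .complex => if σ = AlgEquiv.refl then .cc else .ccBar
  | .complex, .quaternion => .ch
  | .quaternion, .real => .hr
  | .quaternion, .complex => .hc
  | .quaternion, .quaternion => .hh

/-- The modulated quiver `(Q^b, M)`. -/
def basic : ModulatedQuiver V Q.BasicArrow where
  src a := Q.src (BasicArrow.toArrow Q a)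
  tgt a := Q.tgt (BasicArrow.toArrow Q a)
  ring := Q.kind
  bimodule a := SimpleBimodule.ofTwist (Q.twist (BasicArrow.toArrow Q a)) _ _

end SemilinearQuiver

end

/-! Write A for ℂ_σQ/⟨S⟩ and T for the tensor algebra of the modulated quiver. Adjoining to ℂ an
element s with s c = c̄ s gives M₂(ℝ) when s² = 1 and ℍ when s² = -1. Hence the algebra attached to
a vertex of type D is M₂(ℝ) if D = ℝ and D itself otherwise. Put ε_i = (e_i + s_i)/2 at a real
vertex, ε_i = e_i at the others, and ε = ∑ ε_i. Conjugation by the imaginary unit exchanges ε_i and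
e_i - ε_i at a real vertex, so there are elements x_k ∈ Aε_i and y_k ∈ ε_iA with ∑ x_k y_k = e_i
(`vertexCol`, `vertexRow`, `IsVertexRep.sum_vertexCol_mul_vertexRow`). Thus ε is full, and M ↦ εM is
an equivalence of module categories (`IsIdempotentElem.isMoritaEquivalent_corner`).

It remains to identify εAε with T. For an ordinary arrow a, the 2 × 2 matrix U of the elements y_k a
x_l lies over εAε, and the relation a c = σ(c) a becomes σ(c) U = U c, where complex numbers stand
for their matrices over the division algebras at the ends (`IsArrowRep.of_vertexRep`). Solving this
equation type by type shows that such a U amounts to one homomorphism from the simple bimodule of a,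
or to two of them if both ends are real or both are quaternionic. Here `arrowMap` and `arrowMap'`
extract the homomorphisms and `arrowMat` and `arrowMat'` rebuild U; the two passages are mutually
inverse by `IsArrowRep.eq_arrowMap_add`, `arrowMap_of_hom` and `arrowMap'_of_hom`.

The universal property of T then gives a homomorphism φ : T → A with φ(1) = ε
(`exists_hom_quotAlg`), and that of A gives ψ : A → M₂(T) (`exists_hom_matrix`). On generators, and
hence everywhere, ψ(φ(t)) is the matrix with single entry t in position (0, 0). So φ is injective,
and no basis of either algebra is needed. Its image is εAε, because every y_k a x_l is in the image:
this is clear for generators, and passes to products by inserting ∑ x_k y_k = 1 between the factors.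
Neither φ nor ψ need be unital, since φ lands in a corner and the matrices at non-real vertices are
padded by zeros. This is why non-unital homomorphisms are used throughout. -/

noncomputable section

/-! ## Morita equivalence of a full corner -/

namespace IsIdempotentElem

/-! ### Modules over a corner ring, and coinduction from it -/

section Corner

variable {A : Type*} [Ring A] {e : A} (he : IsIdempotentElem e)

/-- The corner element `e * a * e`. -/
def cornerMk (a : A) : he.Corner := ⟨e * a * e, a, rfl⟩

lemma corner_mul_left (c : he.Corner) : e * c.1 = c.1 :=
  ((Subsemigroup.mem_corner_iff he).mp c.2).1

lemma corner_mul_right (c : he.Corner) : c.1 * e = c.1 :=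
  ((Subsemigroup.mem_corner_iff he).mp c.2).2

/-- The part `eM` of an `A`-module `M`. -/
def cornerPart (_ : IsIdempotentElem e) (M : Type*) [AddCommGroup M] [Module A M] :
    AddSubgroup M where
  carrier := {m | e • m = m}
  zero_mem' := smul_zero e
  add_mem' {m n} hm hn := by
    change e • m = m at hm
    change e • n = n at hn
    change e • (m + n) = m + n
    rw [smul_add, hm, hn]
  neg_mem' {m} hm := by
    change e • m = m at hm
    change e • (-m) = -m
    rw [smul_neg, hm]

variable (M : Type*) [AddCommGroup M] [Module A M]

instance : Module he.Corner (he.cornerPart M) where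
  smul c m := ⟨c.1 • m.1, by
    change e • c.1 • m.1 = c.1 • m.1
    rw [← mul_smul, he.corner_mul_left]⟩
  one_smul m := Subtype.ext m.2
  mul_smul c d m := Subtype.ext (mul_smul c.1 d.1 m.1)
  smul_zero c := Subtype.ext (smul_zero c.1)
  smul_add c m n := Subtype.ext (smul_add c.1 m.1 n.1)
  add_smul c d m := Subtype.ext (add_smul c.1 d.1 m.1)
  zero_smul m := Subtype.ext (zero_smul A m.1)

variable {M} in
lemma cornerPart_smul (m : he.cornerPart M) : e • m.1 = m.1 := m.2

lemma cornerPart_mem (m : M) : e • m ∈ he.cornerPart M := by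
  change e • e • m = e • m
  rw [← mul_smul, he.eq]

variable {M} in
/-- An `A`-linear map restricts to the parts cut out by an idempotent. -/
def cornerPartMap {N : Type*} [AddCommGroup N] [Module A N] (f : M →ₗ[A] N) :
    he.cornerPart M →ₗ[he.Corner] he.cornerPart N where
  toFun m := ⟨f m.1, by
    change e • f m.1 = f m.1
    rw [← map_smul, he.cornerPart_smul]⟩
  map_add' m n := Subtype.ext (map_add f m.1 n.1)
  map_smul' c m := Subtype.ext (map_smul f c.1 m.1)

/-- The maps `A → N` which are linear over the corner ring. -/
def coinduced (N : Type*) [AddCommGroup N] [Module he.Corner N] : AddSubgroup (A →+ N) where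
  carrier := {f | ∀ (c : he.Corner) (a : A), f (c.1 * a) = c • f a}
  zero_mem' c a := (smul_zero c).symm
  add_mem' {f g} hf hg c a := by
    rw [AddMonoidHom.add_apply, AddMonoidHom.add_apply, hf, hg, smul_add]
  neg_mem' {f} hf c a := by
    rw [AddMonoidHom.neg_apply, AddMonoidHom.neg_apply, hf, smul_neg]

variable (N : Type*) [AddCommGroup N] [Module he.Corner N]

instance : Module A (he.coinduced N) where
  smul a f := ⟨f.1.comp (AddMonoidHom.mulRight a), fun c b => by
    change f.1 (c.1 * b * a) = c • f.1 (b * a)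
    rw [mul_assoc, f.2]⟩
  one_smul f := Subtype.ext (AddMonoidHom.ext fun b => congrArg f.1 (mul_one b))
  mul_smul a b f := Subtype.ext (AddMonoidHom.ext fun c => congrArg f.1 (mul_assoc c a b).symm)
  smul_zero a := rfl
  smul_add a f g := rfl
  add_smul a b f := Subtype.ext (AddMonoidHom.ext fun c => by
    change f.1 (c * (a + b)) = f.1 (c * a) + f.1 (c * b)
    rw [mul_add, map_add])
  zero_smul f := Subtype.ext (AddMonoidHom.ext fun c => by
    change f.1 (c * 0) = 0
    rw [mul_zero, map_zero])

/-- The corner part of the coinduced module is the original module. -/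
def cornerPartCoinducedEquiv : N ≃ₗ[he.Corner] he.cornerPart (he.coinduced N) where
  toFun n := ⟨⟨{ toFun := fun a => he.cornerMk a • n
                 map_zero' := by
                  have : he.cornerMk 0 = 0 := Subtype.ext (by
                    change e * 0 * e = 0; simp)
                  exact (congrArg (· • n) this).trans (zero_smul he.Corner n)
                 map_add' := fun a b => by
                  have : he.cornerMk (a + b) = he.cornerMk a + he.cornerMk b :=
                    Subtype.ext (by change e * (a + b) * e = e * a * e + e * b * e; noncomm_ring)
                  rw [this, add_smul] }, fun c a => by
      have : he.cornerMk (c.1 * a) = c * he.cornerMk a := Subtype.ext (by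
        change e * (c.1 * a) * e = c.1 * (e * a * e)
        simp only [← mul_assoc, he.corner_mul_left, he.corner_mul_right])
      change he.cornerMk (c.1 * a) • n = c • he.cornerMk a • n
      rw [this, mul_smul]⟩, Subtype.ext (AddMonoidHom.ext fun a => by
        have : he.cornerMk (a * e) = he.cornerMk a := Subtype.ext (by
          change e * (a * e) * e = e * a * e
          simp only [mul_assoc, he.eq])
        change he.cornerMk (a * e) • n = he.cornerMk a • n
        rw [this])⟩
  map_add' n n' := Subtype.ext (Subtype.ext (AddMonoidHom.ext fun a => smul_add _ n n'))
  map_smul' c n := Subtype.ext (Subtype.ext (AddMonoidHom.ext fun a => by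
    have : he.cornerMk (a * c.1) = he.cornerMk a * c := Subtype.ext (by
      change e * (a * c.1) * e = (e * a * e) * c.1
      simp only [mul_assoc, he.corner_mul_left, he.corner_mul_right])
    change he.cornerMk a • c • n = he.cornerMk (a * c.1) • n
    rw [this, mul_smul]))
  invFun f := f.1.1 1
  left_inv n := by
    have : he.cornerMk 1 = 1 := Subtype.ext (by
      change e * 1 * e = e
      rw [mul_one, he.eq])
    change he.cornerMk 1 • n = n
    rw [this, one_smul]
  right_inv f := Subtype.ext (Subtype.ext (AddMonoidHom.ext fun a => by
    -- Being fixed by e gives `h1`, and linearity over the unit e of the corner gives `h2`. So f(a)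
    -- depends only on eae, and f is determined by f(1).
    have h1 : f.1.1 (a * e) = f.1.1 a := DFunLike.congr_fun (congrArg Subtype.val f.2) a
    have h2 : f.1.1 (e * (a * e)) = f.1.1 (a * e) :=
      (f.1.2 1 (a * e)).trans (one_smul _ _)
    change he.cornerMk a • f.1.1 1 = f.1.1 a
    rw [← f.1.2, mul_one, ← h1, ← h2, ← mul_assoc]
    rfl))

end Corner

/-! ### The functor M ↦ eM for a full idempotent -/

section Equivalence

open CategoryTheory
open scoped ModuleCat.Algebra

universe u w

variable {A : Type u} [Ring A] {e : A} (he : IsIdempotentElem e)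

/-- The functor `M ↦ eM`. -/
def cornerFunctor : ModuleCat.{w} A ⥤ ModuleCat.{w} he.Corner where
  obj M := ModuleCat.of he.Corner (he.cornerPart M)
  map f := ModuleCat.ofHom (he.cornerPartMap f.hom)

instance : (he.cornerFunctor : ModuleCat.{u} A ⥤ ModuleCat.{u} he.Corner).EssSurj where
  mem_essImage (N : ModuleCat.{u} he.Corner) :=
    ⟨ModuleCat.of A (he.coinduced N), ⟨(he.cornerPartCoinducedEquiv N).symm.toModuleIso⟩⟩

variable {ι : Type*} [Fintype ι] {x y : ι → A} (h : ∑ i, x i * e * y i = 1)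

include h in
-- Every m equals ∑ x_i e y_i m, so a linear map is determined by its values on the elements e y_i m
-- of eM.
lemma cornerFunctor_faithful : (he.cornerFunctor : ModuleCat.{w} A ⥤ _).Faithful where
  map_injective {M N f g} hfg := by
    ext m
    have key : ∀ k : M →ₗ[A] N, k m = ∑ i, x i • k (e • y i • m) := fun k => by
      simp only [map_smul, ← mul_smul, ← Finset.sum_smul, ← mul_assoc, h, one_smul]
    rw [key, key]
    refine Finset.sum_congr rfl fun i _ => congrArg _ ?_
    exact congrArg Subtype.val
      (LinearMap.congr_fun (congrArg ModuleCat.Hom.hom hfg) ⟨_, he.cornerPart_mem M (y i • m)⟩)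

include h in
-- An extension f of k has to satisfy f(m) = ∑ x_i k(e y_i m), and this formula is taken as the
-- definition. Its linearity follows from a second expansion of m, which moves the scalar out of k
-- in the form e a x_j.
lemma exists_cornerPartMap_eq {M N : Type*} [AddCommGroup M] [Module A M] [AddCommGroup N]
    [Module A N] (k : he.cornerPart M →ₗ[he.Corner] he.cornerPart N) :
    ∃ f : M →ₗ[A] N, he.cornerPartMap f = k := by
  let p (m : M) : he.cornerPart M := ⟨e • m, he.cornerPart_mem M m⟩
  have p_add (m n : M) : p (m + n) = p m + p n := Subtype.ext (smul_add e m n)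
  have p_sum (g : ι → M) : p (∑ i, g i) = ∑ i, p (g i) := by
    exact map_sum (AddMonoidHom.mk' p p_add) g Finset.univ
  have p_smul (a : A) (m : M) : p (a • e • m) = he.cornerMk a • p m := Subtype.ext (by
    change e • a • e • m = (e * a * e) • e • m
    rw [← mul_smul, ← mul_smul, ← mul_smul, mul_assoc _ e e, he.eq, mul_assoc])
  have e_smul (n : he.cornerPart N) : e • n.1 = n.1 := he.cornerPart_smul n
  have hx (m : M) : m = ∑ i, x i • e • y i • m := by
    simp only [← mul_smul, ← Finset.sum_smul, ← mul_assoc, h, one_smul]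
  have hx' (n : N) : n = ∑ i, x i • e • y i • n := by
    simp only [← mul_smul, ← Finset.sum_smul, ← mul_assoc, h, one_smul]
  -- After expanding m, the scalar acts on e y_j m through the corner element e a x_j e, over which
  -- k is linear.
  have key (a : A) (m : M) : (k (p (a • m))).1 = ∑ j, e • a • x j • (k (p (y j • m))).1 := by
    have : a • m = ∑ j, (a * x j) • e • y j • m := by
      conv_lhs => rw [hx m, Finset.smul_sum]
      simp only [mul_smul]
    rw [this, p_sum, map_sum, AddSubgroup.val_finsetSum]
    refine Finset.sum_congr rfl fun j _ => ?_
    rw [p_smul, map_smul]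
    change (e * (a * x j) * e) • (k (p (y j • m))).1 = _
    rw [mul_smul, e_smul, mul_smul, mul_smul]
  refine ⟨{ toFun := fun m => ∑ i, x i • (k (p (y i • m))).1
            map_add' := fun m n => by
              simp only [smul_add, p_add, map_add, AddSubgroup.coe_add, Finset.sum_add_distrib]
            map_smul' := fun a m => ?_ }, ?_⟩
  · rw [RingHom.id_apply]
    have h1 : ∀ i, (k (p (y i • a • m))).1 = ∑ j, e • y i • a • x j • (k (p (y j • m))).1 := by
      intro i
      rw [← mul_smul, key]
      simp only [mul_smul]
    simp only [h1]
    rw [hx' (a • _)]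
    simp only [Finset.smul_sum]
  · refine LinearMap.ext fun m => Subtype.ext ?_
    change ∑ i, x i • (k (p (y i • m.1))).1 = (k m).1
    have h1 : ∀ i, (k (p (y i • m.1))).1 = e • y i • (k m).1 := by
      intro i
      have : p (y i • m.1) = he.cornerMk (y i) • m := Subtype.ext (by
        change e • y i • m.1 = (e * y i * e) • m.1
        rw [mul_smul, mul_smul, he.cornerPart_smul])
      rw [this, map_smul]
      change (e * y i * e) • (k m).1 = _
      rw [mul_smul, mul_smul, e_smul]
    simp only [h1]
    exact (hx' _).symm

include h in
lemma cornerFunctor_full : (he.cornerFunctor : ModuleCat.{w} A ⥤ _).Full where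
  map_surjective {M N} k := by
    obtain ⟨f, hf⟩ := he.exists_cornerPartMap_eq h k.hom
    exact ⟨ModuleCat.ofHom f, ModuleCat.hom_ext hf⟩

include h in
/-- An algebra is Morita equivalent to its corner at a full idempotent. -/
lemma isMoritaEquivalent_corner (R : Type*) [CommRing R] [Algebra R A] :
    IsMoritaEquivalent R A he.Corner := by
  have : (he.cornerFunctor : ModuleCat.{u} A ⥤ ModuleCat.{u} he.Corner).Faithful :=
    he.cornerFunctor_faithful h
  have : (he.cornerFunctor : ModuleCat.{u} A ⥤ ModuleCat.{u} he.Corner).Full :=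
    he.cornerFunctor_full h
  have : (he.cornerFunctor : ModuleCat.{u} A ⥤ ModuleCat.{u} he.Corner).IsEquivalence := {}
  refine ⟨⟨⟨he.cornerFunctor.asEquivalence, ⟨fun {M N} f r => ?_⟩⟩⟩⟩
  refine ModuleCat.hom_ext (LinearMap.ext fun m => Subtype.ext ?_)
  -- The functor respects the actions of R: a scalar r acts on eM through r • e, and e fixes eM.
  change algebraMap R A r • f.hom m.1 = (algebraMap R he.Corner r).1 • f.hom m.1
  change _ = (r • e) • f.hom m.1
  have h1 : f.hom m.1 = e • f.hom m.1 := (he.cornerPartMap f.hom m).2.symm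
  rw [Algebra.smul_def, mul_smul, ← h1]

end Equivalence

end IsIdempotentElem

/-! ## Non-unital homomorphisms and corners -/

namespace IsIdempotentElem

variable {R A B : Type*} [CommRing R] [Ring A] [Algebra R A] [Ring B] [Algebra R B]
  {e : A} (he : IsIdempotentElem e)

include he in
lemma mem_corner_of_mul_eq {a : A} (hl : e * a = a) (hr : a * e = a) :
    a ∈ Subsemigroup.corner e :=
  (Subsemigroup.mem_corner_iff he).mpr ⟨hl, hr⟩

variable (R) in
/-- The inclusion of a corner. -/
def cornerSubtype : he.Corner →ₙₐ[R] A where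
  toFun c := c.1
  map_smul' _ _ := rfl
  map_zero' := rfl
  map_add' _ _ := rfl
  map_mul' _ _ := rfl

/-- A non-unital homomorphism with values in a corner. -/
def codRestrictCorner (f : B →ₙₐ[R] A) (hf : ∀ b, e * f b = f b ∧ f b * e = f b) :
    B →ₙₐ[R] he.Corner where
  toFun b := ⟨f b, he.mem_corner_of_mul_eq (hf b).1 (hf b).2⟩
  map_smul' r b := Subtype.ext (map_smul f r b)
  map_zero' := Subtype.ext (map_zero f)
  map_add' b c := Subtype.ext (map_add f b c)
  map_mul' b c := Subtype.ext (map_mul f b c)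

/-- A linear map with values in a corner. -/
def codRestrictCornerLinear {M : Type*} [AddCommGroup M] [Module R M] (f : M →ₗ[R] A)
    (hf : ∀ m, e * f m = f m ∧ f m * e = f m) : M →ₗ[R] he.Corner where
  toFun m := ⟨f m, he.mem_corner_of_mul_eq (hf m).1 (hf m).2⟩
  map_smul' r m := Subtype.ext (map_smul f r m)
  map_add' m n := Subtype.ext (map_add f m n)

/-- A non-unital isomorphism onto a corner is an isomorphism of algebras. -/
lemma nonempty_algEquiv_corner (f : B →ₙₐ[R] A) (h1 : f 1 = e)
    (hinj : Function.Injective f) (hsurj : ∀ a, ∃ b, f b = e * a * e) :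
    Nonempty (he.Corner ≃ₐ[R] B) := by
  have hf : ∀ b, e * f b = f b ∧ f b * e = f b := fun b => by
    constructor
    · rw [← h1, ← map_mul, one_mul]
    · rw [← h1, ← map_mul, mul_one]
  let g : B →ₐ[R] he.Corner := AlgHom.ofLinearMap (he.codRestrictCorner f hf : B →ₗ[R] he.Corner)
    (Subtype.ext h1) (map_mul (he.codRestrictCorner f hf))
  refine ⟨(AlgEquiv.ofBijective g ⟨fun b c hbc => hinj (congrArg Subtype.val hbc), fun c => ?_⟩).symm⟩
  obtain ⟨b, hb⟩ := hsurj c.1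
  refine ⟨b, Subtype.ext (hb.trans ?_)⟩
  rw [he.corner_mul_left, he.corner_mul_right]

end IsIdempotentElem

/-- The sum of orthogonal idempotents is idempotent, and acts on the summands as a unit. -/
lemma sum_mul_eq_of_orthogonal {V Y : Type*} [Fintype V] [Ring Y] {f : V → Y}
    (hf : ∀ i j, i ≠ j → f i * f j = 0) {i : V} {y : Y} (hy : f i * y = y) :
    (∑ j, f j) * y = y := by
  rw [Finset.sum_mul, Finset.sum_eq_single i _ (by simp), hy]
  intro j _ hj
  rw [← hy, ← mul_assoc, hf j i hj, zero_mul]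

lemma mul_sum_eq_of_orthogonal {V Y : Type*} [Fintype V] [Ring Y] {f : V → Y}
    (hf : ∀ i j, i ≠ j → f i * f j = 0) {i : V} {y : Y} (hy : y * f i = y) :
    y * (∑ j, f j) = y := by
  rw [Finset.mul_sum, Finset.sum_eq_single i _ (by simp), hy]
  intro j _ hj
  rw [← hy, mul_assoc, hf i j hj.symm, mul_zero]

/-! ## The universal property of the tensor algebra of a modulated quiver -/

namespace ModulatedQuiver

open MulOpposite

variable {V E : Type*} (Γ : ModulatedQuiver V E)

/-- The canonical linear map from the generators to the tensor algebra. -/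
def gen : Γ.VertexRing × Γ.ArrowBimodule →ₗ[ℝ] Γ.TensorAlg :=
  (RingQuot.mkAlgHom ℝ (TensorRing.Rel ℝ Γ.VertexRing Γ.ArrowBimodule)).toLinearMap ∘ₗ
    TensorAlgebra.ι ℝ

lemma gen_one : Γ.gen (1, 0) = 1 :=
  (RingQuot.mkAlgHom_rel ℝ TensorRing.Rel.one).trans (map_one _)

lemma gen_mul (b c : Γ.VertexRing) : Γ.gen (b * c, 0) = Γ.gen (b, 0) * Γ.gen (c, 0) :=
  (RingQuot.mkAlgHom_rel ℝ (TensorRing.Rel.mul b c)).trans (map_mul _ _ _)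

lemma gen_left (b : Γ.VertexRing) (m : Γ.ArrowBimodule) :
    Γ.gen (0, b • m) = Γ.gen (b, 0) * Γ.gen (0, m) :=
  (RingQuot.mkAlgHom_rel ℝ (TensorRing.Rel.left b m)).trans (map_mul _ _ _)

lemma gen_right (m : Γ.ArrowBimodule) (b : Γ.VertexRing) :
    Γ.gen (0, op b • m) = Γ.gen (0, m) * Γ.gen (b, 0) :=
  (RingQuot.mkAlgHom_rel ℝ (TensorRing.Rel.right m b)).trans (map_mul _ _ _)

open Classical in
/-- The embedding of the division algebra at a vertex. -/
def vertexHom (i : V) : (Γ.ring i).Carrier →ₙₐ[ℝ] Γ.TensorAlg where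
  toFun b := Γ.gen (Pi.single i b, 0)
  map_smul' r b := by
    rw [MonoidHom.id_apply, ← map_smul, Prod.smul_mk, smul_zero, ← Pi.single_smul]
  map_zero' := by rw [Pi.single_zero]; exact map_zero _
  map_add' b c := by rw [Pi.single_add, ← map_add, Prod.mk_add_mk, add_zero]
  map_mul' b c := by rw [← gen_mul, Pi.single_mul]

open Classical in
/-- The element of the arrow bimodule with a single nonzero component. -/
def arrowSingle (a : E) (m : (Γ.bimodule a).Carrier) : Γ.ArrowBimodule :=
  (Pi.single a m : (a : E) → (Γ.bimodule a).Carrier)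

open Classical in
/-- The embedding of the bimodule at an arrow. -/
def arrowHom (a : E) : (Γ.bimodule a).Carrier →ₗ[ℝ] Γ.TensorAlg where
  toFun m := Γ.gen (0, Γ.arrowSingle a m)
  map_smul' r m := by
    rw [RingHom.id_apply, ← map_smul, Prod.smul_mk, smul_zero]
    exact congrArg _ (congrArg _ (Pi.single_smul (f := fun a => (Γ.bimodule a).Carrier) a r m))
  map_add' m n := by
    rw [← map_add, Prod.mk_add_mk, add_zero]
    exact congrArg _ (congrArg _ (Pi.single_add (f := fun a => (Γ.bimodule a).Carrier) a m n))

lemma vertexHom_mul_vertexHom {i j : V} (h : i ≠ j) (b : (Γ.ring i).Carrier)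
    (c : (Γ.ring j).Carrier) : Γ.vertexHom i b * Γ.vertexHom j c = 0 := by
  classical
  have : (Pi.single i b : Γ.VertexRing) * Pi.single j c = 0 := by
    ext k
    by_cases hk : k = i
    · subst hk
      simp [Pi.single_eq_of_ne h]
    · simp [Pi.single_eq_of_ne hk]
  change Γ.gen _ * Γ.gen _ = 0
  rw [← gen_mul, this]
  exact map_zero _

lemma arrowHom_left (a : E) (b : (Γ.ring (Γ.tgt a)).Carrier) (m : (Γ.bimodule a).Carrier) :
    Γ.arrowHom a (b • m) = Γ.vertexHom (Γ.tgt a) b * Γ.arrowHom a m := by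
  classical
  refine Eq.trans (congrArg (fun x => Γ.gen (0, x)) (funext fun c => ?_)) (Γ.gen_left _ _)
  change (Pi.single a (b • m) : (a : E) → (Γ.bimodule a).Carrier) c =
    (Pi.single (Γ.tgt a) b : Γ.VertexRing) (Γ.tgt c) •
      (Pi.single a m : (a : E) → (Γ.bimodule a).Carrier) c
  by_cases hc : c = a
  · subst hc
    simp
  · simp [Pi.single_eq_of_ne hc]

lemma arrowHom_right (a : E) (m : (Γ.bimodule a).Carrier) (b : (Γ.ring (Γ.src a)).Carrier) :
    Γ.arrowHom a (op b • m) = Γ.arrowHom a m * Γ.vertexHom (Γ.src a) b := by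
  classical
  refine Eq.trans (congrArg (fun x => Γ.gen (0, x)) (funext fun c => ?_)) (Γ.gen_right _ _)
  change (Pi.single a (op b • m) : (a : E) → (Γ.bimodule a).Carrier) c =
    op ((Pi.single (Γ.src a) b : Γ.VertexRing) (Γ.src c)) •
      (Pi.single a m : (a : E) → (Γ.bimodule a).Carrier) c
  by_cases hc : c = a
  · subst hc
    simp
  · simp [Pi.single_eq_of_ne hc]

lemma gen_eq_sum [Fintype V] [Fintype E] (b : Γ.VertexRing) (m : Γ.ArrowBimodule) :
    Γ.gen (b, m) = ∑ i, Γ.vertexHom i (b i) + ∑ a, Γ.arrowHom a (m a) := by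
  classical
  have h1 : ∑ i, Γ.vertexHom i (b i) = Γ.gen (b, 0) := by
    change ∑ i, (Γ.gen ∘ₗ LinearMap.inl ℝ _ _) (Pi.single i (b i)) = _
    rw [← map_sum, Finset.univ_sum_single]
    rfl
  have h2 : ∑ a, Γ.arrowHom a (m a) = Γ.gen (0, m) := by
    change ∑ a, (Γ.gen ∘ₗ LinearMap.inr ℝ _ _) (Γ.arrowSingle a (m a)) = _
    rw [← map_sum]
    exact congrArg _ (Finset.univ_sum_single (M := fun a => (Γ.bimodule a).Carrier) m)
  rw [h1, h2, ← map_add, Prod.mk_add_mk, add_zero, zero_add]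

lemma sum_vertexHom_one [Fintype V] : ∑ i, Γ.vertexHom i 1 = 1 := by
  classical
  change ∑ i, (Γ.gen ∘ₗ LinearMap.inl ℝ _ _) (Pi.single i 1) = 1
  rw [← map_sum]
  refine Eq.trans (congrArg _ ?_) Γ.gen_one
  exact Finset.univ_sum_single (fun i => (1 : (Γ.ring i).Carrier))

/-- A property which is stable under sums and products holds on the whole tensor algebra if it
holds for the elements of the vertex algebras and the arrow bimodules. -/
lemma tensorAlg_induction [Fintype V] [Finite E] {P : Γ.TensorAlg → Prop} (zero : P 0)
    (add : ∀ x y, P x → P y → P (x + y)) (mul : ∀ x y, P x → P y → P (x * y))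
    (vertex : ∀ i b, P (Γ.vertexHom i b)) (arrow : ∀ a m, P (Γ.arrowHom a m))
    (x : Γ.TensorAlg) : P x := by
  have := Fintype.ofFinite E
  have hgen : ∀ y, P (Γ.gen y) := fun y => by
    rw [show y = (y.1, y.2) from rfl, gen_eq_sum]
    refine add _ _ ?_ ?_
    · exact Finset.sum_induction _ P add zero fun i _ => vertex i _
    · exact Finset.sum_induction _ P add zero fun i _ => arrow i _
  obtain ⟨y, rfl⟩ := RingQuot.mkAlgHom_surjective ℝ (TensorRing.Rel ℝ Γ.VertexRing Γ.ArrowBimodule) x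
  induction y using TensorAlgebra.induction with
  | algebraMap r =>
    have : algebraMap ℝ Γ.TensorAlg r = Γ.gen (r • 1, 0) := by
      rw [Algebra.algebraMap_eq_smul_one, ← Γ.gen_one, ← map_smul, Prod.smul_mk, smul_zero]
    rw [AlgHom.commutes]
    exact this ▸ hgen _
  | ι m => exact hgen m
  | mul a b ha hb => rw [map_mul]; exact mul _ _ ha hb
  | add a b ha hb => rw [map_add]; exact add _ _ ha hb

section Lift

variable {Γ} [Fintype V] [Finite E] {Y : Type*} [Ring Y] [Algebra ℝ Y]
  (v : ∀ i, (Γ.ring i).Carrier →ₙₐ[ℝ] Y) (w : ∀ a, (Γ.bimodule a).Carrier →ₗ[ℝ] Y)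
  (hv : ∀ i j, i ≠ j → ∀ b c, v i b * v j c = 0)
  (hl : ∀ a b m, w a (b • m) = v (Γ.tgt a) b * w a m)
  (hr : ∀ a m b, w a (op b • m) = w a m * v (Γ.src a) b)

include hv hl hr in
-- The map on generators is the sum of all components. By orthogonality only matching end points
-- contribute to a product, and there `hl` and `hr` apply.
lemma exists_algHom (h1 : ∑ i, v i 1 = 1) : ∃ φ : Γ.TensorAlg →ₐ[ℝ] Y,
    (∀ i b, φ (Γ.vertexHom i b) = v i b) ∧ ∀ a m, φ (Γ.arrowHom a m) = w a m := by
  classical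
  have := Fintype.ofFinite E
  let f : Γ.VertexRing × Γ.ArrowBimodule →ₗ[ℝ] Y :=
    { toFun := fun x => ∑ i, v i (x.1 i) + ∑ a, w a (x.2 a)
      map_add' := fun x y => by
        have h1 : ∀ i, v i ((x + y).1 i) = v i (x.1 i) + v i (y.1 i) := fun i => map_add _ _ _
        have h2 : ∀ a, w a ((x + y).2 a) = w a (x.2 a) + w a (y.2 a) := fun i => map_add _ _ _
        simp only [h1, h2, Finset.sum_add_distrib]
        abel
      map_smul' := fun r x => by
        have h1 : ∀ i, v i ((r • x).1 i) = r • v i (x.1 i) := fun i => map_smul _ _ _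
        have h2 : ∀ a, w a ((r • x).2 a) = r • w a (x.2 a) := fun i => map_smul _ _ _
        simp only [h1, h2, RingHom.id_apply, smul_add, Finset.smul_sum] }
  have f1 (b : Γ.VertexRing) : f (b, 0) = ∑ i, v i (b i) := by
    change ∑ i, v i (b i) + ∑ a, w a 0 = _
    simp only [map_zero, Finset.sum_const_zero, add_zero]
  have f2 (m : Γ.ArrowBimodule) : f (0, m) = ∑ a, w a (m a) := by
    change ∑ i, v i 0 + ∑ a, w a (m a) = _
    simp only [map_zero, Finset.sum_const_zero, zero_add]
  have f3 (i : V) (b : (Γ.ring i).Carrier) : f (Pi.single i b, 0) = v i b := by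
    rw [f1, Finset.sum_eq_single i, Pi.single_eq_same]
    · intro j _ hj
      rw [Pi.single_eq_of_ne hj, map_zero]
    · simp
  have f4 (a : E) (m : (Γ.bimodule a).Carrier) : f (0, Γ.arrowSingle a m) = w a m := by
    rw [f2, Finset.sum_eq_single a]
    · exact congrArg _ (Pi.single_eq_same (M := fun a => (Γ.bimodule a).Carrier) a m)
    · intro j _ hj
      exact (congrArg _ (Pi.single_eq_of_ne (M := fun a => (Γ.bimodule a).Carrier) hj m)).trans (map_zero _)
    · simp
  -- The unit at the target of a can be split off from w a m on the left, and any other vertex kills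
  -- it.
  have vw (i : V) (a : E) (h : i ≠ Γ.tgt a) (b) (m) : v i b * w a m = 0 := by
    rw [← one_smul (Γ.ring (Γ.tgt a)).Carrier m, hl, ← mul_assoc, hv _ _ h, zero_mul]
  have wv (i : V) (a : E) (h : i ≠ Γ.src a) (b) (m) : w a m * v i b = 0 := by
    rw [← one_smul (Γ.ring (Γ.src a)).Carrierᵐᵒᵖ m]
    change w a (op 1 • m) * _ = _
    rw [hr, mul_assoc, hv _ _ h.symm, mul_zero]
  let g : Γ.TensorAlg →ₐ[ℝ] Y := RingQuot.liftAlgHom ℝ ⟨TensorAlgebra.lift ℝ f, by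
    rintro x y (_ | ⟨b, c⟩ | ⟨b, m⟩ | ⟨m, b⟩)
    · simp only [TensorAlgebra.lift_ι_apply, map_one, f1]
      exact h1
    · simp only [TensorAlgebra.lift_ι_apply, map_mul, f1]
      rw [Finset.sum_mul]
      refine Finset.sum_congr rfl fun i _ => ?_
      rw [Finset.mul_sum, Finset.sum_eq_single i, Pi.mul_apply, map_mul]
      · intro j _ hj
        exact hv i j hj.symm _ _
      · simp
    · simp only [TensorAlgebra.lift_ι_apply, map_mul, f1, f2]
      rw [Finset.mul_sum]
      refine Finset.sum_congr rfl fun a _ => ?_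
      rw [Finset.sum_mul, Finset.sum_eq_single (Γ.tgt a)]
      · exact hl a _ _
      · intro j _ hj
        exact vw j a hj _ _
      · simp
    · simp only [TensorAlgebra.lift_ι_apply, map_mul, f1, f2]
      rw [Finset.sum_mul]
      refine Finset.sum_congr rfl fun a _ => ?_
      rw [Finset.mul_sum, Finset.sum_eq_single (Γ.src a)]
      · exact hr a _ _
      · intro j _ hj
        exact wv j a hj _ _
      · simp⟩
  have hg (x) : g (Γ.gen x) = f x :=
    (RingQuot.liftAlgHom_mkAlgHom_apply ℝ _ _ _).trans (TensorAlgebra.lift_ι_apply f x)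
  exact ⟨g, fun i b => (hg _).trans (f3 i b), fun a m => (hg _).trans (f4 a m)⟩

include hv hl hr in
-- The elements v i 1 are orthogonal idempotents, and all given maps take values in the corner of Y
-- at their sum. There the unital version applies.
lemma exists_nonUnitalAlgHom : ∃ φ : Γ.TensorAlg →ₙₐ[ℝ] Y,
    (∀ i b, φ (Γ.vertexHom i b) = v i b) ∧ ∀ a m, φ (Γ.arrowHom a m) = w a m := by
  have orth : ∀ i j, i ≠ j → v i 1 * v j 1 = 0 := fun i j h => hv i j h 1 1
  have hvl (i) (b) : v i 1 * v i b = v i b := by rw [← map_mul, one_mul]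
  have hvr (i) (b) : v i b * v i 1 = v i b := by rw [← map_mul, mul_one]
  have he : IsIdempotentElem (∑ i, v i 1) := by
    change _ * (∑ i, v i 1) = _
    rw [Finset.mul_sum]
    exact Finset.sum_congr rfl fun i _ => sum_mul_eq_of_orthogonal orth (hvl i 1)
  have hw (a m) : (∑ i, v i 1) * w a m = w a m ∧ w a m * (∑ i, v i 1) = w a m := by
    constructor
    · refine sum_mul_eq_of_orthogonal orth (i := Γ.tgt a) ?_
      rw [← hl, one_smul]
    · refine mul_sum_eq_of_orthogonal orth (i := Γ.src a) ?_
      rw [← hr]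
      exact congrArg _ (one_smul (Γ.ring (Γ.src a)).Carrierᵐᵒᵖ m)
  obtain ⟨φ, h1, h2⟩ := exists_algHom (Γ := Γ) (Y := he.Corner)
    (fun i => he.codRestrictCorner (v i) fun b =>
      ⟨sum_mul_eq_of_orthogonal orth (hvl i b), mul_sum_eq_of_orthogonal orth (hvr i b)⟩)
    (fun a => he.codRestrictCornerLinear (w a) (hw a))
    (fun i j h b c => Subtype.ext (hv i j h b c))
    (fun a b m => Subtype.ext (hl a b m)) (fun a m b => Subtype.ext (hr a m b))
    (Subtype.ext ((map_sum (he.cornerSubtype ℝ) _ _).trans rfl))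
  exact ⟨(he.cornerSubtype ℝ).comp (φ : Γ.TensorAlg →ₙₐ[ℝ] he.Corner),
    fun i b => congrArg Subtype.val (h1 i b), fun a m => congrArg Subtype.val (h2 a m)⟩

end Lift

end ModulatedQuiver

/-! ## The universal property of a semilinear path algebra with special loops -/

namespace SemilinearQuiver

variable {V E : Type*} [Fintype V] (Q : SemilinearQuiver V E)

/-- The canonical homomorphism from the free algebra on the generators. -/
def quotMk : FreeAlgebra ℝ (Gen V E) →ₐ[ℝ] Q.QuotAlg :=
  (RingQuot.mkAlgHom ℝ (fun x y : Q.PathAlg => x ∈ Q.S ∧ y = 0)).comp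
    (RingQuot.mkAlgHom ℝ Q.PathRel)

lemma quotMk_surjective : Function.Surjective Q.quotMk :=
  (RingQuot.mkAlgHom_surjective ℝ _).comp (RingQuot.mkAlgHom_surjective ℝ _)

variable {Q} in
lemma quotMk_rel {x y : FreeAlgebra ℝ (Gen V E)} (h : Q.PathRel x y) : Q.quotMk x = Q.quotMk y :=
  congrArg (RingQuot.mkAlgHom ℝ (fun x y : Q.PathAlg => x ∈ Q.S ∧ y = 0))
    (RingQuot.mkAlgHom_rel ℝ h)

/-- The image of a complex number in `ℂ_σQ/⟨S⟩`. -/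
def scalarElt (c : ℂ) : Q.QuotAlg := Q.quotMk (FreeAlgebra.ι ℝ (.scalar c))

/-- The image of a trivial path in `ℂ_σQ/⟨S⟩`. -/
def vertexElt (i : V) : Q.QuotAlg := Q.quotMk (FreeAlgebra.ι ℝ (.vertex i))

/-- The image of an arrow in `ℂ_σQ/⟨S⟩`. -/
def arrowElt (a : E) : Q.QuotAlg := Q.quotMk (FreeAlgebra.ι ℝ (.arrow a))

lemma scalarElt_add (c d : ℂ) : Q.scalarElt (c + d) = Q.scalarElt c + Q.scalarElt d :=
  (quotMk_rel (.scalar_add c d)).trans (map_add _ _ _)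

lemma scalarElt_mul (c d : ℂ) : Q.scalarElt (c * d) = Q.scalarElt c * Q.scalarElt d :=
  (quotMk_rel (.scalar_mul c d)).trans (map_mul _ _ _)

lemma scalarElt_ofReal (r : ℝ) : Q.scalarElt r = algebraMap ℝ Q.QuotAlg r :=
  (quotMk_rel (.scalar_real r)).trans (AlgHom.commutes _ _)

lemma scalarElt_one : Q.scalarElt 1 = 1 := by
  simpa using Q.scalarElt_ofReal 1

lemma vertexElt_mul_self (i : V) : Q.vertexElt i * Q.vertexElt i = Q.vertexElt i :=
  (map_mul _ _ _).symm.trans (quotMk_rel (.vertex_mul_self i))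

lemma vertexElt_mul_vertexElt {i j : V} (h : i ≠ j) : Q.vertexElt i * Q.vertexElt j = 0 :=
  (map_mul _ _ _).symm.trans ((quotMk_rel (.vertex_mul_of_ne i j h)).trans (map_zero _))

lemma sum_vertexElt : ∑ i, Q.vertexElt i = 1 :=
  (map_sum _ _ _).symm.trans ((quotMk_rel .sum_vertex).trans (map_one _))

lemma tgt_mul_arrowElt (a : E) : Q.vertexElt (Q.tgt a) * Q.arrowElt a = Q.arrowElt a :=
  (map_mul _ _ _).symm.trans (quotMk_rel (.tgt_mul_arrow a))

lemma arrowElt_mul_src (a : E) : Q.arrowElt a * Q.vertexElt (Q.src a) = Q.arrowElt a :=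
  (map_mul _ _ _).symm.trans (quotMk_rel (.arrow_mul_src a))

lemma vertexElt_mul_scalarElt (i : V) (c : ℂ) :
    Q.vertexElt i * Q.scalarElt c = Q.scalarElt c * Q.vertexElt i :=
  (map_mul _ _ _).symm.trans ((quotMk_rel (.vertex_mul_scalar i c)).trans (map_mul _ _ _))

lemma arrowElt_mul_scalarElt (a : E) (c : ℂ) :
    Q.arrowElt a * Q.scalarElt c = Q.scalarElt (Q.twist a c) * Q.arrowElt a :=
  (map_mul _ _ _).symm.trans ((quotMk_rel (.arrow_mul_scalar a c)).trans (map_mul _ _ _))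

/-- The homomorphism `c ↦ c e_i` at a vertex `i`. -/
def vertexHom (i : V) : ℂ →ₙₐ[ℝ] Q.QuotAlg where
  toFun c := Q.scalarElt c * Q.vertexElt i
  map_smul' r c := by
    rw [MonoidHom.id_apply, Complex.real_smul, scalarElt_mul, scalarElt_ofReal, Algebra.smul_def,
      mul_assoc]
  map_zero' := by
    have := Q.scalarElt_ofReal 0
    rw [Complex.ofReal_zero, map_zero] at this
    rw [this, zero_mul]
  map_add' c d := by rw [scalarElt_add, add_mul]
  map_mul' c d := by
    rw [scalarElt_mul, mul_assoc, mul_assoc, ← mul_assoc (Q.vertexElt i),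
      vertexElt_mul_scalarElt, mul_assoc, vertexElt_mul_self]

lemma vertexHom_one (i : V) : Q.vertexHom i 1 = Q.vertexElt i := by
  change Q.scalarElt 1 * _ = _
  rw [scalarElt_one, one_mul]

lemma sum_vertexHom_one : ∑ i, Q.vertexHom i 1 = 1 := by
  simp only [vertexHom_one, sum_vertexElt]

lemma sum_vertexHom (c : ℂ) : ∑ i, Q.vertexHom i c = Q.scalarElt c := by
  change ∑ i, Q.scalarElt c * Q.vertexElt i = _
  rw [← Finset.mul_sum, sum_vertexElt, mul_one]

lemma vertexHom_mul_vertexHom {i j : V} (h : i ≠ j) (c d : ℂ) :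
    Q.vertexHom i c * Q.vertexHom j d = 0 := by
  change Q.scalarElt c * Q.vertexElt i * (Q.scalarElt d * Q.vertexElt j) = 0
  rw [mul_assoc, ← mul_assoc (Q.vertexElt i), vertexElt_mul_scalarElt, mul_assoc _ (Q.vertexElt i),
    vertexElt_mul_vertexElt Q h, mul_zero, mul_zero]

lemma arrowElt_mul_vertexHom (a : E) (c : ℂ) :
    Q.arrowElt a * Q.vertexHom (Q.src a) c = Q.vertexHom (Q.tgt a) (Q.twist a c) * Q.arrowElt a := by
  change Q.arrowElt a * (Q.scalarElt c * Q.vertexElt _) =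
    Q.scalarElt (Q.twist a c) * Q.vertexElt _ * Q.arrowElt a
  rw [← mul_assoc, arrowElt_mul_scalarElt, mul_assoc, arrowElt_mul_src, mul_assoc,
    tgt_mul_arrowElt]

lemma vertexHom_one_mul_arrowElt (a : E) :
    Q.vertexHom (Q.tgt a) 1 * Q.arrowElt a = Q.arrowElt a := by
  rw [vertexHom_one, tgt_mul_arrowElt]

lemma arrowElt_mul_vertexHom_one (a : E) :
    Q.arrowElt a * Q.vertexHom (Q.src a) 1 = Q.arrowElt a := by
  rw [vertexHom_one, arrowElt_mul_src]

lemma arrowElt_mul_self_of_sign_eq_one (s : Q.special) (hs : Q.sign s = 1) :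
    Q.arrowElt s * Q.arrowElt s = Q.vertexHom (Q.src s) 1 := by
  have : RingQuot.mkAlgHom ℝ (fun x y : Q.PathAlg => x ∈ Q.S ∧ y = 0)
      (Q.arrow s ^ 2 - Q.e (Q.src s)) = 0 :=
    (RingQuot.mkAlgHom_rel ℝ ⟨Or.inl ⟨s, hs, rfl⟩, rfl⟩).trans (map_zero _)
  rw [map_sub, map_pow, sub_eq_zero, sq] at this
  rw [vertexHom_one]
  exact this

lemma arrowElt_mul_self_of_sign_eq_neg_one (s : Q.special) (hs : Q.sign s = -1) :
    Q.arrowElt s * Q.arrowElt s = -Q.vertexHom (Q.src s) 1 := by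
  have : RingQuot.mkAlgHom ℝ (fun x y : Q.PathAlg => x ∈ Q.S ∧ y = 0)
      (Q.arrow s ^ 2 + Q.e (Q.src s)) = 0 :=
    (RingQuot.mkAlgHom_rel ℝ ⟨Or.inr ⟨s, hs, rfl⟩, rfl⟩).trans (map_zero _)
  rw [map_add, map_pow, add_eq_zero_iff_eq_neg, sq] at this
  rw [vertexHom_one]
  exact this

/-- A property which is stable under sums and products holds on the whole algebra if it holds for
the elements `c e_i` and the arrows. -/
lemma quotAlg_induction {P : Q.QuotAlg → Prop} (zero : P 0)
    (add : ∀ x y, P x → P y → P (x + y)) (mul : ∀ x y, P x → P y → P (x * y))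
    (vertex : ∀ i c, P (Q.vertexHom i c)) (arrow : ∀ a, P (Q.arrowElt a))
    (x : Q.QuotAlg) : P x := by
  have hs (c : ℂ) : P (Q.scalarElt c) := by
    rw [← sum_vertexHom]
    exact Finset.sum_induction _ P add zero fun i _ => vertex i _
  obtain ⟨y, rfl⟩ := Q.quotMk_surjective x
  induction y with
  | grade0 r =>
    rw [AlgHom.commutes, ← scalarElt_ofReal]
    exact hs r
  | grade1 x =>
    cases x with
    | scalar c => exact hs c
    | vertex i =>
      have := vertex i 1
      rwa [vertexHom_one] at this
    | arrow a => exact arrow a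
  | mul a b ha hb => rw [map_mul]; exact mul _ _ ha hb
  | add a b ha hb => rw [map_add]; exact add _ _ ha hb

section Lift

variable {Q} {Y : Type*} [Ring Y] [Algebra ℝ Y] (z : V → (ℂ →ₙₐ[ℝ] Y)) (x : E → Y)
  (hz : ∀ i j, i ≠ j → ∀ c d, z i c * z j d = 0)
  (hl : ∀ a, z (Q.tgt a) 1 * x a = x a)
  (hx : ∀ a c, x a * z (Q.src a) c = z (Q.tgt a) (Q.twist a c) * x a)
  (hp : ∀ s : Q.special, Q.sign s = 1 → x s * x s = z (Q.src s) 1)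
  (hm : ∀ s : Q.special, Q.sign s = -1 → x s * x s = -z (Q.src s) 1)

include hz hl hx hp hm in
lemma exists_algHom (h1 : ∑ i, z i 1 = 1) : ∃ ψ : Q.QuotAlg →ₐ[ℝ] Y,
    (∀ i c, ψ (Q.vertexHom i c) = z i c) ∧ ∀ a, ψ (Q.arrowElt a) = x a := by
  have hzz (i : V) (c d : ℂ) : z i c * z i d = z i (c * d) := (map_mul _ _ _).symm
  have hsum (i : V) (c : ℂ) : (∑ j, z j c) * z i 1 = z i c := by
    rw [Finset.sum_mul, Finset.sum_eq_single i, hzz, mul_one]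
    · intro j _ hj
      exact hz j i hj _ _
    · simp
  have hsum' (i : V) (c : ℂ) : z i 1 * (∑ j, z j c) = z i c := by
    rw [Finset.mul_sum, Finset.sum_eq_single i, hzz, one_mul]
    · intro j _ hj
      exact hz i j hj.symm _ _
    · simp
  have hr (a : E) : x a * z (Q.src a) 1 = x a := by
    rw [hx, map_one, hl]
  -- A scalar has components at all vertices, so c must go to the sum of the z_i(c).
  let g : Gen V E → Y := fun
    | .scalar c => ∑ i, z i c
    | .vertex i => z i 1
    | .arrow a => x a
  let f : Q.PathAlg →ₐ[ℝ] Y := RingQuot.liftAlgHom ℝ ⟨FreeAlgebra.lift ℝ g, by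
    rintro _ _ (r | ⟨c, d⟩ | ⟨c, d⟩ | i | ⟨i, j, h⟩ | _ | a | a | ⟨i, c⟩ | ⟨a, c⟩) <;>
      simp only [map_mul, map_add, map_sum, map_one, map_zero, FreeAlgebra.lift_ι_apply,
        AlgHom.commutes, g, Finset.sum_add_distrib]
    · rw [Algebra.algebraMap_eq_smul_one, ← h1, Finset.smul_sum]
      refine Finset.sum_congr rfl fun i _ => ?_
      rw [← map_smul, Complex.real_smul, mul_one]
    · rw [Finset.mul_sum]
      refine Finset.sum_congr rfl fun i _ => ?_
      conv_rhs => rw [← one_mul d, ← hzz, ← mul_assoc, hsum, hzz]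
      rw [hzz]
    · rw [hzz, one_mul]
    · exact hz i j h _ _
    · exact h1
    · exact hl a
    · exact hr a
    · rw [hsum, hsum']
    -- Splitting off the units at the two ends of the arrow reduces the sums over vertices to the
    -- single terms related by `hx`.
    · rw [← hr a, mul_assoc, hsum', hr, hx, ← hl a, ← mul_assoc, ← mul_assoc, hsum, hzz, mul_one]⟩
  have hf (y) : f (RingQuot.mkAlgHom ℝ Q.PathRel y) = FreeAlgebra.lift ℝ g y :=
    RingQuot.liftAlgHom_mkAlgHom_apply ℝ _ _ _
  have hfa (a : E) : f (Q.arrow a) = x a := (hf _).trans (FreeAlgebra.lift_ι_apply _ _)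
  have hfe (i : V) : f (Q.e i) = z i 1 := (hf _).trans (FreeAlgebra.lift_ι_apply _ _)
  let k : Q.QuotAlg →ₐ[ℝ] Y := RingQuot.liftAlgHom ℝ ⟨f, by
    rintro _ _ ⟨⟨s, hs, rfl⟩ | ⟨s, hs, rfl⟩, rfl⟩
    · rw [map_sub, map_pow, hfa, hfe, sq, hp s hs, sub_self, map_zero]
    · rw [map_add, map_pow, hfa, hfe, sq, hm s hs, neg_add_cancel, map_zero]⟩
  have hk (y) : k (Q.quotMk y) = FreeAlgebra.lift ℝ g y :=
    (RingQuot.liftAlgHom_mkAlgHom_apply ℝ _ _ _).trans (hf y)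
  refine ⟨k, fun i c => ?_, fun a => (hk _).trans (FreeAlgebra.lift_ι_apply _ _)⟩
  change k (Q.scalarElt c * Q.vertexElt i) = _
  rw [map_mul, scalarElt, vertexElt, hk, hk, FreeAlgebra.lift_ι_apply, FreeAlgebra.lift_ι_apply]
  exact hsum i c

include hz hl hx hp hm in
-- As for the tensor algebra, the unital version is applied in the corner of Y at the sum of the
-- orthogonal idempotents z i 1.
lemma exists_nonUnitalAlgHom : ∃ ψ : Q.QuotAlg →ₙₐ[ℝ] Y,
    (∀ i c, ψ (Q.vertexHom i c) = z i c) ∧ ∀ a, ψ (Q.arrowElt a) = x a := by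
  have orth : ∀ i j, i ≠ j → z i 1 * z j 1 = 0 := fun i j h => hz i j h 1 1
  have hzl (i) (b) : z i 1 * z i b = z i b := by rw [← map_mul, one_mul]
  have hzr (i) (b) : z i b * z i 1 = z i b := by rw [← map_mul, mul_one]
  have he : IsIdempotentElem (∑ i, z i 1) := by
    change _ * (∑ i, z i 1) = _
    rw [Finset.mul_sum]
    exact Finset.sum_congr rfl fun i _ => sum_mul_eq_of_orthogonal orth (hzl i 1)
  have hxl (a) : (∑ i, z i 1) * x a = x a := sum_mul_eq_of_orthogonal orth (hl a)
  have hxr (a) : x a * (∑ i, z i 1) = x a := by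
    refine mul_sum_eq_of_orthogonal orth (i := Q.src a) ?_
    rw [hx, map_one, hl]
  obtain ⟨ψ, h1, h2⟩ := exists_algHom (Q := Q) (Y := he.Corner)
    (fun i => he.codRestrictCorner (z i) fun b =>
      ⟨sum_mul_eq_of_orthogonal orth (hzl i b), mul_sum_eq_of_orthogonal orth (hzr i b)⟩)
    (fun a => ⟨x a, he.mem_corner_of_mul_eq (hxl a) (hxr a)⟩)
    (fun i j h b c => Subtype.ext (hz i j h b c))
    (fun a => Subtype.ext (hl a)) (fun a c => Subtype.ext (hx a c))
    (fun s hs => Subtype.ext (hp s hs)) (fun s hs => Subtype.ext (hm s hs))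
    (Subtype.ext ((map_sum (he.cornerSubtype ℝ) _ _).trans rfl))
  exact ⟨(he.cornerSubtype ℝ).comp (ψ : Q.QuotAlg →ₙₐ[ℝ] he.Corner),
    fun i b => congrArg Subtype.val (h1 i b), fun a => congrArg Subtype.val (h2 a)⟩

end Lift

end SemilinearQuiver

/-! ## The algebras at the vertices -/

section VertexAlgebra

variable {Y : Type*} [Ring Y] [Algebra ℝ Y]

/-- The quaternion `j`. -/
def quaternionJ : ℍ[ℝ] := ⟨0, 0, 1, 0⟩

lemma re_quaternionJ : quaternionJ.re = 0 := rfl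
lemma imI_quaternionJ : quaternionJ.imI = 0 := rfl
lemma imJ_quaternionJ : quaternionJ.imJ = 1 := rfl
lemma imK_quaternionJ : quaternionJ.imK = 0 := rfl

lemma quaternionJ_mul_self : quaternionJ * quaternionJ = -1 := by
  ext <;> simp [re_quaternionJ, imI_quaternionJ, imJ_quaternionJ, imK_quaternionJ]

lemma quaternionJ_mul_ofComplex (c : ℂ) :
    quaternionJ * Quaternion.ofComplex c =
      Quaternion.ofComplex (starRingEnd ℂ c) * quaternionJ := by
  ext <;> simp [re_quaternionJ, imI_quaternionJ, imJ_quaternionJ, imK_quaternionJ]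

lemma ofComplex_add_ofComplex_mul_quaternionJ (q : ℍ[ℝ]) :
    Quaternion.ofComplex ⟨q.re, q.imI⟩ + Quaternion.ofComplex ⟨q.imJ, q.imK⟩ * quaternionJ = q := by
  ext <;> simp [re_quaternionJ, imI_quaternionJ, imJ_quaternionJ, imK_quaternionJ]

/-- A homomorphism `z` from `ℂ` to a ring and an element `s` which satisfies the relations of the
special loop at a vertex of the given kind; there is no loop at a complex vertex. -/
structure IsVertexRep (d : DivisionKind) (z : ℂ →ₙₐ[ℝ] Y) (s : Y) : Prop where
  one_mul : z 1 * s = s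
  mul_scalar : ∀ c, s * z c = z (starRingEnd ℂ c) * s
  sq : match d with
    | .real => s * s = z 1
    | .complex => s = 0
    | .quaternion => s * s = -z 1

variable (z : ℂ →ₙₐ[ℝ] Y) (s : Y)

lemma nonUnitalAlgHom_eq_re_add_im (c : ℂ) : z c = c.re • z 1 + c.im • z Complex.I := by
  rw [← map_smul, ← map_smul, ← map_add]
  congr 1
  apply Complex.ext <;> simp

lemma map_I_mul_map_I : z Complex.I * z Complex.I = -z 1 := by
  rw [← map_mul, Complex.I_mul_I, map_neg]

/-- The embedding of the division algebra at a vertex in the corner `εAε`. -/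
def vertexEmb : (d : DivisionKind) → d.Carrier →ₗ[ℝ] Y
  | .real => show ℝ →ₗ[ℝ] Y from LinearMap.toSpanSingleton ℝ Y ((1 / 2 : ℝ) • (z 1 + s))
  | .complex => show ℂ →ₗ[ℝ] Y from z
  | .quaternion => show ℍ[ℝ] →ₗ[ℝ] Y from
      { toFun := fun q => z ⟨q.re, q.imI⟩ + z ⟨q.imJ, q.imK⟩ * s
        map_add' := fun p q => by
          have h1 : (⟨(p + q).re, (p + q).imI⟩ : ℂ) = ⟨p.re, p.imI⟩ + ⟨q.re, q.imI⟩ := by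
            apply Complex.ext <;> simp
          have h2 : (⟨(p + q).imJ, (p + q).imK⟩ : ℂ) = ⟨p.imJ, p.imK⟩ + ⟨q.imJ, q.imK⟩ := by
            apply Complex.ext <;> simp
          rw [h1, h2, map_add, map_add, add_mul]
          abel
        map_smul' := fun r q => by
          have h1 : (⟨(r • q).re, (r • q).imI⟩ : ℂ) = r • ⟨q.re, q.imI⟩ := by
            apply Complex.ext <;> simp
          have h2 : (⟨(r • q).imJ, (r • q).imK⟩ : ℂ) = r • ⟨q.imJ, q.imK⟩ := by
            apply Complex.ext <;> simp
          rw [h1, h2, map_smul, map_smul, smul_mul_assoc, RingHom.id_apply, smul_add] }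

lemma vertexEmb_quaternion (q : ℍ[ℝ]) :
    vertexEmb z s .quaternion q = z ⟨q.re, q.imI⟩ + z ⟨q.imJ, q.imK⟩ * s := rfl

/-- The elements `x₀, x₁` of `Aε` with `x₀ y₀ + x₁ y₁ = e`. -/
def vertexCol : (d : DivisionKind) → Fin 2 → Y
  | .real => ![vertexEmb z s .real 1, z Complex.I * vertexEmb z s .real 1]
  | .complex => ![vertexEmb z s .complex 1, 0]
  | .quaternion => ![vertexEmb z s .quaternion 1, 0]

/-- The elements `y₀, y₁` of `εA` with `x₀ y₀ + x₁ y₁ = e`. -/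
def vertexRow : (d : DivisionKind) → Fin 2 → Y
  | .real => ![vertexEmb z s .real 1, -(vertexEmb z s .real 1 * z Complex.I)]
  | .complex => ![vertexEmb z s .complex 1, 0]
  | .quaternion => ![vertexEmb z s .quaternion 1, 0]

/-- The embedding of a ring in the upper left entry of the matrices. -/
def cornerSingle (K : Type*) [Ring K] [Algebra ℝ K] : K →ₙₐ[ℝ] Matrix (Fin 2) (Fin 2) K where
  toFun := Matrix.single 0 0
  map_zero' := Matrix.single_zero 0 0
  map_add' := Matrix.single_add 0 0
  map_mul' a b := by rw [Matrix.single_mul_single_same]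
  map_smul' r a := (Matrix.smul_single r 0 0 a).symm

/-- The matrices by which the complex numbers act at a vertex, padded by zeros. -/
def scalarMat : (d : DivisionKind) → ℂ →ₙₐ[ℝ] Matrix (Fin 2) (Fin 2) d.Carrier
  | .real => show ℂ →ₙₐ[ℝ] Matrix (Fin 2) (Fin 2) ℝ from
      { toFun := fun c => !![c.re, -c.im; c.im, c.re]
        map_zero' := by ext i j; fin_cases i <;> fin_cases j <;> simp
        map_add' := fun c c' => by ext i j; fin_cases i <;> fin_cases j <;> simp [add_comm]
        map_mul' := fun c c' => by
          ext i j; fin_cases i <;> fin_cases j <;> simp <;> ring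
        map_smul' := fun r c => by ext i j; fin_cases i <;> fin_cases j <;> simp }
  | .complex => show ℂ →ₙₐ[ℝ] Matrix (Fin 2) (Fin 2) ℂ from cornerSingle ℂ
  | .quaternion => show ℂ →ₙₐ[ℝ] Matrix (Fin 2) (Fin 2) ℍ[ℝ] from
      (cornerSingle ℍ[ℝ]).comp (Quaternion.ofComplex : ℂ →ₙₐ[ℝ] ℍ[ℝ])

/-- The matrix by which the special loop acts at a vertex, padded by zeros. -/
def loopMat : (d : DivisionKind) → Matrix (Fin 2) (Fin 2) d.Carrier
  | .real => show Matrix (Fin 2) (Fin 2) ℝ from !![1, 0; 0, -1]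
  | .complex => show Matrix (Fin 2) (Fin 2) ℂ from 0
  | .quaternion => show Matrix (Fin 2) (Fin 2) ℍ[ℝ] from Matrix.single 0 0 quaternionJ

lemma scalarMat_real (c : ℂ) :
    scalarMat .real c = (!![c.re, -c.im; c.im, c.re] : Matrix (Fin 2) (Fin 2) ℝ) := rfl

lemma scalarMat_complex (c : ℂ) :
    scalarMat .complex c = (Matrix.single 0 0 c : Matrix (Fin 2) (Fin 2) ℂ) := rfl

lemma scalarMat_quaternion (c : ℂ) : scalarMat .quaternion c =
    (Matrix.single 0 0 (Quaternion.ofComplex c) : Matrix (Fin 2) (Fin 2) ℍ[ℝ]) := rfl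

lemma vertexEmb_real_one : vertexEmb z s .real 1 = (1 / 2 : ℝ) • (z 1 + s) :=
  one_smul ℝ _

lemma vertexEmb_complex_one : vertexEmb z s .complex 1 = z 1 := rfl

lemma vertexEmb_quaternion_one : vertexEmb z s .quaternion 1 = z 1 := by
  change z 1 + z 0 * s = z 1
  rw [map_zero, zero_mul, add_zero]

namespace IsVertexRep

variable {z s} {d : DivisionKind}

lemma mul_one (h : IsVertexRep d z s) : s * z 1 = s := by
  rw [h.mul_scalar, map_one, h.one_mul]

/-- The idempotent `ε = (e + s) / 2` at a real vertex satisfies `ε² = ε`, `ε s = s ε = ε`,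
`ε i = i (e - ε)`. -/
lemma real_relations (h : IsVertexRep .real z s) {p : Y} (hp : p = (1 / 2 : ℝ) • (z 1 + s)) :
    p * p = p ∧ p * s = p ∧ s * p = p ∧ z 1 * p = p ∧ p * z 1 = p ∧
      p * z Complex.I = z Complex.I - z Complex.I * p ∧ p * (z Complex.I * p) = 0 ∧
      s * (z Complex.I * p) = -(z Complex.I * p) := by
  have hsq : s * s = z 1 := h.sq
  have hee : z 1 * z 1 = z 1 := by rw [← map_mul, _root_.mul_one]
  have hei : z 1 * z Complex.I = z Complex.I := by rw [← map_mul, _root_.one_mul]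
  have hie : z Complex.I * z 1 = z Complex.I := by rw [← map_mul, _root_.mul_one]
  have hsi : s * z Complex.I = -(z Complex.I * s) := by
    rw [h.mul_scalar, Complex.conj_I, map_neg, neg_mul]
  have h2 : (1 / 2 : ℝ) • ((1 / 2 : ℝ) • ((z 1 + s) * (z 1 + s))) = p := by
    rw [add_mul, mul_add, mul_add, hee, hsq, h.one_mul, h.mul_one, hp]
    module
  have h3 : s * p = p := by
    rw [hp, mul_smul_comm, mul_add, hsq, h.mul_one, add_comm]
  have h4 : p * z Complex.I = z Complex.I - z Complex.I * p := by
    rw [hp, smul_mul_assoc, mul_smul_comm, add_mul, mul_add, hei, hie, hsi]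
    module
  have h5 : p * p = p := by
    conv_lhs => rw [hp]
    rw [smul_mul_smul_comm, mul_smul, h2]
  refine ⟨h5, ?_, h3, ?_, ?_, h4, ?_, ?_⟩
  · rw [hp, smul_mul_assoc, add_mul, hsq, h.one_mul, add_comm]
  · rw [hp, mul_smul_comm, mul_add, hee, h.one_mul]
  · rw [hp, smul_mul_assoc, add_mul, hee, h.mul_one]
  · rw [← mul_assoc, h4, sub_mul, mul_assoc, h5, sub_self]
  · rw [← mul_assoc, hsi, neg_mul, mul_assoc, h3]

/-- At a real vertex this is the idempotency of ε. At a quaternionic one, s plays the role of j and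
satisfies the same commutation rule with ℂ. -/
lemma vertexEmb_mul (h : IsVertexRep d z s) (b c : d.Carrier) :
    vertexEmb z s d (b * c) = vertexEmb z s d b * vertexEmb z s d c := by
  cases d with
  | real =>
    have h1 := (h.real_relations rfl).1
    have key : ∀ p q : ℝ, (p * q) • ((1 / 2 : ℝ) • (z 1 + s)) =
        (p • ((1 / 2 : ℝ) • (z 1 + s))) * (q • ((1 / 2 : ℝ) • (z 1 + s))) := by
      intro p q
      rw [smul_mul_smul_comm, h1]
    exact key b c
  | complex => exact map_mul z b c
  | quaternion =>
    have hsq : s * s = -z 1 := h.sq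
    have key : ∀ p q : ℍ[ℝ], z ⟨(p * q).re, (p * q).imI⟩ + z ⟨(p * q).imJ, (p * q).imK⟩ * s =
        (z ⟨p.re, p.imI⟩ + z ⟨p.imJ, p.imK⟩ * s) * (z ⟨q.re, q.imI⟩ + z ⟨q.imJ, q.imK⟩ * s) := by
      intro p q
      -- In complex coordinates, (a + b j)(c + d j) = (a c - b d̄) + (a d + b c̄) j.
      have h1 : (⟨(p * q).re, (p * q).imI⟩ : ℂ) = ⟨p.re, p.imI⟩ * ⟨q.re, q.imI⟩ -
          ⟨p.imJ, p.imK⟩ * starRingEnd ℂ ⟨q.imJ, q.imK⟩ := by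
        apply Complex.ext <;> simp <;> ring
      have h2 : (⟨(p * q).imJ, (p * q).imK⟩ : ℂ) = ⟨p.re, p.imI⟩ * ⟨q.imJ, q.imK⟩ +
          ⟨p.imJ, p.imK⟩ * starRingEnd ℂ ⟨q.re, q.imI⟩ := by
        apply Complex.ext <;> simp <;> ring
      have h3 : ∀ c c' : ℂ, z c * s * (z c' * s) = -(z (c * starRingEnd ℂ c')) := by
        intro c c'
        rw [mul_assoc, ← mul_assoc s, h.mul_scalar, mul_assoc, hsq, ← mul_assoc, mul_neg,
          ← map_mul, ← map_mul, _root_.mul_one]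
      have h4 : ∀ c c' : ℂ, z c * s * z c' = z (c * starRingEnd ℂ c') * s := by
        intro c c'
        rw [mul_assoc, h.mul_scalar, ← mul_assoc, map_mul]
      simp only [h1, h2, map_sub, map_add, add_mul, mul_add, h3, h4, map_mul z ⟨p.re, p.imI⟩,
        mul_assoc (z ⟨p.re, p.imI⟩)]
      abel
    exact key b c

lemma vertexEmb_one_mul (h : IsVertexRep d z s) (b : d.Carrier) :
    vertexEmb z s d 1 * vertexEmb z s d b = vertexEmb z s d b := by
  rw [← h.vertexEmb_mul, _root_.one_mul]

lemma map_one_mul_vertexEmb_one (h : IsVertexRep d z s) :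
    z 1 * vertexEmb z s d 1 = vertexEmb z s d 1 := by
  cases d with
  | real =>
    rw [vertexEmb_real_one]
    exact (h.real_relations rfl).2.2.2.1
  | complex => rw [vertexEmb_complex_one, ← map_mul, _root_.mul_one]
  | quaternion => rw [vertexEmb_quaternion_one, ← map_mul, _root_.mul_one]

lemma vertexEmb_one_mul_map_one (h : IsVertexRep d z s) :
    vertexEmb z s d 1 * z 1 = vertexEmb z s d 1 := by
  cases d with
  | real =>
    rw [vertexEmb_real_one]
    exact (h.real_relations rfl).2.2.2.2.1
  | complex => rw [vertexEmb_complex_one, ← map_mul, _root_.mul_one]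
  | quaternion => rw [vertexEmb_quaternion_one, ← map_mul, _root_.mul_one]

/-- The embedding of the division algebra as a homomorphism. -/
def emb (h : IsVertexRep d z s) : d.Carrier →ₙₐ[ℝ] Y where
  toFun := vertexEmb z s d
  map_zero' := map_zero (vertexEmb z s d)
  map_add' := map_add (vertexEmb z s d)
  map_smul' := map_smul (vertexEmb z s d)
  map_mul' := h.vertexEmb_mul

lemma emb_apply (h : IsVertexRep d z s) (b : d.Carrier) : h.emb b = vertexEmb z s d b := rfl

lemma vertexCol_mul_emb_one (h : IsVertexRep d z s) (k : Fin 2) :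
    vertexCol z s d k * h.emb 1 = vertexCol z s d k := by
  cases d <;> fin_cases k <;>
    simp [vertexCol, emb_apply, mul_assoc, h.vertexEmb_one_mul]

lemma vertexCol_zero (h : IsVertexRep d z s) : vertexCol z s d 0 = h.emb 1 := by
  cases d <;> rfl

lemma vertexRow_zero (h : IsVertexRep d z s) : vertexRow z s d 0 = h.emb 1 := by
  cases d <;> rfl

lemma map_one_mul_vertexCol (h : IsVertexRep d z s) (k : Fin 2) :
    z 1 * vertexCol z s d k = vertexCol z s d k := by
  cases d <;> fin_cases k <;>
    simp [vertexCol, ← mul_assoc, ← map_mul, h.map_one_mul_vertexEmb_one]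

lemma vertexRow_mul_map_one (h : IsVertexRep d z s) (k : Fin 2) :
    vertexRow z s d k * z 1 = vertexRow z s d k := by
  cases d <;> fin_cases k <;>
    simp [vertexRow, mul_assoc, ← map_mul, h.vertexEmb_one_mul_map_one]

/-- At a real vertex ε i = i (e - ε), so the second summand -i ε i equals e - ε and complements the
first, which is ε. -/
lemma sum_vertexCol_mul_vertexRow (h : IsVertexRep d z s) :
    ∑ k, vertexCol z s d k * vertexRow z s d k = z 1 := by
  rw [Fin.sum_univ_two]
  cases d with
  | real =>
    obtain ⟨h1, h2, h3, h4, h5, h6, h7, h8⟩ := h.real_relations (vertexEmb_real_one z s)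
    change vertexEmb z s .real 1 * vertexEmb z s .real 1 +
      z Complex.I * vertexEmb z s .real 1 * -(vertexEmb z s .real 1 * z Complex.I) = z 1
    rw [mul_neg, mul_assoc, ← mul_assoc (vertexEmb z s .real 1), h1, h6, mul_sub, ← mul_assoc,
      map_I_mul_map_I, neg_mul, h4]
    abel
  | complex =>
    simp [vertexCol, vertexRow, vertexEmb_complex_one, ← map_mul]
  | quaternion =>
    simp [vertexCol, vertexRow, vertexEmb_quaternion_one, ← map_mul]

/-- The elements x_k, y_l turn the vertex algebra into matrices over the division algebra. At a real
vertex ε c ε = Re(c) ε, because ε i ε = 0, and the other entries follow by multiplying c by i.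
Elsewhere only the entry (0, 0) is not padding. -/
lemma vertexRow_mul_map_mul_vertexCol (h : IsVertexRep d z s) (c : ℂ) (k l : Fin 2) :
    vertexRow z s d k * z c * vertexCol z s d l = h.emb (scalarMat d c k l) := by
  cases d with
  | real =>
    obtain ⟨h1, h2, h3, h4, h5, h6, h7, h8⟩ := h.real_relations (vertexEmb_real_one z s)
    have hr (r : ℝ) : h.emb r = r • vertexEmb z s .real 1 := by
      rw [vertexEmb_real_one]; rfl
    rw [scalarMat_real, nonUnitalAlgHom_eq_re_add_im]
    generalize hP : vertexEmb z s .real 1 = P at *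
    have h9 : ∀ a, z Complex.I * (z Complex.I * a) = -(z 1 * a) := fun a => by
      rw [← mul_assoc, map_I_mul_map_I, neg_mul]
    have h10 : ∀ a, z 1 * (z Complex.I * a) = z Complex.I * a := fun a => by
      rw [← mul_assoc, ← map_mul, _root_.one_mul]
    fin_cases k <;> fin_cases l <;>
      simp [vertexRow, vertexCol, hr, hP, add_mul, mul_add, mul_assoc, h4, h1, h7, h9, h10]
  | complex =>
    rw [scalarMat_complex]
    fin_cases k <;> fin_cases l <;>
      simp [vertexRow, vertexCol, vertexEmb_complex_one, ← map_mul]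
    · rfl
    all_goals exact (map_zero h.emb).symm
  | quaternion =>
    rw [scalarMat_quaternion]
    fin_cases k <;> fin_cases l <;>
      simp [vertexRow, vertexCol, vertexEmb_quaternion_one, ← map_mul]
    · have key : ∀ q : ℍ[ℝ], q = Quaternion.ofComplex c → z c = vertexEmb z s .quaternion q := by
        rintro _ rfl
        rw [vertexEmb_quaternion]
        have h1 : (⟨(Quaternion.ofComplex c).imJ, (Quaternion.ofComplex c).imK⟩ : ℂ) = 0 := rfl
        rw [h1, map_zero, zero_mul, add_zero]
        rfl
      exact key _ rfl
    all_goals exact (map_zero h.emb).symm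

/-- At a real vertex s fixes ε and anticommutes with i, which gives the eigenvalues 1 and -1 on ε
and iε. At a quaternionic vertex s is the image of j. -/
lemma vertexRow_mul_loop_mul_vertexCol (h : IsVertexRep d z s) (k l : Fin 2) :
    vertexRow z s d k * s * vertexCol z s d l = h.emb (loopMat d k l) := by
  cases d with
  | real =>
    obtain ⟨h1, h2, h3, h4, h5, h6, h7, h8⟩ := h.real_relations (vertexEmb_real_one z s)
    have hr (r : ℝ) : h.emb r = r • vertexEmb z s .real 1 := by
      rw [vertexEmb_real_one]; rfl
    generalize hP : vertexEmb z s .real 1 = P at *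
    have h9 : ∀ a, z Complex.I * (z Complex.I * a) = -(z 1 * a) := fun a => by
      rw [← mul_assoc, map_I_mul_map_I, neg_mul]
    change _ = h.emb ((!![1, 0; 0, -1] : Matrix (Fin 2) (Fin 2) ℝ) k l)
    fin_cases k <;> fin_cases l <;>
      simp [vertexRow, vertexCol, hr, hP, mul_assoc, h4, h1, h3, h7, h8, h9]
  | complex =>
    have hs : vertexRow z s .complex k * s = 0 := by
      rw [show s = 0 from h.sq, mul_zero]
    rw [hs, zero_mul]
    exact (map_zero h.emb).symm
  | quaternion =>
    change _ = h.emb ((Matrix.single 0 0 quaternionJ : Matrix (Fin 2) (Fin 2) ℍ[ℝ]) k l)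
    fin_cases k <;> fin_cases l <;>
      simp [vertexRow, vertexCol, vertexEmb_quaternion_one, h.one_mul, h.mul_one]
    · change s = z 0 + z 1 * s
      rw [map_zero, h.one_mul, zero_add]
    all_goals exact (map_zero h.emb).symm

section Naturality

variable {Y' : Type*} [Ring Y'] [Algebra ℝ Y'] (f : Y →ₙₐ[ℝ] Y')

lemma map (h : IsVertexRep d z s) : IsVertexRep d (f.comp z) (f s) where
  one_mul := by rw [NonUnitalAlgHom.comp_apply, ← map_mul, h.one_mul]
  mul_scalar c := by
    rw [NonUnitalAlgHom.comp_apply, NonUnitalAlgHom.comp_apply, ← map_mul, ← map_mul, h.mul_scalar]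
  sq := by
    have := h.sq
    cases d with
    | real => exact (map_mul f s s).symm.trans (congrArg f this)
    | complex => exact (congrArg f this).trans (map_zero f)
    | quaternion => exact (map_mul f s s).symm.trans ((congrArg f this).trans (map_neg f _))

end Naturality

end IsVertexRep

section Naturality

variable {Y' : Type*} [Ring Y'] [Algebra ℝ Y'] (f : Y →ₙₐ[ℝ] Y')

/-- The constructions at a vertex use only z and s, so they commute with homomorphisms. This lets
their images under A → M₂(T) be computed in matrices over the division algebra. -/
lemma map_vertexEmb {d : DivisionKind} (b : d.Carrier) :
    f (vertexEmb z s d b) = vertexEmb (f.comp z) (f s) d b := by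
  cases d with
  | real =>
    exact (map_smul f (show ℝ from b) _).trans (congrArg _ ((map_smul f (1 / 2 : ℝ) _).trans
      (congrArg _ (map_add f _ _))))
  | complex => rfl
  | quaternion => exact (map_add f _ _).trans (congrArg _ (map_mul f _ _))

lemma map_vertexCol (d : DivisionKind) (k : Fin 2) :
    f (vertexCol z s d k) = vertexCol (f.comp z) (f s) d k := by
  cases d <;> fin_cases k <;> simp [vertexCol, map_vertexEmb]

lemma map_vertexRow (d : DivisionKind) (k : Fin 2) :
    f (vertexRow z s d k) = vertexRow (f.comp z) (f s) d k := by
  cases d <;> fin_cases k <;> simp [vertexRow, map_vertexEmb]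

end Naturality

/-! ### The model by matrices -/

/-- The matrices over the division algebra are themselves a representation of the vertex relations.
Every vertex of the model over T is obtained from this one by a change of entries. -/
lemma isVertexRep_scalarMat (d : DivisionKind) : IsVertexRep d (scalarMat d) (loopMat d) where
  one_mul := by
    cases d with
    | real =>
      have : (!![(1 : ℂ).re, -(1 : ℂ).im; (1 : ℂ).im, (1 : ℂ).re] : Matrix (Fin 2) (Fin 2) ℝ) *
          !![1, 0; 0, -1] = !![1, 0; 0, -1] := by simp
      exact this
    | complex => exact mul_zero _
    | quaternion =>
      have : (Matrix.single 0 0 (Quaternion.ofComplex 1) : Matrix (Fin 2) (Fin 2) ℍ[ℝ]) *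
          Matrix.single 0 0 quaternionJ = Matrix.single 0 0 quaternionJ := by
        rw [Matrix.single_mul_single_same, map_one, one_mul]
      exact this
  mul_scalar c := by
    cases d with
    | real =>
      have : (!![1, 0; 0, -1] : Matrix (Fin 2) (Fin 2) ℝ) * !![c.re, -c.im; c.im, c.re] =
          !![(starRingEnd ℂ c).re, -(starRingEnd ℂ c).im; (starRingEnd ℂ c).im,
            (starRingEnd ℂ c).re] * !![1, 0; 0, -1] := by simp
      exact this
    | complex => exact (zero_mul _).trans (mul_zero _).symm
    | quaternion =>
      have : (Matrix.single 0 0 quaternionJ : Matrix (Fin 2) (Fin 2) ℍ[ℝ]) *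
          Matrix.single 0 0 (Quaternion.ofComplex c) =
          Matrix.single 0 0 (Quaternion.ofComplex (starRingEnd ℂ c)) *
            Matrix.single 0 0 quaternionJ := by
        rw [Matrix.single_mul_single_same, Matrix.single_mul_single_same,
          quaternionJ_mul_ofComplex]
      exact this
  sq := by
    cases d with
    | real =>
      have : (!![1, 0; 0, -1] : Matrix (Fin 2) (Fin 2) ℝ) * !![1, 0; 0, -1] =
          !![(1 : ℂ).re, -(1 : ℂ).im; (1 : ℂ).im, (1 : ℂ).re] := by simp
      exact this
    | complex => rfl
    | quaternion =>
      have : (Matrix.single 0 0 quaternionJ : Matrix (Fin 2) (Fin 2) ℍ[ℝ]) *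
          Matrix.single 0 0 quaternionJ = -Matrix.single 0 0 (Quaternion.ofComplex 1) := by
        rw [Matrix.single_mul_single_same, quaternionJ_mul_self, map_one, ← Matrix.single_neg]
      exact this

lemma vertexEmb_scalarMat (d : DivisionKind) (b : d.Carrier) :
    vertexEmb (scalarMat d) (loopMat d) d b = Matrix.single 0 0 b := by
  cases d with
  | real =>
    have key : ∀ r : ℝ, r • ((1 / 2 : ℝ) • ((!![(1 : ℂ).re, -(1 : ℂ).im; (1 : ℂ).im, (1 : ℂ).re] +
        !![1, 0; 0, -1] : Matrix (Fin 2) (Fin 2) ℝ))) = Matrix.single 0 0 r := by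
      intro r
      ext i j
      fin_cases i <;> fin_cases j <;> simp
      ring
    exact key b
  | complex => rfl
  | quaternion =>
    have key : ∀ q : ℍ[ℝ], (Matrix.single 0 0 (Quaternion.ofComplex ⟨q.re, q.imI⟩) +
        Matrix.single 0 0 (Quaternion.ofComplex ⟨q.imJ, q.imK⟩) *
        Matrix.single 0 0 quaternionJ : Matrix (Fin 2) (Fin 2) ℍ[ℝ]) = Matrix.single 0 0 q := by
      intro q
      rw [Matrix.single_mul_single_same, ← Matrix.single_add,
        ofComplex_add_ofComplex_mul_quaternionJ]
    exact key b

lemma scalarMat_one_apply_zero (d : DivisionKind) : scalarMat d 1 0 0 = 1 := by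
  cases d with
  | real => rfl
  | complex => rfl
  | quaternion => exact map_one Quaternion.ofComplex

/-- In the matrix model x_k is the matrix unit in position (k, 0). The factor `scalarMat d 1 k k` is
1, except at the padded index k = 1 of a non-real vertex, where it is 0 and so covers x_1 = 0. -/
lemma vertexCol_scalarMat (d : DivisionKind) (k : Fin 2) :
    vertexCol (scalarMat d) (loopMat d) d k = Matrix.single k 0 (scalarMat d 1 k k) := by
  have h0 : vertexCol (scalarMat d) (loopMat d) d 0 = Matrix.single 0 0 (scalarMat d 1 0 0) := by
    rw [(isVertexRep_scalarMat d).vertexCol_zero, IsVertexRep.emb_apply, vertexEmb_scalarMat,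
      scalarMat_one_apply_zero]
  fin_cases k
  · exact h0
  cases d with
  | real =>
    change scalarMat .real Complex.I * vertexEmb (scalarMat .real) (loopMat .real) .real 1 = _
    rw [vertexEmb_scalarMat]
    have : (!![Complex.I.re, -Complex.I.im; Complex.I.im, Complex.I.re] :
        Matrix (Fin 2) (Fin 2) ℝ) * Matrix.single 0 0 1 = Matrix.single 1 0 1 := by
      ext i j
      fin_cases i <;> fin_cases j <;> simp [Matrix.mul_apply, Matrix.single]
    exact this
  | complex => exact (Matrix.single_zero 1 0).symm
  | quaternion => exact (Matrix.single_zero 1 0).symm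

lemma vertexRow_scalarMat (d : DivisionKind) (k : Fin 2) :
    vertexRow (scalarMat d) (loopMat d) d k = Matrix.single 0 k (scalarMat d 1 k k) := by
  have h0 : vertexRow (scalarMat d) (loopMat d) d 0 = Matrix.single 0 0 (scalarMat d 1 0 0) := by
    rw [(isVertexRep_scalarMat d).vertexRow_zero, IsVertexRep.emb_apply, vertexEmb_scalarMat,
      scalarMat_one_apply_zero]
  fin_cases k
  · exact h0
  cases d with
  | real =>
    change -(vertexEmb (scalarMat .real) (loopMat .real) .real 1 * scalarMat .real Complex.I) = _
    rw [vertexEmb_scalarMat]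
    have : -(Matrix.single 0 0 1 * (!![Complex.I.re, -Complex.I.im; Complex.I.im, Complex.I.re] :
        Matrix (Fin 2) (Fin 2) ℝ)) = Matrix.single 0 1 1 := by
      ext i j
      fin_cases i <;> fin_cases j <;> simp [Matrix.mul_apply, Matrix.single]
    exact this
  | complex => exact (Matrix.single_zero 0 1).symm
  | quaternion => exact (Matrix.single_zero 0 1).symm

end VertexAlgebra

/-! ## The bimodules at the arrows -/

section ArrowBimodule

open MulOpposite

variable {C : Type*} [Ring C] [Algebra ℝ C]

/-- The automorphism of `ℂ` over `ℝ` which is the conjugation if `b` is true. -/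
def twistBy : Bool → (ℂ ≃ₐ[ℝ] ℂ)
  | false => AlgEquiv.refl
  | true => Complex.conjAe

/-- The sign by which `twistBy b` acts on `i`. -/
def twistSign : Bool → ℝ
  | false => 1
  | true => -1

lemma twistSign_mul_self (b : Bool) : twistSign b * twistSign b = 1 := by
  cases b <;> simp [twistSign]

lemma twistBy_I (b : Bool) : twistBy b Complex.I = twistSign b • Complex.I := by
  cases b <;> simp [twistBy, twistSign]

/-- A matrix over a ring `C` which satisfies the relations of an arrow whose end points have the
given kinds, where the algebras at the end points are mapped to `C` by `f` and `g`. -/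
structure IsArrowRep (b : Bool) {d d' : DivisionKind} (f : d.Carrier →ₙₐ[ℝ] C)
    (g : d'.Carrier →ₙₐ[ℝ] C) (u : Matrix (Fin 2) (Fin 2) C) : Prop where
  rel : ∀ c, (scalarMat d (twistBy b c)).map f * u = u * (scalarMat d' c).map g
  one_mul : (scalarMat d 1).map f * u = u

/-- The linear map `m ↦ x g(m)`. -/
def constMul {K : Type*} [Ring K] [Algebra ℝ K] (x : C) (g : K →ₙₐ[ℝ] C) : K →ₗ[ℝ] C :=
  (LinearMap.mulLeft ℝ x).comp (g : K →ₗ[ℝ] C)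

/-- The linear map `m ↦ f(m) x`. -/
def mulConst {K : Type*} [Ring K] [Algebra ℝ K] (f : K →ₙₐ[ℝ] C) (x : C) : K →ₗ[ℝ] C :=
  (LinearMap.mulRight ℝ x).comp (f : K →ₗ[ℝ] C)

/-- The element `x` or `f(j) x`. -/
def shiftLeft (f : ℍ[ℝ] →ₙₐ[ℝ] C) (x : C) : Bool → C
  | false => x
  | true => f quaternionJ * x

/-- The element `x` or `x g(j)`. -/
def shiftRight (x : C) (g : ℍ[ℝ] →ₙₐ[ℝ] C) : Bool → C
  | false => x
  | true => x * g quaternionJ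

/-- The map from the row space determined by the image `x` of `(1, 0)`. -/
def rowMap (f : ℂ →ₙₐ[ℝ] C) (x : C) (g : ℍ[ℝ] →ₙₐ[ℝ] C) : Matrix (Fin 1) (Fin 2) ℂ →ₗ[ℝ] C where
  toFun m := f (m 0 0) * x + f (m 0 1) * (x * g quaternionJ)
  map_add' m n := by
    rw [Matrix.add_apply, Matrix.add_apply, map_add, map_add, add_mul, add_mul]
    abel
  map_smul' r m := by
    rw [Matrix.smul_apply, Matrix.smul_apply, map_smul, map_smul, smul_mul_assoc, smul_mul_assoc,
      RingHom.id_apply, smul_add]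

/-- The map from the column space determined by the image `x` of `(1, 0)`. -/
def colMap (f : ℍ[ℝ] →ₙₐ[ℝ] C) (x : C) (g : ℂ →ₙₐ[ℝ] C) : Matrix (Fin 2) (Fin 1) ℂ →ₗ[ℝ] C where
  toFun m := x * g (m 0 0) - f quaternionJ * x * g (m 1 0)
  map_add' m n := by
    rw [Matrix.add_apply, Matrix.add_apply, map_add, map_add, mul_add, mul_add]
    abel
  map_smul' r m := by
    rw [Matrix.smul_apply, Matrix.smul_apply, map_smul, map_smul, mul_smul_comm, mul_smul_comm,
      RingHom.id_apply, smul_sub]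

/-- The element `x - j x j`, which commutes with `ℍ` if `x` commutes with `ℂ`. -/
def quaternionAverage (f : ℍ[ℝ] →ₙₐ[ℝ] C) (x : C) (g : ℍ[ℝ] →ₙₐ[ℝ] C) : C :=
  x - f quaternionJ * x * g quaternionJ

/-- The bimodule homomorphism from the simple bimodule at an arrow determined by a matrix which
satisfies the relations of the arrow. -/
def arrowMap (b : Bool) (u : Matrix (Fin 2) (Fin 2) C) :
    {d d' : DivisionKind} → (X : SimpleBimodule d d') → (d.Carrier →ₙₐ[ℝ] C) →
      (d'.Carrier →ₙₐ[ℝ] C) → (X.Carrier →ₗ[ℝ] C)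
  | _, _, .rr, _, _ => show ℝ →ₗ[ℝ] C from LinearMap.toSpanSingleton ℝ C (u 0 0)
  | _, _, .rc, _, g => show ℂ →ₗ[ℝ] C from constMul (u 0 0) (show ℂ →ₙₐ[ℝ] C from g)
  | _, _, .rh, _, g => show ℍ[ℝ] →ₗ[ℝ] C from constMul (u 0 0) (show ℍ[ℝ] →ₙₐ[ℝ] C from g)
  | _, _, .cr, f, _ => show ℂ →ₗ[ℝ] C from mulConst (show ℂ →ₙₐ[ℝ] C from f) (u 0 0)
  | _, _, .cc, f, _ => show ℂ →ₗ[ℝ] C from mulConst (show ℂ →ₙₐ[ℝ] C from f) (u 0 0)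
  | _, _, .ccBar, f, _ => show ℂ →ₗ[ℝ] C from mulConst (show ℂ →ₙₐ[ℝ] C from f) (u 0 0)
  | _, _, .ch, f, g => show Matrix (Fin 1) (Fin 2) ℂ →ₗ[ℝ] C from
      rowMap (show ℂ →ₙₐ[ℝ] C from f) (shiftRight (u 0 0) (show ℍ[ℝ] →ₙₐ[ℝ] C from g) b)
        (show ℍ[ℝ] →ₙₐ[ℝ] C from g)
  | _, _, .hr, f, _ => show ℍ[ℝ] →ₗ[ℝ] C from mulConst (show ℍ[ℝ] →ₙₐ[ℝ] C from f) (u 0 0)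
  | _, _, .hc, f, g => show Matrix (Fin 2) (Fin 1) ℂ →ₗ[ℝ] C from
      colMap (show ℍ[ℝ] →ₙₐ[ℝ] C from f) (shiftLeft (show ℍ[ℝ] →ₙₐ[ℝ] C from f) (u 0 0) b)
        (show ℂ →ₙₐ[ℝ] C from g)
  | _, _, .hh, f, g => show ℍ[ℝ] →ₗ[ℝ] C from mulConst (show ℍ[ℝ] →ₙₐ[ℝ] C from f)
      (quaternionAverage (show ℍ[ℝ] →ₙₐ[ℝ] C from f)
        (shiftLeft (show ℍ[ℝ] →ₙₐ[ℝ] C from f) (u 0 0) b) (show ℍ[ℝ] →ₙₐ[ℝ] C from g))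

/-- The quaternion `i`. -/
def quaternionI : ℍ[ℝ] := Quaternion.ofComplex Complex.I

/-- The bimodule homomorphism from the bimodule at the second arrow, where there is one. -/
def arrowMap' (b : Bool) (u : Matrix (Fin 2) (Fin 2) C) :
    {d d' : DivisionKind} → (X : SimpleBimodule d d') → (d.Carrier →ₙₐ[ℝ] C) →
      (d'.Carrier →ₙₐ[ℝ] C) → (X.Carrier →ₗ[ℝ] C)
  | _, _, .rr, _, _ => show ℝ →ₗ[ℝ] C from LinearMap.toSpanSingleton ℝ C (u 0 1)
  | _, _, .hh, f, g => show ℍ[ℝ] →ₗ[ℝ] C from mulConst (show ℍ[ℝ] →ₙₐ[ℝ] C from f)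
      (quaternionAverage (show ℍ[ℝ] →ₙₐ[ℝ] C from f)
        (shiftLeft (show ℍ[ℝ] →ₙₐ[ℝ] C from f) (u 0 0) b * (show ℍ[ℝ] →ₙₐ[ℝ] C from g) quaternionI)
        (show ℍ[ℝ] →ₙₐ[ℝ] C from g))
  | _, _, _, _, _ => 0

/-- The entries of the matrix of an arrow in the bimodule of the first arrow of `Q^b`. -/
def arrowMat (b : Bool) : {d d' : DivisionKind} → (X : SimpleBimodule d d') →
    Matrix (Fin 2) (Fin 2) X.Carrier
  | _, _, .rr => show Matrix (Fin 2) (Fin 2) ℝ from !![1, 0; 0, twistSign b]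
  | _, _, .rc => show Matrix (Fin 2) (Fin 2) ℂ from !![1, 0; (-twistSign b) • Complex.I, 0]
  | _, _, .rh => show Matrix (Fin 2) (Fin 2) ℍ[ℝ] from !![1, 0; (-twistSign b) • quaternionI, 0]
  | _, _, .cr => show Matrix (Fin 2) (Fin 2) ℂ from !![1, twistSign b • Complex.I; 0, 0]
  | _, _, .cc => show Matrix (Fin 2) (Fin 2) ℂ from !![1, 0; 0, 0]
  | _, _, .ccBar => show Matrix (Fin 2) (Fin 2) ℂ from !![1, 0; 0, 0]
  | _, _, .ch => show Matrix (Fin 2) (Fin 2) (Matrix (Fin 1) (Fin 2) ℂ) from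
      !![bif b then !![0, -1] else !![1, 0], 0; 0, 0]
  | _, _, .hr => show Matrix (Fin 2) (Fin 2) ℍ[ℝ] from !![1, twistSign b • quaternionI; 0, 0]
  | _, _, .hc => show Matrix (Fin 2) (Fin 2) (Matrix (Fin 2) (Fin 1) ℂ) from
      !![bif b then !![0; 1] else !![1; 0], 0; 0, 0]
  | _, _, .hh => show Matrix (Fin 2) (Fin 2) ℍ[ℝ] from
      !![(1 / 2 : ℝ) • (bif b then -quaternionJ else 1), 0; 0, 0]

/-- The entries of the matrix of an arrow in the bimodule of the second arrow of `Q^b`. -/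
def arrowMat' (b : Bool) : {d d' : DivisionKind} → (X : SimpleBimodule d d') →
    Matrix (Fin 2) (Fin 2) X.Carrier
  | _, _, .rr => show Matrix (Fin 2) (Fin 2) ℝ from !![0, 1; -twistSign b, 0]
  | _, _, .hh => show Matrix (Fin 2) (Fin 2) ℍ[ℝ] from
      !![(1 / 2 : ℝ) • (bif b then quaternionJ * quaternionI else -quaternionI), 0; 0, 0]
  | _, _, _ => 0

/-- The twists which are compatible with a simple bimodule. -/
def SimpleBimodule.IsCompatible (b : Bool) : {d d' : DivisionKind} → SimpleBimodule d d' → Prop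
  | _, _, .cc => b = false
  | _, _, .ccBar => b = true
  | _, _, _ => True

/-- The simple bimodules over `ℝ` and over `ℍ` from the same kind to itself. -/
def SimpleBimodule.IsDouble : {d d' : DivisionKind} → SimpleBimodule d d' → Prop
  | _, _, .rr => True
  | _, _, .hh => True
  | _, _, _ => False

lemma ofTwist_isCompatible (b : Bool) (d d' : DivisionKind) :
    (SimpleBimodule.ofTwist (twistBy b) d d').IsCompatible b := by
  have hne : Complex.conjAe ≠ AlgEquiv.refl := fun h => by
    have := congrArg Complex.im (DFunLike.congr_fun h Complex.I)
    norm_num at this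
  cases d <;> cases d' <;> cases b <;>
    simp [SimpleBimodule.ofTwist, twistBy, hne, SimpleBimodule.IsCompatible]

lemma exists_eq_twistBy (σ : ℂ ≃ₐ[ℝ] ℂ) : ∃ b, σ = twistBy b := by
  rcases Complex.real_algHom_eq_id_or_conj (σ : ℂ →ₐ[ℝ] ℂ) with h | h
  · exact ⟨false, AlgEquiv.ext fun x => DFunLike.congr_fun h x⟩
  · exact ⟨true, AlgEquiv.ext fun x => DFunLike.congr_fun h x⟩

lemma arrowMap'_eq_zero (b : Bool) (u : Matrix (Fin 2) (Fin 2) C) {d d' : DivisionKind}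
    (X : SimpleBimodule d d') (f : d.Carrier →ₙₐ[ℝ] C) (g : d'.Carrier →ₙₐ[ℝ] C)
    (h : ¬X.IsDouble) : arrowMap' b u X f g = 0 := by
  cases X with
  | rr => exact absurd trivial h
  | hh => exact absurd trivial h
  | _ => rfl

end ArrowBimodule

/-! ### Bimodule homomorphisms determined by the matrix of an arrow -/

section ArrowBimodule

open MulOpposite

variable {C : Type*} [Ring C] [Algebra ℝ C]

lemma nonUnitalAlgHom_real_apply (f : ℝ →ₙₐ[ℝ] C) (r : ℝ) : f r = r • f 1 := by
  rw [← map_smul, smul_eq_mul, mul_one]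

lemma exists_eq_ofComplex_add (q : ℍ[ℝ]) :
    ∃ z w : ℂ, q = Quaternion.ofComplex z + Quaternion.ofComplex w * quaternionJ :=
  ⟨_, _, (ofComplex_add_ofComplex_mul_quaternionJ q).symm⟩

lemma quaternionToMatrix_eq (z w : ℂ) :
    quaternionToMatrix (Quaternion.ofComplex z + Quaternion.ofComplex w * quaternionJ) =
      !![z, w; -starRingEnd ℂ w, starRingEnd ℂ z] := by
  have hC : ∀ c : ℂ, quaternionToMatrix (Quaternion.ofComplex c) =
      !![c, 0; 0, starRingEnd ℂ c] := by
    intro c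
    change algebraMap ℝ _ c.re + c.im • !![Complex.I, 0; 0, -Complex.I] +
      (0 : ℝ) • !![0, 1; -1, 0] + (0 : ℝ) • !![0, Complex.I; Complex.I, 0] = _
    ext i j
    fin_cases i <;> fin_cases j <;>
      simp [Matrix.algebraMap_eq_diagonal, Complex.ext_iff]
  have hJ : quaternionToMatrix quaternionJ = !![0, 1; -1, 0] := by
    change algebraMap ℝ _ 0 + (0 : ℝ) • !![Complex.I, 0; 0, -Complex.I] +
      (1 : ℝ) • !![0, 1; -1, 0] + (0 : ℝ) • !![0, Complex.I; Complex.I, 0] = _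
    simp
  rw [map_add, map_mul, hC, hC, hJ]
  simp

section Quaternion

variable (f : ℍ[ℝ] →ₙₐ[ℝ] C)

lemma map_quaternionJ_mul_map_quaternionJ : f quaternionJ * f quaternionJ = -f 1 := by
  rw [← map_mul, quaternionJ_mul_self, map_neg]

lemma map_quaternionJ_mul_map_ofComplex (c : ℂ) :
    f quaternionJ * f (Quaternion.ofComplex c) =
      f (Quaternion.ofComplex (starRingEnd ℂ c)) * f quaternionJ := by
  rw [← map_mul, quaternionJ_mul_ofComplex, map_mul]

lemma map_ofComplex_mul_map_quaternionJ (c : ℂ) :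
    f (Quaternion.ofComplex c) * f quaternionJ =
      f quaternionJ * f (Quaternion.ofComplex (starRingEnd ℂ c)) := by
  rw [map_quaternionJ_mul_map_ofComplex, Complex.conj_conj]

/-- Since j c = c̄ j, multiplication by j undoes a conjugation. A conjugate-linear arrow at a
quaternionic vertex can thus be replaced by a linear one. -/
lemma shiftLeft_intertwine {x : C} {b : Bool} {k : ℂ → C}
    (h : ∀ c, f (Quaternion.ofComplex (twistBy b c)) * x = x * k c) (c : ℂ) :
    f (Quaternion.ofComplex c) * shiftLeft f x b = shiftLeft f x b * k c := by
  cases b with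
  | false => exact h c
  | true =>
    change f (Quaternion.ofComplex c) * (f quaternionJ * x) = f quaternionJ * x * k c
    rw [← mul_assoc, map_ofComplex_mul_map_quaternionJ, mul_assoc, mul_assoc, ← h]
    rfl

lemma shiftRight_intertwine {x : C} {b : Bool} {k : ℂ → C}
    (h : ∀ c, k (twistBy b c) * x = x * f (Quaternion.ofComplex c)) (c : ℂ) :
    k c * shiftRight x f b = shiftRight x f b * f (Quaternion.ofComplex c) := by
  cases b with
  | false => exact h c
  | true =>
    change k c * (x * f quaternionJ) = x * f quaternionJ * f (Quaternion.ofComplex c)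
    have := h (starRingEnd ℂ c)
    rw [mul_assoc, map_quaternionJ_mul_map_ofComplex, ← mul_assoc x, ← this, ← mul_assoc]
    congr 3
    exact (Complex.conj_conj c).symm

/-- The map sends (1, 0) to x and (0, 1) = (1, 0) j to x j. Compatibility with j in turn rests on
(0, 1) j = -(1, 0) and x j² = -x, and compatibility with ℂ on `h`. -/
lemma rowMap_mul {k : ℂ →ₙₐ[ℝ] C} {x : C} (h : ∀ c, k c * x = x * f (Quaternion.ofComplex c))
    (h1 : x * f 1 = x) (m : Matrix (Fin 1) (Fin 2) ℂ) (q : ℍ[ℝ]) :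
    rowMap k x f (m * quaternionToMatrix q) = rowMap k x f m * f q := by
  obtain ⟨z, w, rfl⟩ := exists_eq_ofComplex_add q
  have hx (c a) : x * (f (Quaternion.ofComplex c) * a) = k c * (x * a) := by
    rw [← mul_assoc, ← h, mul_assoc]
  have hJ (c a) : f quaternionJ * (f (Quaternion.ofComplex c) * a) =
      f (Quaternion.ofComplex (starRingEnd ℂ c)) * (f quaternionJ * a) := by
    rw [← mul_assoc, map_quaternionJ_mul_map_ofComplex, mul_assoc]
  rw [quaternionToMatrix_eq]
  simp only [rowMap, LinearMap.coe_mk, AddHom.coe_mk, Matrix.mul_apply, Fin.sum_univ_two,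
    Matrix.of_apply, Matrix.cons_val_zero, Matrix.cons_val_one, map_mul, map_add, map_neg,
    add_mul, mul_add, mul_assoc, hx, hJ, map_quaternionJ_mul_map_quaternionJ,
    map_quaternionJ_mul_map_ofComplex, mul_neg, neg_mul, ← h, h1]
  abel

/-- The map sends the column (1, 0) to x. The matrix of j takes this column to (0, -1), hence the
minus sign in the second term of `colMap`. -/
lemma colMap_mul {g : ℂ →ₙₐ[ℝ] C} {x : C} (h : ∀ c, f (Quaternion.ofComplex c) * x = x * g c)
    (h1 : f 1 * x = x) (q : ℍ[ℝ]) (m : Matrix (Fin 2) (Fin 1) ℂ) :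
    colMap f x g (quaternionToMatrix q * m) = f q * colMap f x g m := by
  obtain ⟨z, w, rfl⟩ := exists_eq_ofComplex_add q
  have hx (c a) : f (Quaternion.ofComplex c) * (x * a) = x * (g c * a) := by
    rw [← mul_assoc, h, mul_assoc]
  have hJ (c a) : f (Quaternion.ofComplex c) * (f quaternionJ * a) =
      f quaternionJ * (f (Quaternion.ofComplex (starRingEnd ℂ c)) * a) := by
    rw [← mul_assoc, map_ofComplex_mul_map_quaternionJ, mul_assoc]
  have hJJ (a) : f quaternionJ * (f quaternionJ * (x * a)) = -(x * a) := by
    rw [← mul_assoc, map_quaternionJ_mul_map_quaternionJ, neg_mul, ← mul_assoc, h1]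
  rw [quaternionToMatrix_eq]
  simp only [colMap, LinearMap.coe_mk, AddHom.coe_mk, Matrix.mul_apply, Fin.sum_univ_two,
    Matrix.of_apply, Matrix.cons_val_zero, Matrix.cons_val_one, map_mul, map_add, map_neg,
    add_mul, mul_add, mul_sub, mul_assoc, hJ, hx, hJJ, mul_neg, neg_mul]
  abel

/-- Commutation with ℂ is inherited from x, the conjugations caused by the two factors j cancelling.
For j, both products equal j x + x j, as j² = -1. -/
lemma quaternionAverage_commute {g : ℍ[ℝ] →ₙₐ[ℝ] C} {x : C}
    (h : ∀ c, f (Quaternion.ofComplex c) * x = x * g (Quaternion.ofComplex c))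
    (h1 : f 1 * x = x) (h2 : x * g 1 = x) (q : ℍ[ℝ]) :
    f q * quaternionAverage f x g = quaternionAverage f x g * g q := by
  obtain ⟨z, w, rfl⟩ := exists_eq_ofComplex_add q
  have hx (c a) : x * (g (Quaternion.ofComplex c) * a) = f (Quaternion.ofComplex c) * (x * a) := by
    rw [← mul_assoc, ← h, mul_assoc]
  have hJ (c a) : f quaternionJ * (f (Quaternion.ofComplex c) * a) =
      f (Quaternion.ofComplex (starRingEnd ℂ c)) * (f quaternionJ * a) := by
    rw [← mul_assoc, map_quaternionJ_mul_map_ofComplex, mul_assoc]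
  have hJ' (c a) : g quaternionJ * (g (Quaternion.ofComplex c) * a) =
      g (Quaternion.ofComplex (starRingEnd ℂ c)) * (g quaternionJ * a) := by
    rw [← mul_assoc, map_quaternionJ_mul_map_ofComplex, mul_assoc]
  have hJJ (a) : f quaternionJ * (f quaternionJ * (x * a)) = -(x * a) := by
    rw [← mul_assoc, map_quaternionJ_mul_map_quaternionJ, neg_mul, ← mul_assoc, h1]
  simp only [quaternionAverage, map_mul, map_add, add_mul, mul_add, mul_sub, sub_mul, mul_assoc,
    hx, hJ, hJ', hJJ, map_quaternionJ_mul_map_quaternionJ, map_quaternionJ_mul_map_ofComplex,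
    mul_neg, Complex.conj_conj, ← h, h2]
  abel

lemma quaternionAverage_unit {g : ℍ[ℝ] →ₙₐ[ℝ] C} {x : C} (h : f 1 * x = x) :
    f 1 * quaternionAverage f x g = quaternionAverage f x g := by
  have : f 1 * f quaternionJ = f quaternionJ := by rw [← map_mul, one_mul]
  rw [quaternionAverage, mul_sub, h, ← mul_assoc, ← mul_assoc, this]

end Quaternion

namespace IsArrowRep

variable {b : Bool} {d d' : DivisionKind} {f : d.Carrier →ₙₐ[ℝ] C} {g : d'.Carrier →ₙₐ[ℝ] C}
  {u : Matrix (Fin 2) (Fin 2) C}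

lemma rel_apply (h : IsArrowRep b f g u) (c : ℂ) (k l : Fin 2) :
    f (scalarMat d (twistBy b c) k 0) * u 0 l + f (scalarMat d (twistBy b c) k 1) * u 1 l =
      u k 0 * g (scalarMat d' c 0 l) + u k 1 * g (scalarMat d' c 1 l) := by
  have := congrFun (congrFun (h.rel c) k) l
  rwa [Matrix.mul_apply, Matrix.mul_apply, Fin.sum_univ_two, Fin.sum_univ_two] at this

lemma one_mul_apply (h : IsArrowRep b f g u) (k l : Fin 2) :
    f (scalarMat d 1 k 0) * u 0 l + f (scalarMat d 1 k 1) * u 1 l = u k l := by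
  have := congrFun (congrFun h.one_mul k) l
  rwa [Matrix.mul_apply, Fin.sum_univ_two] at this

/-- A twist fixes 1, so the relation at c = 1 transfers the left unit law to the right side. -/
lemma mul_one_apply (h : IsArrowRep b f g u) (k l : Fin 2) :
    u k 0 * g (scalarMat d' 1 0 l) + u k 1 * g (scalarMat d' 1 1 l) = u k l := by
  rw [← h.rel_apply, map_one, h.one_mul_apply]

lemma map_one_mul (h : IsArrowRep b f g u) (k l : Fin 2) : f 1 * u k l = u k l := by
  conv_lhs => rw [← h.one_mul_apply, mul_add, ← mul_assoc, ← mul_assoc, ← map_mul, ← map_mul,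
    _root_.one_mul, _root_.one_mul, h.one_mul_apply]

lemma mul_map_one (h : IsArrowRep b f g u) (k l : Fin 2) : u k l * g 1 = u k l := by
  conv_lhs => rw [← h.mul_one_apply, add_mul, mul_assoc, mul_assoc, ← map_mul, ← map_mul,
    _root_.mul_one, _root_.mul_one, h.mul_one_apply]

/-- When neither end is real, the scalar matrices live in position (0, 0), and the matrix relation
reduces to one equation for the entry u 0 0. The next three lemmas are the other such cases. -/
lemma complex_complex {f g : ℂ →ₙₐ[ℝ] C}
    (h : IsArrowRep b (d := .complex) (d' := .complex) f g u) (c : ℂ) :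
    f (twistBy b c) * u 0 0 = u 0 0 * g c := by
  have : f (twistBy b c) * u 0 0 + f 0 * u 1 0 = u 0 0 * g c + u 0 1 * g 0 := h.rel_apply c 0 0
  rwa [map_zero, map_zero, zero_mul, mul_zero, add_zero, add_zero] at this

lemma complex_quaternion {f : ℂ →ₙₐ[ℝ] C} {g : ℍ[ℝ] →ₙₐ[ℝ] C}
    (h : IsArrowRep b (d := .complex) (d' := .quaternion) f g u) (c : ℂ) :
    f (twistBy b c) * u 0 0 = u 0 0 * g (Quaternion.ofComplex c) := by
  have : f (twistBy b c) * u 0 0 + f 0 * u 1 0 =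
    u 0 0 * g (Quaternion.ofComplex c) + u 0 1 * g 0 := h.rel_apply c 0 0
  rwa [map_zero, map_zero, zero_mul, mul_zero, add_zero, add_zero] at this

lemma quaternion_complex {f : ℍ[ℝ] →ₙₐ[ℝ] C} {g : ℂ →ₙₐ[ℝ] C}
    (h : IsArrowRep b (d := .quaternion) (d' := .complex) f g u) (c : ℂ) :
    f (Quaternion.ofComplex (twistBy b c)) * u 0 0 = u 0 0 * g c := by
  have : f (Quaternion.ofComplex (twistBy b c)) * u 0 0 + f 0 * u 1 0 =
    u 0 0 * g c + u 0 1 * g 0 := h.rel_apply c 0 0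
  rwa [map_zero, map_zero, zero_mul, mul_zero, add_zero, add_zero] at this

lemma quaternion_quaternion {f g : ℍ[ℝ] →ₙₐ[ℝ] C}
    (h : IsArrowRep b (d := .quaternion) (d' := .quaternion) f g u) (c : ℂ) :
    f (Quaternion.ofComplex (twistBy b c)) * u 0 0 = u 0 0 * g (Quaternion.ofComplex c) := by
  have : f (Quaternion.ofComplex (twistBy b c)) * u 0 0 + f 0 * u 1 0 =
    u 0 0 * g (Quaternion.ofComplex c) + u 0 1 * g 0 := h.rel_apply c 0 0
  rwa [map_zero, map_zero, zero_mul, mul_zero, add_zero, add_zero] at this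

lemma map_one_mul_shiftLeft {f : ℍ[ℝ] →ₙₐ[ℝ] C} {x : C} (h : f 1 * x = x) :
    f 1 * shiftLeft f x b = shiftLeft f x b := by
  cases b with
  | false => exact h
  | true =>
    change f 1 * (f quaternionJ * x) = f quaternionJ * x
    rw [← mul_assoc, ← map_mul, _root_.one_mul]

lemma shiftRight_mul_map_one {g : ℍ[ℝ] →ₙₐ[ℝ] C} {x : C} (h : x * g 1 = x) :
    shiftRight x g b * g 1 = shiftRight x g b := by
  cases b with
  | false => exact h
  | true =>
    change x * g quaternionJ * g 1 = x * g quaternionJ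
    rw [mul_assoc, ← map_mul, _root_.mul_one]

lemma shiftLeft_mul_map_one {f g : ℍ[ℝ] →ₙₐ[ℝ] C} {x : C} (h : x * g 1 = x) :
    shiftLeft f x b * g 1 = shiftLeft f x b := by
  cases b with
  | false => exact h
  | true =>
    change f quaternionJ * x * g 1 = f quaternionJ * x
    rw [mul_assoc, h]

/-- Apart from `hc`, the left algebra acts through f or by real scalars, and only associativity and
the unit law of f are needed. Columns also need the shifted element to commute with ℂ. -/
lemma arrowMap_smul (h : IsArrowRep b f g u) (X : SimpleBimodule d d') (a : d.Carrier)
    (m : X.Carrier) : arrowMap b u X f g (a • m) = f a * arrowMap b u X f g m := by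
  have h1 := h.map_one_mul 0 0
  cases X with
  | rr =>
    have key (f : ℝ →ₙₐ[ℝ] C) (h1 : f 1 * u 0 0 = u 0 0) (r s : ℝ) :
        (r * s) • u 0 0 = f r * s • u 0 0 := by
      rw [nonUnitalAlgHom_real_apply, smul_mul_smul_comm, h1]
    exact key f h1 a m
  | rc =>
    have key (f : ℝ →ₙₐ[ℝ] C) (g : ℂ →ₙₐ[ℝ] C) (h1 : f 1 * u 0 0 = u 0 0) (r : ℝ) (s : ℂ) :
        u 0 0 * g (r • s) = f r * (u 0 0 * g s) := by
      rw [nonUnitalAlgHom_real_apply, map_smul, mul_smul_comm, smul_mul_assoc, ← mul_assoc, h1]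
    exact key f g h1 a m
  | rh =>
    have key (f : ℝ →ₙₐ[ℝ] C) (g : ℍ[ℝ] →ₙₐ[ℝ] C) (h1 : f 1 * u 0 0 = u 0 0) (r : ℝ) (s : ℍ[ℝ]) :
        u 0 0 * g (r • s) = f r * (u 0 0 * g s) := by
      rw [nonUnitalAlgHom_real_apply, map_smul, mul_smul_comm, smul_mul_assoc, ← mul_assoc, h1]
    exact key f g h1 a m
  | ch =>
    have key (f : ℂ →ₙₐ[ℝ] C) (x y : C) (r s t : ℂ) :
        f (r * s) * x + f (r * t) * y = f r * (f s * x + f t * y) := by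
      rw [map_mul, map_mul, mul_add, mul_assoc, mul_assoc]
    exact key f _ _ a _ _
  | hc =>
    exact colMap_mul (f := f) (shiftLeft_intertwine _ h.quaternion_complex)
      (map_one_mul_shiftLeft h1) a m
  | _ => exact (congrArg (· * _) (map_mul f a _)).trans (mul_assoc _ _ _)

/-- Compatibility matters only for the two ℂ-ℂ-bimodules, where the twist decides the right action.
With a quaternionic end on both sides or opposite ℂ, the twist has been absorbed by j; with a real
end, only real scalars or g itself act on the right. -/
lemma arrowMap_op_smul (h : IsArrowRep b f g u) (X : SimpleBimodule d d') (hX : X.IsCompatible b)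
    (a : d'.Carrier) (m : X.Carrier) :
    arrowMap b u X f g (op a • m) = arrowMap b u X f g m * g a := by
  have h1 := h.mul_map_one 0 0
  have h2 := h.map_one_mul 0 0
  cases X with
  | rr =>
    have key (g : ℝ →ₙₐ[ℝ] C) (h1 : u 0 0 * g 1 = u 0 0) (r s : ℝ) :
        (s * r) • u 0 0 = s • u 0 0 * g r := by
      rw [nonUnitalAlgHom_real_apply, smul_mul_smul_comm, h1]
    exact key g h1 a m
  | rc => exact (congrArg (_ * ·) (map_mul g _ a)).trans (mul_assoc _ _ _).symm
  | rh => exact (congrArg (_ * ·) (map_mul g _ a)).trans (mul_assoc _ _ _).symm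
  | cr =>
    have key (f : ℂ →ₙₐ[ℝ] C) (g : ℝ →ₙₐ[ℝ] C) (h1 : u 0 0 * g 1 = u 0 0) (r : ℝ) (s : ℂ) :
        f (op r • s) * u 0 0 = f s * u 0 0 * g r := by
      rw [nonUnitalAlgHom_real_apply, op_smul_eq_smul, map_smul, mul_smul_comm, smul_mul_assoc,
        mul_assoc, h1]
    exact key f g h1 a m
  | hr =>
    have key (f : ℍ[ℝ] →ₙₐ[ℝ] C) (g : ℝ →ₙₐ[ℝ] C) (h1 : u 0 0 * g 1 = u 0 0) (r : ℝ) (s : ℍ[ℝ]) :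
        f (op r • s) * u 0 0 = f s * u 0 0 * g r := by
      have : op r • s = r • s := by ext <;> simp [mul_comm]
      rw [nonUnitalAlgHom_real_apply, this, map_smul, mul_smul_comm, smul_mul_assoc,
        mul_assoc, h1]
    exact key f g h1 a m
  | cc =>
    have hb : b = false := hX
    subst hb
    have key (f g : ℂ →ₙₐ[ℝ] C) (h : ∀ c, f c * u 0 0 = u 0 0 * g c) (r s : ℂ) :
        f (s * r) * u 0 0 = f s * u 0 0 * g r := by
      rw [map_mul, mul_assoc, h, mul_assoc]
    exact key f g h.complex_complex a m
  | ccBar =>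
    have hb : b = true := hX
    subst hb
    have key (f g : ℂ →ₙₐ[ℝ] C) (h : ∀ c, f (starRingEnd ℂ c) * u 0 0 = u 0 0 * g c) (r s : ℂ) :
        f (s * starRingEnd ℂ r) * u 0 0 = f s * u 0 0 * g r := by
      rw [map_mul, mul_assoc, h, mul_assoc]
    exact key f g h.complex_complex a m
  | ch =>
    exact rowMap_mul (f := g) (shiftRight_intertwine _ h.complex_quaternion)
      (shiftRight_mul_map_one h1) m a
  | hc =>
    have key (g : ℂ →ₙₐ[ℝ] C) (x y : C) (r s t : ℂ) :
        x * g (s * r) - y * g (t * r) = (x * g s - y * g t) * g r := by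
      rw [map_mul, map_mul, sub_mul, mul_assoc, mul_assoc]
    exact key g _ _ a _ _
  | hh =>
    have key (f g : ℍ[ℝ] →ₙₐ[ℝ] C) (x : C) (hx : ∀ q, f q * x = x * g q) (r s : ℍ[ℝ]) :
        f (s * r) * x = f s * x * g r := by
      rw [map_mul, mul_assoc, hx, mul_assoc]
    exact key f g _ (quaternionAverage_commute _ (shiftLeft_intertwine _ h.quaternion_quaternion)
      (map_one_mul_shiftLeft h2) (shiftLeft_mul_map_one h1)) a m

lemma arrowMap'_smul (h : IsArrowRep b f g u) (X : SimpleBimodule d d') (a : d.Carrier)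
    (m : X.Carrier) : arrowMap' b u X f g (a • m) = f a * arrowMap' b u X f g m := by
  have h1 := h.map_one_mul 0 1
  cases X with
  | rr =>
    have key (f : ℝ →ₙₐ[ℝ] C) (h1 : f 1 * u 0 1 = u 0 1) (r s : ℝ) :
        (r * s) • u 0 1 = f r * s • u 0 1 := by
      rw [nonUnitalAlgHom_real_apply, smul_mul_smul_comm, h1]
    exact key f h1 a m
  | hh => exact (congrArg (· * _) (map_mul f a _)).trans (mul_assoc _ _ _)
  | _ => exact (mul_zero _).symm

lemma arrowMap'_op_smul (h : IsArrowRep b f g u) (X : SimpleBimodule d d')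
    (a : d'.Carrier) (m : X.Carrier) :
    arrowMap' b u X f g (op a • m) = arrowMap' b u X f g m * g a := by
  have h1 := h.mul_map_one 0 1
  have h2 := h.map_one_mul 0 0
  have h3 := h.mul_map_one 0 0
  cases X with
  | rr =>
    have key (g : ℝ →ₙₐ[ℝ] C) (h1 : u 0 1 * g 1 = u 0 1) (r s : ℝ) :
        (s * r) • u 0 1 = s • u 0 1 * g r := by
      rw [nonUnitalAlgHom_real_apply, smul_mul_smul_comm, h1]
    exact key g h1 a m
  | hh =>
    have key (f g : ℍ[ℝ] →ₙₐ[ℝ] C) (x : C)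
        (h : ∀ c, f (Quaternion.ofComplex c) * x = x * g (Quaternion.ofComplex c))
        (h1 : f 1 * x = x) (r s : ℍ[ℝ]) :
        f (s * r) * quaternionAverage f (x * g quaternionI) g =
          f s * quaternionAverage f (x * g quaternionI) g * g r := by
      rw [map_mul, mul_assoc, mul_assoc]
      congr 1
      -- As ℂ is commutative, x i commutes with ℂ whenever x does. Its average is a second element
      -- which commutes with ℍ.
      refine quaternionAverage_commute _ (fun c => ?_) ?_ ?_ r
      · rw [← mul_assoc, h, mul_assoc, mul_assoc, quaternionI, ← map_mul, ← map_mul, ← map_mul,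
          ← map_mul, mul_comm]
      · rw [← mul_assoc, h1]
      · rw [mul_assoc, ← map_mul, _root_.mul_one]
    exact key f g _ (shiftLeft_intertwine _ h.quaternion_quaternion)
      (map_one_mul_shiftLeft h2) a m
  | _ => exact (zero_mul _).symm

end IsArrowRep

end ArrowBimodule

/-! ### Recovering the matrix of an arrow from its homomorphisms -/

section ArrowBimodule

open MulOpposite

variable {C : Type*} [Ring C] [Algebra ℝ C]

lemma quaternionI_mul_self : quaternionI * quaternionI = -1 := by
  rw [quaternionI, ← map_mul, Complex.I_mul_I, map_neg, map_one]

lemma quaternionJ_mul_quaternionI : quaternionJ * quaternionI = -(quaternionI * quaternionJ) := by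
  rw [quaternionI, quaternionJ_mul_ofComplex, Complex.conj_I, map_neg, neg_mul]

/-- With x i = i x one finds i (x i - j x i j) = -x - j x j, while the average of x is x - j x j. So
the two averages together determine x, which is why an arrow between quaternionic vertices yields
two arrows. -/
lemma quaternionAverage_sub {f g : ℍ[ℝ] →ₙₐ[ℝ] C} {x : C}
    (h : ∀ c, f (Quaternion.ofComplex c) * x = x * g (Quaternion.ofComplex c)) (h2 : x * g 1 = x) :
    quaternionAverage f x g - f quaternionI * quaternionAverage f (x * g quaternionI) g =
      (2 : ℝ) • x := by
  have hI : ∀ a, f quaternionI * (x * a) = x * (g quaternionI * a) := fun a => by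
    rw [← mul_assoc, quaternionI, h, mul_assoc]
  have hII : ∀ a, x * (g quaternionI * (g quaternionI * a)) = -(x * a) := fun a => by
    rw [← mul_assoc (g _), ← map_mul, quaternionI_mul_self, map_neg, neg_mul, mul_neg,
      ← mul_assoc, h2]
  have hII' : x * (g quaternionI * g quaternionI) = -x := by
    rw [← map_mul, quaternionI_mul_self, map_neg, mul_neg, h2]
  have hIJ : ∀ a, f quaternionI * (f quaternionJ * a) = -(f quaternionJ * (f quaternionI * a)) :=
    fun a => by
      rw [← mul_assoc, ← map_mul, ← mul_assoc, ← map_mul, quaternionJ_mul_quaternionI, map_neg,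
        neg_mul, neg_neg]
  simp only [quaternionAverage, mul_sub, mul_assoc, hI, hII, hII', hIJ, mul_neg]
  module

namespace IsArrowRep

variable {b : Bool} {d d' : DivisionKind} {f : d.Carrier →ₙₐ[ℝ] C} {g : d'.Carrier →ₙₐ[ℝ] C}
  {u : Matrix (Fin 2) (Fin 2) C}

lemma row_one_eq_zero (h : IsArrowRep b f g u) (hd : d ≠ .real) (l : Fin 2) : u 1 l = 0 := by
  rw [← h.one_mul_apply]
  cases d with
  | real => exact absurd rfl hd
  | complex =>
    have : f 0 * u 0 l + f 0 * u 1 l = 0 := by rw [map_zero, zero_mul, zero_mul, add_zero]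
    exact this
  | quaternion =>
    have : f 0 * u 0 l + f 0 * u 1 l = 0 := by rw [map_zero, zero_mul, zero_mul, add_zero]
    exact this

lemma col_one_eq_zero (h : IsArrowRep b f g u) (hd : d' ≠ .real) (k : Fin 2) : u k 1 = 0 := by
  rw [← h.mul_one_apply]
  cases d' with
  | real => exact absurd rfl hd
  | complex =>
    have : u k 0 * g 0 + u k 1 * g 0 = 0 := by rw [map_zero, mul_zero, mul_zero, add_zero]
    exact this
  | quaternion =>
    have : u k 0 * g 0 + u k 1 * g 0 = 0 := by rw [map_zero, mul_zero, mul_zero, add_zero]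
    exact this

/-- This is the top row of the relation at c = i, solved for the lower entries: i is twisted by a
sign whose square is 1, and its real matrix is antidiagonal. -/
lemma row_one_of_real {f : ℝ →ₙₐ[ℝ] C} (h : IsArrowRep b (d := .real) f g u) (l : Fin 2) :
    u 1 l = (-twistSign b) • (u 0 0 * g (scalarMat d' Complex.I 0 l) +
      u 0 1 * g (scalarMat d' Complex.I 1 l)) := by
  have h1 : f 1 * u 1 l = u 1 l := h.map_one_mul 1 l
  rw [← h.rel_apply]
  have : u 1 l = (-twistSign b) • (f (twistBy b Complex.I).re * u 0 l +
      f (-(twistBy b Complex.I).im) * u 1 l) := by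
    rw [twistBy_I, Complex.smul_re, Complex.smul_im, Complex.I_re, Complex.I_im, smul_zero,
      map_zero, zero_mul, zero_add, smul_eq_mul, _root_.mul_one, nonUnitalAlgHom_real_apply f,
      smul_mul_assoc, h1, smul_smul, neg_mul_neg, twistSign_mul_self, one_smul]
  exact this

/-- This is the left column of the relation at c = i, in which the matrix of i picks out u k 1. -/
lemma col_one_of_real {g : ℝ →ₙₐ[ℝ] C} (h : IsArrowRep b (d' := .real) f g u) (k : Fin 2) :
    u k 1 = f (scalarMat d (twistSign b • Complex.I) k 0) * u 0 0 +
      f (scalarMat d (twistSign b • Complex.I) k 1) * u 1 0 := by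
  have h1 : u k 1 * g 1 = u k 1 := h.mul_map_one k 1
  rw [← twistBy_I, h.rel_apply]
  have : u k 1 = u k 0 * g 0 + u k 1 * g 1 := by rw [map_zero, mul_zero, zero_add, h1]
  exact this

/-- The entries outside position (0, 0) are either padding or determined through the action of i;
only for two real ends does u 0 1 remain as a second free parameter. For two quaternionic ends u 0 0
is recovered from two averages. This is what puts the matrix entries of an arrow of A in the image
of T. -/
lemma eq_arrowMap_add (h : IsArrowRep b f g u) (X : SimpleBimodule d d') (k l : Fin 2) :
    u k l = arrowMap b u X f g (arrowMat b X k l) + arrowMap' b u X f g (arrowMat' b X k l) := by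
  have hf := h.map_one_mul
  have hg := h.mul_map_one
  cases X with
  | rr =>
    have h1 : u 1 0 = (-twistSign b) • u 0 1 := by
      rw [row_one_of_real h 0]
      have : ∀ g : ℝ →ₙₐ[ℝ] C, u 0 1 * g 1 = u 0 1 → (-twistSign b) • (u 0 0 * g 0 + u 0 1 * g 1) =
        (-twistSign b) • u 0 1 := fun g hg => by rw [map_zero, mul_zero, zero_add, hg]
      exact this g (hg 0 1)
    have h2 : u 1 1 = twistSign b • u 0 0 := by
      rw [row_one_of_real h 1]
      have : ∀ g : ℝ →ₙₐ[ℝ] C, u 0 0 * g 1 = u 0 0 →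
          (-twistSign b) • (u 0 0 * g (-1) + u 0 1 * g 0) = twistSign b • u 0 0 := fun g hg => by
        rw [map_zero, mul_zero, add_zero, map_neg, mul_neg, hg, smul_neg, neg_smul, neg_neg]
      exact this g (hg 0 0)
    change u k l = (!![1, 0; 0, twistSign b] : Matrix _ _ ℝ) k l • u 0 0 +
      (!![0, 1; -twistSign b, 0] : Matrix _ _ ℝ) k l • u 0 1
    fin_cases k <;> fin_cases l <;> simp [h1, h2]
  | rc =>
    have h0 : ∀ k, u k 1 = 0 := h.col_one_eq_zero nofun
    have h1 : u 1 0 = u 0 0 * (g : ℂ →ₙₐ[ℝ] C) ((-twistSign b) • Complex.I) := by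
      rw [row_one_of_real h 0, h0 0, zero_mul, add_zero, ← mul_smul_comm, ← map_smul]
      rfl
    have key : ∀ g : ℂ →ₙₐ[ℝ] C, u 0 0 * g 1 = u 0 0 →
        u 1 0 = u 0 0 * g ((-twistSign b) • Complex.I) →
        u k l = u 0 0 * g ((!![1, 0; (-twistSign b) • Complex.I, 0] : Matrix _ _ ℂ) k l) + 0 := by
      intro g hg h1
      fin_cases k <;> fin_cases l <;> simp [h0, hg]
      simpa using h1
    exact key g (hg 0 0) h1
  | rh =>
    have h0 : ∀ k, u k 1 = 0 := h.col_one_eq_zero nofun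
    have h1 : u 1 0 = u 0 0 * (g : ℍ[ℝ] →ₙₐ[ℝ] C) ((-twistSign b) • quaternionI) := by
      rw [row_one_of_real h 0, h0 0, zero_mul, add_zero, ← mul_smul_comm, ← map_smul]
      rfl
    have key : ∀ g : ℍ[ℝ] →ₙₐ[ℝ] C, u 0 0 * g 1 = u 0 0 →
        u 1 0 = u 0 0 * g ((-twistSign b) • quaternionI) →
        u k l = u 0 0 * g ((!![1, 0; (-twistSign b) • quaternionI, 0] : Matrix _ _ ℍ[ℝ]) k l) + 0 := by
      intro g hg h1
      fin_cases k <;> fin_cases l <;> simp [h0, hg]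
      simpa using h1
    exact key g (hg 0 0) h1
  | cr =>
    have h0 : ∀ l, u 1 l = 0 := h.row_one_eq_zero nofun
    have h1 : u 0 1 = (f : ℂ →ₙₐ[ℝ] C) (twistSign b • Complex.I) * u 0 0 := by
      rw [col_one_of_real h 0, h0 0, mul_zero, add_zero]
      rfl
    have key : ∀ f : ℂ →ₙₐ[ℝ] C, f 1 * u 0 0 = u 0 0 → u 0 1 = f (twistSign b • Complex.I) * u 0 0 →
        u k l = f ((!![1, twistSign b • Complex.I; 0, 0] : Matrix _ _ ℂ) k l) * u 0 0 + 0 := by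
      intro f hf h1
      fin_cases k <;> fin_cases l <;> simp [h0, hf]
      simpa using h1
    exact key f (hf 0 0) h1
  | hr =>
    have h0 : ∀ l, u 1 l = 0 := h.row_one_eq_zero nofun
    have h1 : u 0 1 = (f : ℍ[ℝ] →ₙₐ[ℝ] C) (twistSign b • quaternionI) * u 0 0 := by
      rw [quaternionI, ← map_smul, col_one_of_real h 0, h0 0, mul_zero, add_zero]
      rfl
    have key : ∀ f : ℍ[ℝ] →ₙₐ[ℝ] C, f 1 * u 0 0 = u 0 0 → u 0 1 = f (twistSign b • quaternionI) * u 0 0 →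
        u k l = f ((!![1, twistSign b • quaternionI; 0, 0] : Matrix _ _ ℍ[ℝ]) k l) * u 0 0 + 0 := by
      intro f hf h1
      fin_cases k <;> fin_cases l <;> simp [h0, hf]
      simpa using h1
    exact key f (hf 0 0) h1
  | ch =>
    have h0 : ∀ l, u 1 l = 0 := h.row_one_eq_zero nofun
    have h0' : ∀ k, u k 1 = 0 := h.col_one_eq_zero nofun
    have key : ∀ (f : ℂ →ₙₐ[ℝ] C) (g : ℍ[ℝ] →ₙₐ[ℝ] C), f 1 * u 0 0 = u 0 0 → u 0 0 * g 1 = u 0 0 →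
        u k l = rowMap f (shiftRight (u 0 0) g b) g ((!![bif b then !![0, -1] else !![1, 0], 0; 0, 0] :
          Matrix (Fin 2) (Fin 2) (Matrix (Fin 1) (Fin 2) ℂ)) k l) + 0 := by
      intro f g hf hg
      have hJ : u 0 0 * g quaternionJ * g quaternionJ = -u 0 0 := by
        rw [mul_assoc, map_quaternionJ_mul_map_quaternionJ, mul_neg, hg]
      fin_cases k <;> fin_cases l <;> simp [h0, h0']
      cases b <;> simp [rowMap, shiftRight, hf, hJ]
    exact key f g (hf 0 0) (hg 0 0)
  | hc =>
    have h0 : ∀ l, u 1 l = 0 := h.row_one_eq_zero nofun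
    have h0' : ∀ k, u k 1 = 0 := h.col_one_eq_zero nofun
    have key : ∀ (f : ℍ[ℝ] →ₙₐ[ℝ] C) (g : ℂ →ₙₐ[ℝ] C), f 1 * u 0 0 = u 0 0 → u 0 0 * g 1 = u 0 0 →
        u k l = colMap f (shiftLeft f (u 0 0) b) g ((!![bif b then !![0; 1] else !![1; 0], 0; 0, 0] :
          Matrix (Fin 2) (Fin 2) (Matrix (Fin 2) (Fin 1) ℂ)) k l) + 0 := by
      intro f g hf hg
      have hJ : f quaternionJ * (f quaternionJ * u 0 0) = -u 0 0 := by
        rw [← mul_assoc, map_quaternionJ_mul_map_quaternionJ, neg_mul, hf]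
      fin_cases k <;> fin_cases l <;> simp [h0, h0']
      cases b <;> simp [colMap, shiftLeft, hg, hJ]
    exact key f g (hf 0 0) (hg 0 0)
  | hh =>
    have h0 : ∀ l, u 1 l = 0 := h.row_one_eq_zero nofun
    have h0' : ∀ k, u k 1 = 0 := h.col_one_eq_zero nofun
    have key : ∀ f g : ℍ[ℝ] →ₙₐ[ℝ] C, f 1 * u 0 0 = u 0 0 → u 0 0 * g 1 = u 0 0 →
        (∀ c, f (Quaternion.ofComplex (twistBy b c)) * u 0 0 = u 0 0 * g (Quaternion.ofComplex c)) →
        u k l = f ((!![(1 / 2 : ℝ) • (bif b then -quaternionJ else 1), 0; 0, 0] :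
            Matrix _ _ ℍ[ℝ]) k l) * quaternionAverage f (shiftLeft f (u 0 0) b) g +
          f ((!![(1 / 2 : ℝ) • (bif b then quaternionJ * quaternionI else -quaternionI), 0; 0, 0] :
            Matrix _ _ ℍ[ℝ]) k l) *
            quaternionAverage f (shiftLeft f (u 0 0) b * g quaternionI) g := by
      intro f g hf hg hfg
      have hv := shiftLeft_intertwine f hfg
      have hav := quaternionAverage_sub hv (shiftLeft_mul_map_one hg)
      rw [sub_eq_iff_eq_add] at hav
      have hf' := quaternionAverage_unit f (g := g) (map_one_mul_shiftLeft (b := b) hf)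
      fin_cases k <;> fin_cases l <;> simp [h0, h0']
      cases b with
      | false =>
        rw [cond_false, cond_false, hf', hav]
        simp [shiftLeft]
      | true =>
        -- The shifted element is v = j u₀₀, so u₀₀ = -j v; this is the origin of the coefficients
        -- -j/2 and j i/2.
        rw [cond_true, cond_true, map_neg, neg_mul, hav, map_mul, mul_assoc]
        have hJ : f quaternionJ * shiftLeft f (u 0 0) true = -u 0 0 := by
          change f quaternionJ * (f quaternionJ * u 0 0) = -u 0 0
          rw [← mul_assoc, map_quaternionJ_mul_map_quaternionJ, neg_mul, hf]
        rw [mul_add, mul_smul_comm, hJ]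
        module
    exact key f g (hf 0 0) (hg 0 0) h.quaternion_quaternion
  | _ =>
    have h0 : ∀ l, u 1 l = 0 := h.row_one_eq_zero nofun
    have h0' : ∀ k, u k 1 = 0 := h.col_one_eq_zero nofun
    have key : ∀ f : ℂ →ₙₐ[ℝ] C, f 1 * u 0 0 = u 0 0 →
        u k l = f ((!![1, 0; 0, 0] : Matrix _ _ ℂ) k l) * u 0 0 + 0 := by
      intro f hf
      fin_cases k <;> fin_cases l <;> simp [h0, h0', hf]
    exact key f (hf 0 0)

end IsArrowRep

end ArrowBimodule

/-! ### Matrices of arrows built from bimodule homomorphisms -/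

section ArrowBimodule

open MulOpposite

variable {C : Type*} [Ring C] [Algebra ℝ C]

/-- A matrix over a bimodule which satisfies the relations of an arrow. -/
structure IsArrowModel (b : Bool) {d d' : DivisionKind} {X : SimpleBimodule d d'}
    (G : Matrix (Fin 2) (Fin 2) X.Carrier) : Prop where
  rel : ∀ c k l, scalarMat d (twistBy b c) k 0 • G 0 l + scalarMat d (twistBy b c) k 1 • G 1 l =
    op (scalarMat d' c 0 l) • G k 0 + op (scalarMat d' c 1 l) • G k 1
  one_smul : ∀ k l, scalarMat d 1 k 0 • G 0 l + scalarMat d 1 k 1 • G 1 l = G k l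

lemma IsArrowModel.zero (b : Bool) {d d' : DivisionKind} (X : SimpleBimodule d d') :
    IsArrowModel b (0 : Matrix (Fin 2) (Fin 2) X.Carrier) where
  rel c k l := by simp
  one_smul k l := by simp

lemma scalarMat_apply_eq_zero {d : DivisionKind} (hd : d ≠ .real) (c : ℂ) {k l : Fin 2}
    (h : ¬(k = 0 ∧ l = 0)) : scalarMat d c k l = 0 := by
  cases d with
  | real => exact absurd rfl hd
  | complex => exact if_neg fun h' => h ⟨h'.1.symm, h'.2.symm⟩
  | quaternion => exact if_neg fun h' => h ⟨h'.1.symm, h'.2.symm⟩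

lemma scalarMat_real_one : scalarMat .real 1 = (1 : Matrix (Fin 2) (Fin 2) ℝ) := by
  have : (!![(1 : ℂ).re, -(1 : ℂ).im; (1 : ℂ).im, (1 : ℂ).re] : Matrix (Fin 2) (Fin 2) ℝ) = 1 := by
    ext i j
    fin_cases i <;> fin_cases j <;> simp
  exact this

section Cases

variable {b : Bool} {d d' : DivisionKind}

/-- All scalar matrices at non-real vertices are supported in position (0, 0), so a single equation
remains. With one real end, in the next two lemmas, there are two equations, one for each row or
column. -/
lemma isArrowModel_corner {X : SimpleBimodule d d'} (hd : d ≠ .real) (hd' : d' ≠ .real)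
    {x : X.Carrier}
    (h : ∀ c, scalarMat d (twistBy b c) 0 0 • x = op (scalarMat d' c 0 0) • x) :
    IsArrowModel b (!![x, 0; 0, 0] : Matrix (Fin 2) (Fin 2) X.Carrier) := by
  have h10 (c) : scalarMat d c 1 0 = 0 := scalarMat_apply_eq_zero hd c (by simp)
  have h01 (c) : scalarMat d' c 0 1 = 0 := scalarMat_apply_eq_zero hd' c (by simp)
  constructor
  · intro c k l
    fin_cases k <;> fin_cases l <;> simp [h10, h01, h]
  · intro k l
    fin_cases k <;> fin_cases l <;> simp [h10, scalarMat_one_apply_zero]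

lemma isArrowModel_col {X : SimpleBimodule .real d'} (hd' : d' ≠ .real) {x y : X.Carrier}
    (h0 : ∀ c, scalarMat .real (twistBy b c) 0 0 • x + scalarMat .real (twistBy b c) 0 1 • y =
      op (scalarMat d' c 0 0) • x)
    (h1 : ∀ c, scalarMat .real (twistBy b c) 1 0 • x + scalarMat .real (twistBy b c) 1 1 • y =
      op (scalarMat d' c 0 0) • y) :
    IsArrowModel b (!![x, 0; y, 0] : Matrix (Fin 2) (Fin 2) X.Carrier) := by
  have h01 (c) : scalarMat d' c 0 1 = 0 := scalarMat_apply_eq_zero hd' c (by simp)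
  have e00 : scalarMat .real 1 0 0 = 1 := congrFun (congrFun scalarMat_real_one 0) 0
  have e01 : scalarMat .real 1 0 1 = 0 := congrFun (congrFun scalarMat_real_one 0) 1
  have e10 : scalarMat .real 1 1 0 = 0 := congrFun (congrFun scalarMat_real_one 1) 0
  have e11 : scalarMat .real 1 1 1 = 1 := congrFun (congrFun scalarMat_real_one 1) 1
  constructor
  · intro c k l
    fin_cases k <;> fin_cases l <;> simp [h01, h0, h1]
  · intro k l
    fin_cases k <;> fin_cases l <;> simp [e00, e01, e10, e11]

lemma isArrowModel_row {X : SimpleBimodule d .real} (hd : d ≠ .real) {x y : X.Carrier}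
    (h0 : ∀ c, scalarMat d (twistBy b c) 0 0 • x =
      op (scalarMat .real c 0 0) • x + op (scalarMat .real c 1 0) • y)
    (h1 : ∀ c, scalarMat d (twistBy b c) 0 0 • y =
      op (scalarMat .real c 0 1) • x + op (scalarMat .real c 1 1) • y) :
    IsArrowModel b (!![x, y; 0, 0] : Matrix (Fin 2) (Fin 2) X.Carrier) := by
  have h10 (c) : scalarMat d c 1 0 = 0 := scalarMat_apply_eq_zero hd c (by simp)
  constructor
  · intro c k l
    fin_cases k <;> fin_cases l <;> simp [h10, h0, h1]
  · intro k l
    fin_cases k <;> fin_cases l <;> simp [h10, scalarMat_one_apply_zero]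

end Cases

/-- These are the real matrices U with σ(c) U = U c, a plane with coordinates x and y. The points
(1, 0) and (0, 1) give the matrices of the two arrows. -/
lemma isArrowModel_rr {b : Bool} (x y : ℝ) : IsArrowModel b (X := .rr)
    (!![x, y; -twistSign b * y, twistSign b * x] : Matrix (Fin 2) (Fin 2) ℝ) := by
  constructor
  · have key : ∀ (c : ℂ) (k l : Fin 2),
        (!![(twistBy b c).re, -(twistBy b c).im; (twistBy b c).im, (twistBy b c).re] :
          Matrix (Fin 2) (Fin 2) ℝ) k 0 *
          (!![x, y; -twistSign b * y, twistSign b * x] : Matrix (Fin 2) (Fin 2) ℝ) 0 l +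
        (!![(twistBy b c).re, -(twistBy b c).im; (twistBy b c).im, (twistBy b c).re] :
          Matrix (Fin 2) (Fin 2) ℝ) k 1 *
          (!![x, y; -twistSign b * y, twistSign b * x] : Matrix (Fin 2) (Fin 2) ℝ) 1 l =
        (!![x, y; -twistSign b * y, twistSign b * x] : Matrix (Fin 2) (Fin 2) ℝ) k 0 *
          (!![c.re, -c.im; c.im, c.re] : Matrix (Fin 2) (Fin 2) ℝ) 0 l +
        (!![x, y; -twistSign b * y, twistSign b * x] : Matrix (Fin 2) (Fin 2) ℝ) k 1 *
          (!![c.re, -c.im; c.im, c.re] : Matrix (Fin 2) (Fin 2) ℝ) 1 l := by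
      intro c k l
      fin_cases k <;> fin_cases l <;> cases b <;> simp [twistBy, twistSign] <;> ring
    exact key
  · have key : ∀ k l : Fin 2,
        (!![(1 : ℂ).re, -(1 : ℂ).im; (1 : ℂ).im, (1 : ℂ).re] : Matrix (Fin 2) (Fin 2) ℝ) k 0 *
          (!![x, y; -twistSign b * y, twistSign b * x] : Matrix (Fin 2) (Fin 2) ℝ) 0 l +
        (!![(1 : ℂ).re, -(1 : ℂ).im; (1 : ℂ).im, (1 : ℂ).re] : Matrix (Fin 2) (Fin 2) ℝ) k 1 *
          (!![x, y; -twistSign b * y, twistSign b * x] : Matrix (Fin 2) (Fin 2) ℝ) 1 l =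
        (!![x, y; -twistSign b * y, twistSign b * x] : Matrix (Fin 2) (Fin 2) ℝ) k l := by
      intro k l
      fin_cases k <;> fin_cases l <;> simp
    exact key

lemma isArrowModel_arrowMat' (b : Bool) {d d' : DivisionKind} (X : SimpleBimodule d d') :
    IsArrowModel b (arrowMat' b X) := by
  cases X with
  | rr => simpa using! isArrowModel_rr (b := b) 0 1
  | hh =>
    have key : ∀ c, Quaternion.ofComplex (twistBy b c) *
        ((1 / 2 : ℝ) • (bif b then quaternionJ * quaternionI else -quaternionI)) =
        ((1 / 2 : ℝ) • (bif b then quaternionJ * quaternionI else -quaternionI)) *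
          Quaternion.ofComplex c := by
      intro c
      rw [mul_smul_comm, smul_mul_assoc]
      congr 1
      cases b with
      | false =>
        change Quaternion.ofComplex c * -quaternionI = -quaternionI * Quaternion.ofComplex c
        rw [quaternionI, ← map_neg, ← map_mul, ← map_mul, mul_comm]
      | true =>
        change Quaternion.ofComplex (starRingEnd ℂ c) * (quaternionJ * quaternionI) =
          quaternionJ * quaternionI * Quaternion.ofComplex c
        rw [mul_assoc, quaternionI, ← map_mul, mul_comm Complex.I, map_mul, ← mul_assoc,
          ← mul_assoc, quaternionJ_mul_ofComplex]
    exact isArrowModel_corner (X := .hh) nofun nofun key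
  | _ => exact IsArrowModel.zero b _

lemma isArrowModel_arrowMat (b : Bool) {d d' : DivisionKind} (X : SimpleBimodule d d')
    (hX : X.IsCompatible b) : IsArrowModel b (arrowMat b X) := by
  cases X with
  | rr => simpa using! isArrowModel_rr (b := b) 1 0
  | rc =>
    have h0 : ∀ c : ℂ, (twistBy b c).re • (1 : ℂ) +
        (-(twistBy b c).im) • ((-twistSign b) • Complex.I) = 1 * c := by
      intro c
      apply Complex.ext <;> cases b <;> simp [twistBy, twistSign]
    have h1 : ∀ c : ℂ, (twistBy b c).im • (1 : ℂ) +
        (twistBy b c).re • ((-twistSign b) • Complex.I) = ((-twistSign b) • Complex.I) * c := by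
      intro c
      apply Complex.ext <;> cases b <;> simp [twistBy, twistSign]
    exact isArrowModel_col (X := .rc) nofun h0 h1
  | rh =>
    have h0 : ∀ c : ℂ, (twistBy b c).re • (1 : ℍ[ℝ]) +
        (-(twistBy b c).im) • ((-twistSign b) • quaternionI) = 1 * Quaternion.ofComplex c := by
      intro c
      rw [quaternionI, ← map_smul, ← map_smul, ← map_one Quaternion.ofComplex, ← map_smul,
        ← map_add, ← map_mul]
      congr 1
      apply Complex.ext <;> cases b <;> simp [twistBy, twistSign]
    have h1 : ∀ c : ℂ, (twistBy b c).im • (1 : ℍ[ℝ]) +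
        (twistBy b c).re • ((-twistSign b) • quaternionI) =
        ((-twistSign b) • quaternionI) * Quaternion.ofComplex c := by
      intro c
      rw [quaternionI, ← map_smul, ← map_smul, ← map_one Quaternion.ofComplex, ← map_smul,
        ← map_add, ← map_mul]
      congr 1
      apply Complex.ext <;> cases b <;> simp [twistBy, twistSign]
    exact isArrowModel_col (X := .rh) nofun h0 h1
  | cr =>
    have h0 : ∀ c : ℂ, twistBy b c * 1 = op c.re • (1 : ℂ) +
        op c.im • (twistSign b • Complex.I) := by
      intro c
      apply Complex.ext <;> cases b <;> simp [twistBy, twistSign]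
    have h1 : ∀ c : ℂ, twistBy b c * (twistSign b • Complex.I) = op (-c.im) • (1 : ℂ) +
        op c.re • (twistSign b • Complex.I) := by
      intro c
      apply Complex.ext <;> cases b <;> simp [twistBy, twistSign]
    exact isArrowModel_row (X := .cr) nofun h0 h1
  | hr =>
    have hop : ∀ (r : ℝ) (x : ℍ[ℝ]), op r • x = r • x := by
      intro r x
      ext <;> simp [mul_comm]
    have h0 : ∀ c : ℂ, Quaternion.ofComplex (twistBy b c) * 1 = op c.re • (1 : ℍ[ℝ]) +
        op c.im • (twistSign b • quaternionI) := by
      intro c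
      rw [hop, hop, quaternionI, ← map_smul, ← map_smul, ← map_one Quaternion.ofComplex, ← map_smul,
        ← map_add, ← map_mul]
      congr 1
      apply Complex.ext <;> cases b <;> simp [twistBy, twistSign]
    have h1 : ∀ c : ℂ, Quaternion.ofComplex (twistBy b c) * (twistSign b • quaternionI) =
        op (-c.im) • (1 : ℍ[ℝ]) + op c.re • (twistSign b • quaternionI) := by
      intro c
      rw [hop, hop, quaternionI, ← map_smul, ← map_smul, ← map_one Quaternion.ofComplex, ← map_smul,
        ← map_add, ← map_mul]
      congr 1
      apply Complex.ext <;> cases b <;> simp [twistBy, twistSign]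
    exact isArrowModel_row (X := .hr) nofun h0 h1
  | cc =>
    have hb : b = false := hX
    subst hb
    have key : ∀ c : ℂ, c * 1 = 1 * c := fun c => mul_comm c 1
    exact isArrowModel_corner (X := .cc) nofun nofun key
  | ccBar =>
    have hb : b = true := hX
    subst hb
    have key : ∀ c : ℂ, starRingEnd ℂ c * 1 = 1 * starRingEnd ℂ c := fun c => mul_comm _ 1
    exact isArrowModel_corner (X := .ccBar) nofun nofun key
  | ch =>
    have key : ∀ c : ℂ, twistBy b c • (bif b then !![0, -1] else !![1, 0] :
        Matrix (Fin 1) (Fin 2) ℂ) = (bif b then !![0, -1] else !![1, 0] :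
        Matrix (Fin 1) (Fin 2) ℂ) *
          quaternionToMatrix (Quaternion.ofComplex c) := by
      intro c
      have := quaternionToMatrix_eq c 0
      rw [map_zero, zero_mul, add_zero] at this
      rw [this]
      cases b <;> simp [twistBy]
    exact isArrowModel_corner (X := .ch) nofun nofun key
  | hc =>
    have key : ∀ c : ℂ, quaternionToMatrix (Quaternion.ofComplex (twistBy b c)) *
        (bif b then !![0; 1] else !![1; 0] : Matrix (Fin 2) (Fin 1) ℂ) =
        op c • (bif b then !![0; 1] else !![1; 0] : Matrix (Fin 2) (Fin 1) ℂ) := by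
      intro c
      have := quaternionToMatrix_eq (twistBy b c) 0
      rw [map_zero, zero_mul, add_zero] at this
      rw [this]
      cases b <;> simp [twistBy]
    exact isArrowModel_corner (X := .hc) nofun nofun key
  | hh =>
    have key : ∀ c, Quaternion.ofComplex (twistBy b c) *
        ((1 / 2 : ℝ) • (bif b then -quaternionJ else 1)) =
        ((1 / 2 : ℝ) • (bif b then -quaternionJ else 1)) * Quaternion.ofComplex c := by
      intro c
      rw [mul_smul_comm, smul_mul_assoc]
      congr 1
      cases b with
      | false => exact (mul_one _).trans (one_mul _).symm
      | true =>
        change Quaternion.ofComplex (starRingEnd ℂ c) * (-quaternionJ) =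
          (-quaternionJ) * Quaternion.ofComplex c
        rw [mul_neg, neg_mul, quaternionJ_mul_ofComplex]
    exact isArrowModel_corner (X := .hh) nofun nofun key

/-- The coefficients for the conjugation are -j times those for the trivial twist, so multiplication
by j makes the two cases agree. -/
lemma shiftLeft_hom {b : Bool} {f : ℍ[ℝ] →ₙₐ[ℝ] C} {w w' : ℍ[ℝ] →ₗ[ℝ] C}
    (hl : ∀ a m, w (a * m) = f a * w m) (hl' : ∀ a m, w' (a * m) = f a * w' m) :
    shiftLeft f (w ((1 / 2 : ℝ) • (bif b then -quaternionJ else 1)) +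
      w' ((1 / 2 : ℝ) • (bif b then quaternionJ * quaternionI else -quaternionI))) b =
    w ((1 / 2 : ℝ) • 1) + w' ((1 / 2 : ℝ) • (-quaternionI)) := by
  cases b with
  | false => rfl
  | true =>
    change f quaternionJ * (w ((1 / 2 : ℝ) • (-quaternionJ)) +
      w' ((1 / 2 : ℝ) • (quaternionJ * quaternionI))) = _
    rw [mul_add, ← hl, ← hl', mul_smul_comm, mul_smul_comm, mul_neg, quaternionJ_mul_self, neg_neg,
      ← mul_assoc, quaternionJ_mul_self, neg_mul, one_mul]

section Model

variable {b : Bool} {d d' : DivisionKind} {X : SimpleBimodule d d'} {f : d.Carrier →ₙₐ[ℝ] C}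
  {g : d'.Carrier →ₙₐ[ℝ] C} {w w' : X.Carrier →ₗ[ℝ] C}

/-- Homomorphisms from the simple bimodules give a matrix which satisfies the relations of the
arrow. -/
lemma isArrowRep_of_hom (hX : X.IsCompatible b)
    (hl : ∀ a m, w (a • m) = f a * w m) (hr : ∀ a m, w (op a • m) = w m * g a)
    (hl' : ∀ a m, w' (a • m) = f a * w' m) (hr' : ∀ a m, w' (op a • m) = w' m * g a) :
    IsArrowRep b f g ((arrowMat b X).map w + (arrowMat' b X).map w') where
  rel c := by
    have h := (isArrowModel_arrowMat b X hX).rel c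
    have h' := (isArrowModel_arrowMat' b X).rel c
    ext k l
    simp only [Matrix.mul_apply, Fin.sum_univ_two, Matrix.map_apply, Matrix.add_apply, mul_add,
      add_mul, ← hl, ← hl', ← hr, ← hr']
    have e := congrArg w (h k l)
    have e' := congrArg w' (h' k l)
    rw [map_add, map_add] at e e'
    rw [add_add_add_comm, e, e', add_add_add_comm]
  one_mul := by
    have h := (isArrowModel_arrowMat b X hX).one_smul
    have h' := (isArrowModel_arrowMat' b X).one_smul
    ext k l
    simp only [Matrix.mul_apply, Fin.sum_univ_two, Matrix.map_apply, Matrix.add_apply, mul_add,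
      ← hl, ← hl']
    rw [add_add_add_comm, ← map_add, ← map_add, h, h']

/-- The homomorphism determined by the matrix of a homomorphism is the given one. -/
lemma arrowMap_of_hom
    (hl : ∀ a m, w (a • m) = f a * w m) (hr : ∀ a m, w (op a • m) = w m * g a)
    (hl' : ∀ a m, w' (a • m) = f a * w' m) (hr' : ∀ a m, w' (op a • m) = w' m * g a)
    (m : X.Carrier) :
    arrowMap b ((arrowMat b X).map w + (arrowMat' b X).map w') X f g m = w m := by
  cases X with
  | rr =>
    have key (w w' : ℝ →ₗ[ℝ] C) (m : ℝ) : m • (w 1 + w' 0) = w m := by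
      rw [map_zero, add_zero, ← map_smul, smul_eq_mul, mul_one]
    exact key w w' m
  | rc =>
    have key (w w' : ℂ →ₗ[ℝ] C) (g : ℂ →ₙₐ[ℝ] C) (hr : ∀ a m, w (m * a) = w m * g a) (m : ℂ) :
        (w 1 + w' 0) * g m = w m := by
      rw [map_zero, add_zero, ← hr, one_mul]
    exact key w w' g hr m
  | rh =>
    have key (w w' : ℍ[ℝ] →ₗ[ℝ] C) (g : ℍ[ℝ] →ₙₐ[ℝ] C) (hr : ∀ a m, w (m * a) = w m * g a)
        (m : ℍ[ℝ]) : (w 1 + w' 0) * g m = w m := by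
      rw [map_zero, add_zero, ← hr, one_mul]
    exact key w w' g hr m
  | hr =>
    have key (w w' : ℍ[ℝ] →ₗ[ℝ] C) (f : ℍ[ℝ] →ₙₐ[ℝ] C) (hl : ∀ a m, w (a * m) = f a * w m)
        (m : ℍ[ℝ]) : f m * (w 1 + w' 0) = w m := by
      rw [map_zero, add_zero, ← hl, mul_one]
    exact key w w' f hl m
  | ch =>
    have key (w w' : Matrix (Fin 1) (Fin 2) ℂ →ₗ[ℝ] C) (f : ℂ →ₙₐ[ℝ] C) (g : ℍ[ℝ] →ₙₐ[ℝ] C)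
        (hl : ∀ (a : ℂ) m, w (a • m) = f a * w m)
        (hr : ∀ a m, w (m * quaternionToMatrix a) = w m * g a) (m : Matrix (Fin 1) (Fin 2) ℂ) :
        rowMap f (shiftRight (w (bif b then !![0, -1] else !![1, 0]) + w' 0) g b) g m = w m := by
      have hJ := quaternionToMatrix_eq 0 1
      rw [map_zero, map_one, zero_add, one_mul] at hJ
      have hs : shiftRight (w (bif b then !![0, -1] else !![1, 0]) + w' 0) g b = w !![1, 0] := by
        rw [map_zero, add_zero]
        cases b with
        | false => rfl
        | true =>
          change w !![0, -1] * g quaternionJ = _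
          rw [← hr, hJ]
          simp
      rw [hs]
      change f (m 0 0) * w !![1, 0] + f (m 0 1) * (w !![1, 0] * g quaternionJ) = w m
      rw [← hr, ← hl, ← hl, ← map_add, hJ]
      congr 1
      ext i j
      fin_cases i; fin_cases j <;> simp
    exact key w w' f g hl hr m
  | hc =>
    have key (w w' : Matrix (Fin 2) (Fin 1) ℂ →ₗ[ℝ] C) (f : ℍ[ℝ] →ₙₐ[ℝ] C) (g : ℂ →ₙₐ[ℝ] C)
        (hl : ∀ a m, w (quaternionToMatrix a * m) = f a * w m)
        (hr : ∀ (a : ℂ) m, w (op a • m) = w m * g a) (m : Matrix (Fin 2) (Fin 1) ℂ) :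
        colMap f (shiftLeft f (w (bif b then !![0; 1] else !![1; 0]) + w' 0) b) g m = w m := by
      have hJ := quaternionToMatrix_eq 0 1
      rw [map_zero, map_one, zero_add, one_mul] at hJ
      have hs : shiftLeft f (w (bif b then !![0; 1] else !![1; 0]) + w' 0) b = w !![1; 0] := by
        rw [map_zero, add_zero]
        cases b with
        | false => rfl
        | true =>
          change f quaternionJ * w !![0; 1] = _
          rw [← hl, hJ]
          simp
      rw [hs]
      change w !![1; 0] * g (m 0 0) - f quaternionJ * w !![1; 0] * g (m 1 0) = w m
      rw [← hl, ← hr, ← hr, ← map_sub, hJ]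
      congr 1
      ext i j
      fin_cases j; fin_cases i <;> simp
    exact key w w' f g hl hr m
  | hh =>
    have key (w w' : ℍ[ℝ] →ₗ[ℝ] C) (f g : ℍ[ℝ] →ₙₐ[ℝ] C)
        (hl : ∀ a m, w (a * m) = f a * w m) (hr : ∀ a m, w (m * a) = w m * g a)
        (hl' : ∀ a m, w' (a * m) = f a * w' m) (hr' : ∀ a m, w' (m * a) = w' m * g a) (m : ℍ[ℝ]) :
        f m * quaternionAverage f (shiftLeft f (w ((1 / 2 : ℝ) • (bif b then -quaternionJ else 1)) +
          w' ((1 / 2 : ℝ) • (bif b then quaternionJ * quaternionI else -quaternionI))) b) g =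
          w m := by
      rw [shiftLeft_hom hl hl', quaternionAverage, mul_add, add_mul, ← hl, ← hr, ← hl', ← hr']
      -- Averaging m ↦ m - j m j doubles 1/2 and kills -i/2, as j i j = i. Only w survives.
      have h1 : quaternionJ * (1 / 2 : ℝ) • (1 : ℍ[ℝ]) * quaternionJ = -((1 / 2 : ℝ) • 1) := by
        rw [mul_smul_comm, mul_one, smul_mul_assoc, quaternionJ_mul_self, smul_neg]
      have h2 : quaternionJ * (1 / 2 : ℝ) • (-quaternionI) * quaternionJ =
          (1 / 2 : ℝ) • (-quaternionI) := by
        rw [mul_smul_comm, mul_neg, quaternionJ_mul_quaternionI, neg_neg, smul_mul_assoc, mul_assoc,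
          quaternionJ_mul_self, mul_neg, mul_one]
      have h3 : w ((1 / 2 : ℝ) • 1) + w ((1 / 2 : ℝ) • 1) = w 1 := by
        rw [← map_add, ← add_smul]
        norm_num
      rw [h1, h2, map_neg, add_sub_add_right_eq_sub, sub_neg_eq_add, h3, ← hl, mul_one]
    exact key w w' f g hl hr hl' hr' m
  | _ =>
    have key (w w' : ℂ →ₗ[ℝ] C) (f : ℂ →ₙₐ[ℝ] C) (hl : ∀ a m, w (a * m) = f a * w m)
        (m : ℂ) : f m * (w 1 + w' 0) = w m := by
      rw [map_zero, add_zero, ← hl, mul_one]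
    exact key w w' f hl m

/-- Without a second arrow `arrowMap'` is zero, so nothing can be said about w'. For quaternions,
right multiplication by i turns 1/2 and -i/2 into i/2 and 1/2, so that averaging now kills the part
of w and leaves w'(1). -/
lemma arrowMap'_of_hom
    (hl : ∀ a m, w (a • m) = f a * w m) (hr : ∀ a m, w (op a • m) = w m * g a)
    (hl' : ∀ a m, w' (a • m) = f a * w' m) (hr' : ∀ a m, w' (op a • m) = w' m * g a)
    (hX : X.IsDouble) (m : X.Carrier) :
    arrowMap' b ((arrowMat b X).map w + (arrowMat' b X).map w') X f g m = w' m := by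
  cases X with
  | rr =>
    have key (w w' : ℝ →ₗ[ℝ] C) (m : ℝ) : m • (w 0 + w' 1) = w' m := by
      rw [map_zero, zero_add, ← map_smul, smul_eq_mul, mul_one]
    exact key w w' m
  | hh =>
    have key (w w' : ℍ[ℝ] →ₗ[ℝ] C) (f g : ℍ[ℝ] →ₙₐ[ℝ] C)
        (hl : ∀ a m, w (a * m) = f a * w m) (hr : ∀ a m, w (m * a) = w m * g a)
        (hl' : ∀ a m, w' (a * m) = f a * w' m) (hr' : ∀ a m, w' (m * a) = w' m * g a) (m : ℍ[ℝ]) :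
        f m * quaternionAverage f (shiftLeft f (w ((1 / 2 : ℝ) • (bif b then -quaternionJ else 1)) +
          w' ((1 / 2 : ℝ) • (bif b then quaternionJ * quaternionI else -quaternionI))) b *
            g quaternionI) g = w' m := by
      rw [shiftLeft_hom hl hl', quaternionAverage, add_mul, mul_add, add_mul, ← hr, ← hr', ← hl,
        ← hr, ← hl', ← hr']
      have h1 : (1 / 2 : ℝ) • (1 : ℍ[ℝ]) * quaternionI = (1 / 2 : ℝ) • quaternionI := by
        rw [smul_mul_assoc, one_mul]
      have h2 : (1 / 2 : ℝ) • (-quaternionI) * quaternionI = (1 / 2 : ℝ) • 1 := by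
        rw [smul_mul_assoc, neg_mul, quaternionI_mul_self, neg_neg]
      have h3 : quaternionJ * (1 / 2 : ℝ) • quaternionI * quaternionJ =
          (1 / 2 : ℝ) • quaternionI := by
        rw [mul_smul_comm, quaternionJ_mul_quaternionI, smul_mul_assoc, neg_mul, mul_assoc,
          quaternionJ_mul_self, mul_neg, mul_one, neg_neg]
      have h4 : quaternionJ * (1 / 2 : ℝ) • (1 : ℍ[ℝ]) * quaternionJ = -((1 / 2 : ℝ) • 1) := by
        rw [mul_smul_comm, mul_one, smul_mul_assoc, quaternionJ_mul_self, smul_neg]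
      have h5 : w' ((1 / 2 : ℝ) • 1) + w' ((1 / 2 : ℝ) • 1) = w' 1 := by
        rw [← map_add, ← add_smul]
        norm_num
      rw [h1, h2, h3, h4, map_neg, add_sub_add_left_eq_sub, sub_neg_eq_add, h5, ← hl', mul_one]
    exact key w w' f g hl hr hl' hr' m
  | _ => exact absurd hX id

end Model

end ArrowBimodule

/-! ### Change of entries, and the matrix of an arrow between two vertices -/

section ArrowBimodule

open MulOpposite

variable {C C' : Type*} [Ring C] [Algebra ℝ C] [Ring C'] [Algebra ℝ C']

/-- The homomorphism between matrix rings given by a homomorphism of the entries. -/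
def matHom (f : C →ₙₐ[ℝ] C') :
    Matrix (Fin 2) (Fin 2) C →ₙₐ[ℝ] Matrix (Fin 2) (Fin 2) C' where
  toFun M := M.map f
  map_zero' := by ext i j; exact map_zero f
  map_add' M N := by ext i j; exact map_add f _ _
  map_smul' r M := by ext i j; exact map_smul f r _
  map_mul' M N := by
    ext i j
    simp only [Matrix.map_apply, Matrix.mul_apply, Fin.sum_univ_two, map_add, map_mul]

lemma matHom_single (f : C →ₙₐ[ℝ] C') (k l : Fin 2) (c : C) :
    matHom f (Matrix.single k l c) = Matrix.single k l (f c) :=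
  Matrix.map_single k l c f

lemma scalarMat_one_apply_of_ne (d : DivisionKind) {k l : Fin 2} (h : k ≠ l) :
    scalarMat d 1 k l = 0 := by
  by_cases hd : d = .real
  · subst hd
    exact (congrFun (congrFun scalarMat_real_one k) l).trans (Matrix.one_apply_ne h)
  · refine scalarMat_apply_eq_zero hd 1 fun h' => h (h'.1.trans h'.2.symm)

namespace IsArrowRep

variable {b : Bool} {d d' : DivisionKind} {f : d.Carrier →ₙₐ[ℝ] C} {g : d'.Carrier →ₙₐ[ℝ] C}
  {u : Matrix (Fin 2) (Fin 2) C}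

lemma map_scalarMat_one_mul (h : IsArrowRep b f g u) (k l : Fin 2) :
    f (scalarMat d 1 k k) * u k l = u k l := by
  have h1 := h.one_mul_apply k l
  fin_cases k
  · have := scalarMat_one_apply_of_ne d (zero_ne_one : (0 : Fin 2) ≠ 1)
    simpa [this] using h1
  · have := scalarMat_one_apply_of_ne d (one_ne_zero : (1 : Fin 2) ≠ 0)
    simpa [this] using h1

lemma mul_map_scalarMat_one (h : IsArrowRep b f g u) (k l : Fin 2) :
    u k l * g (scalarMat d' 1 l l) = u k l := by
  have h1 := h.mul_one_apply k l
  fin_cases l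
  · have := scalarMat_one_apply_of_ne d' (one_ne_zero : (1 : Fin 2) ≠ 0)
    simpa [this] using h1
  · have := scalarMat_one_apply_of_ne d' (zero_ne_one : (0 : Fin 2) ≠ 1)
    simpa [this] using h1

/-- In the matrix model y_k and x_l are matrix units, up to padding. Sandwiching the matrix of an
arrow between them moves its entry (k, l) to the corner. -/
lemma single_mul_mul_single (h : IsArrowRep b f g u) (k l : Fin 2) :
    Matrix.single (0 : Fin 2) k (f (scalarMat d 1 k k)) * u *
        Matrix.single l (0 : Fin 2) (g (scalarMat d' 1 l l)) =
      Matrix.single 0 0 (u k l) := by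
  rw [Matrix.single_mul_mul_single, h.map_scalarMat_one_mul, h.mul_map_scalarMat_one]

/-- Conjugating the element of an arrow by the elements `y_k` and `x_l` at its end points gives a
matrix which satisfies the relations of the arrow. -/
lemma of_vertexRep {z z' : ℂ →ₙₐ[ℝ] C} {s s' x : C} (h : IsVertexRep d z s)
    (h' : IsVertexRep d' z' s') (hx : ∀ c, x * z' c = z (twistBy b c) * x) (h1 : z 1 * x = x) :
    IsArrowRep b h.emb h'.emb
      (Matrix.of fun k l => vertexRow z s d k * x * vertexCol z' s' d' l) := by
  have left (c : ℂ) (k l : Fin 2) : ((scalarMat d c).map h.emb *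
      Matrix.of fun k l => vertexRow z s d k * x * vertexCol z' s' d' l) k l =
      vertexRow z s d k * z c * x * vertexCol z' s' d' l := by
    simp only [Matrix.mul_apply, Matrix.map_apply, Matrix.of_apply,
      ← h.vertexRow_mul_map_mul_vertexCol]
    -- The inner factors x_m y_m sum to z 1, which can be absorbed by z c.
    calc ∑ m, vertexRow z s d k * z c * vertexCol z s d m *
          (vertexRow z s d m * x * vertexCol z' s' d' l) =
        ∑ m, vertexRow z s d k * z c * (vertexCol z s d m * vertexRow z s d m) *
          (x * vertexCol z' s' d' l) := Finset.sum_congr rfl fun m _ => by simp only [mul_assoc]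
      _ = _ := by
        rw [← Finset.sum_mul, ← Finset.mul_sum, h.sum_vertexCol_mul_vertexRow,
          mul_assoc _ (z c), ← map_mul, _root_.mul_one, mul_assoc _ x]
  have right (c : ℂ) (k l : Fin 2) :
      ((Matrix.of fun k l => vertexRow z s d k * x * vertexCol z' s' d' l) *
        (scalarMat d' c).map h'.emb) k l =
      vertexRow z s d k * (x * z' c) * vertexCol z' s' d' l := by
    simp only [Matrix.mul_apply, Matrix.map_apply, Matrix.of_apply,
      ← h'.vertexRow_mul_map_mul_vertexCol]
    calc ∑ m, vertexRow z s d k * x * vertexCol z' s' d' m *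
          (vertexRow z' s' d' m * z' c * vertexCol z' s' d' l) =
        ∑ m, vertexRow z s d k * x * (vertexCol z' s' d' m * vertexRow z' s' d' m) *
          (z' c * vertexCol z' s' d' l) := Finset.sum_congr rfl fun m _ => by simp only [mul_assoc]
      _ = _ := by
        rw [← Finset.sum_mul, ← Finset.mul_sum, h'.sum_vertexCol_mul_vertexRow,
          mul_assoc _ (z' 1), ← mul_assoc (z' 1), ← map_mul, _root_.one_mul]
        simp only [mul_assoc]
  constructor
  · intro c
    ext k l
    rw [left, right, hx, ← mul_assoc]
  · ext k l
    rw [left, mul_assoc _ (z 1), h1]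
    rfl

end IsArrowRep

section Naturality

variable (F : C →ₙₐ[ℝ] C') (b : Bool) (u : Matrix (Fin 2) (Fin 2) C) {d d' : DivisionKind}
  (X : SimpleBimodule d d') (f : d.Carrier →ₙₐ[ℝ] C) (g : d'.Carrier →ₙₐ[ℝ] C) (m : X.Carrier)

lemma map_shiftLeft (f : ℍ[ℝ] →ₙₐ[ℝ] C) (x : C) :
    F (shiftLeft f x b) = shiftLeft (F.comp f) (F x) b := by
  cases b with
  | false => rfl
  | true => exact map_mul F _ _

lemma map_shiftRight (f : ℍ[ℝ] →ₙₐ[ℝ] C) (x : C) :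
    F (shiftRight x f b) = shiftRight (F x) (F.comp f) b := by
  cases b with
  | false => rfl
  | true => exact map_mul F _ _

lemma map_quaternionAverage (f g : ℍ[ℝ] →ₙₐ[ℝ] C) (x : C) :
    F (quaternionAverage f x g) = quaternionAverage (F.comp f) (F x) (F.comp g) := by
  rw [quaternionAverage, map_sub, map_mul, map_mul]
  rfl

/-- The homomorphism is built from f, g and the entries of u by ring operations. It is used both for
A → M₂(T) and for the inclusion of T as the corner of M₂(T). -/
lemma map_arrowMap :
    F (arrowMap b u X f g m) = arrowMap b (u.map F) X (F.comp f) (F.comp g) m := by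
  cases X with
  | rr => exact map_smul F (show ℝ from m) _
  | ch =>
    have key (f : ℂ →ₙₐ[ℝ] C) (g : ℍ[ℝ] →ₙₐ[ℝ] C) (m : Matrix (Fin 1) (Fin 2) ℂ) :
        F (rowMap f (shiftRight (u 0 0) g b) g m) =
          rowMap (F.comp f) (shiftRight (F (u 0 0)) (F.comp g) b) (F.comp g) m := by
      simp only [rowMap, LinearMap.coe_mk, AddHom.coe_mk, map_add, map_mul, map_shiftRight,
        NonUnitalAlgHom.comp_apply]
    exact key f g m
  | hc =>
    have key (f : ℍ[ℝ] →ₙₐ[ℝ] C) (g : ℂ →ₙₐ[ℝ] C) (m : Matrix (Fin 2) (Fin 1) ℂ) :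
        F (colMap f (shiftLeft f (u 0 0) b) g m) =
          colMap (F.comp f) (shiftLeft (F.comp f) (F (u 0 0)) b) (F.comp g) m := by
      simp only [colMap, LinearMap.coe_mk, AddHom.coe_mk, map_sub, map_mul, map_shiftLeft,
        NonUnitalAlgHom.comp_apply]
    exact key f g m
  | hh =>
    have key (f g : ℍ[ℝ] →ₙₐ[ℝ] C) (m : ℍ[ℝ]) :
        F (f m * quaternionAverage f (shiftLeft f (u 0 0) b) g) =
          F (f m) * quaternionAverage (F.comp f) (shiftLeft (F.comp f) (F (u 0 0)) b)
            (F.comp g) := by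
      rw [map_mul, map_quaternionAverage, map_shiftLeft]
    exact key f g m
  | _ => exact map_mul F _ _

lemma map_arrowMap' :
    F (arrowMap' b u X f g m) = arrowMap' b (u.map F) X (F.comp f) (F.comp g) m := by
  cases X with
  | rr => exact map_smul F (show ℝ from m) _
  | hh =>
    have key (f g : ℍ[ℝ] →ₙₐ[ℝ] C) (m : ℍ[ℝ]) :
        F (f m * quaternionAverage f (shiftLeft f (u 0 0) b * g quaternionI) g) =
          F (f m) * quaternionAverage (F.comp f)
            (shiftLeft (F.comp f) (F (u 0 0)) b * F (g quaternionI)) (F.comp g) := by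
      rw [map_mul, map_quaternionAverage, map_mul, map_shiftLeft]
    exact key f g m
  | _ => exact map_zero F

end Naturality

end ArrowBimodule

/-! ### Special loops and the types of the vertices -/

namespace SemilinearQuiver

variable {V E : Type*} (Q : SemilinearQuiver V E)

open Classical in
/-- The value of a function on the arrows at the special loop of a vertex, or zero if there is no
special loop. -/
def loopElt {Y : Type*} [Zero Y] (x : E → Y) (i : V) : Y :=
  if h : ∃ s : Q.special, Q.src s = i then x h.choose else 0

/-- At most one special loop starts at a vertex, so the chosen loop must be s. -/
lemma loopElt_src {Y : Type*} [Zero Y] (x : E → Y) (s : Q.special) :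
    Q.loopElt x (Q.src s) = x s := by
  have h : ∃ s' : Q.special, Q.src s' = Q.src s := ⟨s, rfl⟩
  rw [loopElt, dif_pos h]
  exact congrArg x (Q.unique_special _ h.choose.2 _ s.2 h.choose_spec)

lemma loopElt_eq_zero {Y : Type*} [Zero Y] (x : E → Y) {i : V}
    (h : ¬∃ s : Q.special, Q.src s = i) : Q.loopElt x i = 0 := dif_neg h

lemma map_loopElt {Y Y' : Type*} [Ring Y] [Algebra ℝ Y] [Ring Y'] [Algebra ℝ Y']
    (F : Y →ₙₐ[ℝ] Y') (x : E → Y) (i : V) :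
    F (Q.loopElt x i) = Q.loopElt (fun a => F (x a)) i := by
  by_cases h : ∃ s : Q.special, Q.src s = i
  · obtain ⟨s, rfl⟩ := h
    rw [loopElt_src, loopElt_src]
  · rw [loopElt_eq_zero Q _ h, loopElt_eq_zero Q _ h, map_zero]

lemma kind_of_sign_eq_one (s : Q.special) (hs : Q.sign s = 1) : Q.kind (Q.src s) = .real :=
  if_pos ⟨s, rfl, hs⟩

lemma kind_of_sign_eq_neg_one (s : Q.special) (hs : Q.sign s = -1) :
    Q.kind (Q.src s) = .quaternion := by
  have h : ¬∃ s' : Q.special, Q.src s' = Q.src s ∧ Q.sign s' = 1 := by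
    rintro ⟨s', h1, h2⟩
    have : s' = s := Subtype.ext (Q.unique_special _ s'.2 _ s.2 h1)
    rw [this, hs] at h2
    exact absurd h2 (by decide)
  exact (if_neg h).trans (if_pos ⟨s, rfl, hs⟩)

lemma kind_of_not_exists {i : V} (h : ¬∃ s : Q.special, Q.src s = i) : Q.kind i = .complex :=
  (if_neg fun ⟨s, h1, _⟩ => h ⟨s, h1⟩).trans (if_neg fun ⟨s, h1, _⟩ => h ⟨s, h1⟩)

lemma isVertexRep {Y : Type*} [Ring Y] [Algebra ℝ Y] (z : V → (ℂ →ₙₐ[ℝ] Y)) (x : E → Y)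
    (hl : ∀ a, z (Q.tgt a) 1 * x a = x a)
    (hx : ∀ a c, x a * z (Q.src a) c = z (Q.tgt a) (Q.twist a c) * x a)
    (hp : ∀ s : Q.special, Q.sign s = 1 → x s * x s = z (Q.src s) 1)
    (hm : ∀ s : Q.special, Q.sign s = -1 → x s * x s = -z (Q.src s) 1) (i : V) :
    IsVertexRep (Q.kind i) (z i) (Q.loopElt x i) := by
  by_cases h : ∃ s : Q.special, Q.src s = i
  · obtain ⟨s, rfl⟩ := h
    have h1 : z (Q.src s) 1 * x s = x s := by rw [Q.loop s s.2, hl]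
    have h2 (c : ℂ) : x s * z (Q.src s) c = z (Q.src s) (starRingEnd ℂ c) * x s := by
      rw [hx, Q.twist_special s s.2, ← Q.loop s s.2]
      rfl
    rw [loopElt_src]
    rcases Int.units_eq_one_or (Q.sign s) with hs | hs
    · rw [Q.kind_of_sign_eq_one s hs]
      exact ⟨h1, h2, hp s hs⟩
    · rw [Q.kind_of_sign_eq_neg_one s hs]
      exact ⟨h1, h2, hm s hs⟩
  · rw [Q.kind_of_not_exists h, loopElt_eq_zero Q _ h]
    exact ⟨mul_zero _, fun c => by rw [zero_mul, mul_zero], rfl⟩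

end SemilinearQuiver

/-! ## The matrix model of `ℂ_σQ/⟨S⟩` -/

lemma isDouble_ofTwist_iff (σ : ℂ ≃ₐ[ℝ] ℂ) (d d' : DivisionKind) :
    (SimpleBimodule.ofTwist σ d d').IsDouble ↔
      (d' = .real ∧ d = .real) ∨ (d' = .quaternion ∧ d = .quaternion) := by
  cases d <;> cases d' <;> simp [SimpleBimodule.ofTwist, SimpleBimodule.IsDouble]

namespace SemilinearQuiver

open MulOpposite

variable {V E : Type*} (Q : SemilinearQuiver V E)

/-- Whether the twist of an arrow is the conjugation. -/
def isConj (a : E) : Bool := (exists_eq_twistBy (Q.twist a)).choose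

lemma twist_eq (a : E) : Q.twist a = twistBy (Q.isConj a) :=
  (exists_eq_twistBy (Q.twist a)).choose_spec

/-- The simple bimodule at an arrow. -/
abbrev simpleBimodule (a : E) : SimpleBimodule (Q.kind (Q.tgt a)) (Q.kind (Q.src a)) :=
  SimpleBimodule.ofTwist (Q.twist a) _ _

lemma simpleBimodule_isCompatible (a : E) : (Q.simpleBimodule a).IsCompatible (Q.isConj a) := by
  rw [simpleBimodule, twist_eq]
  exact ofTwist_isCompatible _ _ _

lemma simpleBimodule_isDouble_iff (a : E) : (Q.simpleBimodule a).IsDouble ↔ Q.IsDouble a :=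
  isDouble_ofTwist_iff _ _ _

/-- The embedding of the division algebra at a vertex in the tensor algebra. -/
def basicHom (i : V) : (Q.kind i).Carrier →ₙₐ[ℝ] Q.basic.TensorAlg := Q.basic.vertexHom i

/-- The embedding of the bimodule of the first arrow given by an ordinary arrow. -/
def firstHom (a : E) (h : a ∉ Q.special) : (Q.simpleBimodule a).Carrier →ₗ[ℝ] Q.basic.TensorAlg :=
  Q.basic.arrowHom (.inl ⟨a, h⟩)

open Classical in
/-- The embedding of the bimodule of the second arrow given by an ordinary arrow, where there is
one. -/
def secondHom (a : E) (h : a ∉ Q.special) :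
    (Q.simpleBimodule a).Carrier →ₗ[ℝ] Q.basic.TensorAlg :=
  if hd : Q.IsDouble a then Q.basic.arrowHom (.inr ⟨a, h, hd⟩) else 0

lemma secondHom_of_isDouble {a : E} (h : a ∉ Q.special) (hd : Q.IsDouble a) :
    Q.secondHom a h = Q.basic.arrowHom (.inr ⟨a, h, hd⟩) := dif_pos hd

lemma secondHom_of_not_isDouble {a : E} (h : a ∉ Q.special) (hd : ¬Q.IsDouble a) :
    Q.secondHom a h = 0 := dif_neg hd

lemma firstHom_smul (a : E) (h : a ∉ Q.special) (c : (Q.kind (Q.tgt a)).Carrier)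
    (m : (Q.simpleBimodule a).Carrier) :
    Q.firstHom a h (c • m) = Q.basicHom (Q.tgt a) c * Q.firstHom a h m :=
  Q.basic.arrowHom_left (.inl ⟨a, h⟩) c m

lemma firstHom_op_smul (a : E) (h : a ∉ Q.special) (c : (Q.kind (Q.src a)).Carrier)
    (m : (Q.simpleBimodule a).Carrier) :
    Q.firstHom a h (op c • m) = Q.firstHom a h m * Q.basicHom (Q.src a) c :=
  Q.basic.arrowHom_right (.inl ⟨a, h⟩) m c

lemma secondHom_smul (a : E) (h : a ∉ Q.special) (c : (Q.kind (Q.tgt a)).Carrier)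
    (m : (Q.simpleBimodule a).Carrier) :
    Q.secondHom a h (c • m) = Q.basicHom (Q.tgt a) c * Q.secondHom a h m := by
  by_cases hd : Q.IsDouble a
  · rw [secondHom_of_isDouble Q h hd]
    exact Q.basic.arrowHom_left (.inr ⟨a, h, hd⟩) c m
  · rw [secondHom_of_not_isDouble Q h hd]
    exact (mul_zero _).symm

lemma secondHom_op_smul (a : E) (h : a ∉ Q.special) (c : (Q.kind (Q.src a)).Carrier)
    (m : (Q.simpleBimodule a).Carrier) :
    Q.secondHom a h (op c • m) = Q.secondHom a h m * Q.basicHom (Q.src a) c := by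
  by_cases hd : Q.IsDouble a
  · rw [secondHom_of_isDouble Q h hd]
    exact Q.basic.arrowHom_right (.inr ⟨a, h, hd⟩) m c
  · rw [secondHom_of_not_isDouble Q h hd]
    exact (zero_mul _).symm

/-- The matrices of the complex numbers at a vertex. -/
def modelVertex (i : V) : ℂ →ₙₐ[ℝ] Matrix (Fin 2) (Fin 2) Q.basic.TensorAlg :=
  (matHom (Q.basicHom i)).comp (scalarMat (Q.kind i))

/-- The matrix of the special loop at a vertex, or zero if there is no special loop. -/
def modelLoop (i : V) : Matrix (Fin 2) (Fin 2) Q.basic.TensorAlg :=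
  matHom (Q.basicHom i) (loopMat (Q.kind i))

/-- The matrix of an ordinary arrow. -/
def modelMat (a : E) (h : a ∉ Q.special) : Matrix (Fin 2) (Fin 2) Q.basic.TensorAlg :=
  (arrowMat (Q.isConj a) (Q.simpleBimodule a)).map (Q.firstHom a h) +
    (arrowMat' (Q.isConj a) (Q.simpleBimodule a)).map (Q.secondHom a h)

open Classical in
/-- The matrix of an arrow. -/
def modelArrow (a : E) : Matrix (Fin 2) (Fin 2) Q.basic.TensorAlg :=
  if h : a ∈ Q.special then Q.modelLoop (Q.src a) else Q.modelMat a h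

lemma isVertexRep_model (i : V) :
    IsVertexRep (Q.kind i) (Q.modelVertex i) (Q.modelLoop i) :=
  (isVertexRep_scalarMat _).map _

lemma isArrowRep_modelMat (a : E) (h : a ∉ Q.special) :
    IsArrowRep (Q.isConj a) (Q.basicHom (Q.tgt a)) (Q.basicHom (Q.src a)) (Q.modelMat a h) :=
  isArrowRep_of_hom (Q.simpleBimodule_isCompatible a) (Q.firstHom_smul a h)
    (Q.firstHom_op_smul a h) (Q.secondHom_smul a h) (Q.secondHom_op_smul a h)

lemma modelArrow_of_mem {a : E} (h : a ∈ Q.special) : Q.modelArrow a = Q.modelLoop (Q.src a) :=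
  dif_pos h

lemma modelArrow_of_notMem {a : E} (h : a ∉ Q.special) : Q.modelArrow a = Q.modelMat a h :=
  dif_neg h

lemma loopElt_modelArrow (i : V) : Q.loopElt Q.modelArrow i = Q.modelLoop i := by
  by_cases h : ∃ s : Q.special, Q.src s = i
  · obtain ⟨s, rfl⟩ := h
    rw [loopElt_src, modelArrow_of_mem Q s.2]
  -- Without a special loop the vertex is complex, and both sides are zero by default. The kind is
  -- generalized so that it can be substituted in dependent types.
  · have key : ∀ d (f : d.Carrier →ₙₐ[ℝ] Q.basic.TensorAlg), d = .complex →
        matHom f (loopMat d) = 0 := by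
      rintro _ f rfl
      exact map_zero (matHom f)
    rw [loopElt_eq_zero Q _ h]
    exact (key _ _ (Q.kind_of_not_exists h)).symm

lemma modelVertex_mul_modelVertex {i j : V} (h : i ≠ j) (c d : ℂ) :
    Q.modelVertex i c * Q.modelVertex j d = 0 := by
  ext k l
  exact (Matrix.mul_apply ..).trans
    (Finset.sum_eq_zero fun m _ => Q.basic.vertexHom_mul_vertexHom h _ _)

/-- The matrix model, as a homomorphism. -/
lemma exists_hom_matrix [Fintype V] :
    ∃ ψ : Q.QuotAlg →ₙₐ[ℝ] Matrix (Fin 2) (Fin 2) Q.basic.TensorAlg,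
      (∀ i c, ψ (Q.vertexHom i c) = Q.modelVertex i c) ∧
        ∀ a, ψ (Q.arrowElt a) = Q.modelArrow a := by
  refine exists_nonUnitalAlgHom Q.modelVertex Q.modelArrow
    (fun i j h => Q.modelVertex_mul_modelVertex h) (fun a => ?_) (fun a c => ?_) (fun s hs => ?_)
    (fun s hs => ?_)
  · by_cases h : a ∈ Q.special
    · rw [modelArrow_of_mem Q h, ← Q.loop a h]
      exact (Q.isVertexRep_model _).one_mul
    · rw [modelArrow_of_notMem Q h]
      exact (Q.isArrowRep_modelMat a h).one_mul
  · by_cases h : a ∈ Q.special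
    · rw [modelArrow_of_mem Q h, ← Q.loop a h, Q.twist_special a h]
      exact (Q.isVertexRep_model _).mul_scalar c
    · rw [modelArrow_of_notMem Q h, Q.twist_eq]
      exact ((Q.isArrowRep_modelMat a h).rel c).symm
  · rw [modelArrow_of_mem Q s.2]
    have := (Q.isVertexRep_model (Q.src s)).sq
    rw [Q.kind_of_sign_eq_one s hs] at this
    exact this
  · rw [modelArrow_of_mem Q s.2]
    have := (Q.isVertexRep_model (Q.src s)).sq
    rw [Q.kind_of_sign_eq_neg_one s hs] at this
    exact this

end SemilinearQuiver

/-! ## The corner of `ℂ_σQ/⟨S⟩` -/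

namespace SemilinearQuiver

variable {V E : Type*} [Fintype V] (Q : SemilinearQuiver V E)

lemma isVertexRep_quotAlg (i : V) :
    IsVertexRep (Q.kind i) (Q.vertexHom i) (Q.loopElt Q.arrowElt i) :=
  Q.isVertexRep _ _ Q.vertexHom_one_mul_arrowElt Q.arrowElt_mul_vertexHom
    Q.arrowElt_mul_self_of_sign_eq_one Q.arrowElt_mul_self_of_sign_eq_neg_one i

/-- The embedding of the division algebra at a vertex in `ℂ_σQ/⟨S⟩`. -/
def quotEmb (i : V) : (Q.kind i).Carrier →ₙₐ[ℝ] Q.QuotAlg := (Q.isVertexRep_quotAlg i).emb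

/-- The elements `x_k` at a vertex, with `∑ x_k y_k = e_i`. -/
def quotCol (i : V) (k : Fin 2) : Q.QuotAlg :=
  vertexCol (Q.vertexHom i) (Q.loopElt Q.arrowElt i) (Q.kind i) k

/-- The elements `y_k` at a vertex, with `∑ x_k y_k = e_i`. -/
def quotRow (i : V) (k : Fin 2) : Q.QuotAlg :=
  vertexRow (Q.vertexHom i) (Q.loopElt Q.arrowElt i) (Q.kind i) k

/-- The matrix of the elements `y_k a x_l` for an arrow `a`. -/
def quotMat (a : E) : Matrix (Fin 2) (Fin 2) Q.QuotAlg :=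
  Matrix.of fun k l => Q.quotRow (Q.tgt a) k * Q.arrowElt a * Q.quotCol (Q.src a) l

lemma isArrowRep_quotMat (a : E) : IsArrowRep (Q.isConj a) (Q.quotEmb (Q.tgt a))
    (Q.quotEmb (Q.src a)) (Q.quotMat a) :=
  IsArrowRep.of_vertexRep _ _ (fun c => by rw [← twist_eq, arrowElt_mul_vertexHom])
    (Q.vertexHom_one_mul_arrowElt a)

/-- The homomorphism from the bimodule of the first arrow given by an arrow. -/
def quotFirst (a : E) : (Q.simpleBimodule a).Carrier →ₗ[ℝ] Q.QuotAlg :=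
  arrowMap (Q.isConj a) (Q.quotMat a) (Q.simpleBimodule a) (Q.quotEmb _) (Q.quotEmb _)

/-- The homomorphism from the bimodule of the second arrow given by an arrow. -/
def quotSecond (a : E) : (Q.simpleBimodule a).Carrier →ₗ[ℝ] Q.QuotAlg :=
  arrowMap' (Q.isConj a) (Q.quotMat a) (Q.simpleBimodule a) (Q.quotEmb _) (Q.quotEmb _)

/-- The homomorphism from the bimodule of an arrow of the modulated quiver. -/
def quotArrow : (a : Q.BasicArrow) → (Q.basic.bimodule a).Carrier →ₗ[ℝ] Q.QuotAlg
  | .inl a => Q.quotFirst a.1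
  | .inr a => Q.quotSecond a.1

lemma quotEmb_one_mul (i : V) (b : (Q.kind i).Carrier) : Q.quotEmb i 1 * Q.quotEmb i b =
    Q.quotEmb i b := by
  rw [← map_mul, one_mul]

lemma quotEmb_mul_one (i : V) (b : (Q.kind i).Carrier) : Q.quotEmb i b * Q.quotEmb i 1 =
    Q.quotEmb i b := by
  rw [← map_mul, mul_one]

lemma quotEmb_mul_quotEmb {i j : V} (h : i ≠ j) (b : (Q.kind i).Carrier)
    (c : (Q.kind j).Carrier) : Q.quotEmb i b * Q.quotEmb j c = 0 := by
  have h1 : Q.quotEmb i 1 * Q.vertexHom i 1 = Q.quotEmb i 1 :=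
    (Q.isVertexRep_quotAlg i).vertexEmb_one_mul_map_one
  have h2 : Q.vertexHom j 1 * Q.quotEmb j 1 = Q.quotEmb j 1 :=
    (Q.isVertexRep_quotAlg j).map_one_mul_vertexEmb_one
  rw [← quotEmb_mul_one, ← Q.quotEmb_one_mul j c, ← h1, ← h2]
  simp only [mul_assoc]
  rw [← mul_assoc (Q.vertexHom i 1), vertexHom_mul_vertexHom Q h]
  simp only [zero_mul, mul_zero]

/-- This is the map from the tensor algebra onto the corner. If an arrow has no second copy, both
second homomorphisms vanish, so the last equation can be stated for every ordinary arrow. -/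
lemma exists_hom_quotAlg [Finite E] : ∃ φ : Q.basic.TensorAlg →ₙₐ[ℝ] Q.QuotAlg,
    (∀ i b, φ (Q.basicHom i b) = Q.quotEmb i b) ∧
      (∀ a h m, φ (Q.firstHom a h m) = Q.quotFirst a m) ∧
        ∀ a h m, φ (Q.secondHom a h m) = Q.quotSecond a m := by
  obtain ⟨φ, h1, h2⟩ := ModulatedQuiver.exists_nonUnitalAlgHom (Γ := Q.basic) Q.quotEmb Q.quotArrow
    (fun i j h b c => Q.quotEmb_mul_quotEmb h b c)
    (by
      rintro (a | a) b m
      · exact (Q.isArrowRep_quotMat a).arrowMap_smul _ b m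
      · exact (Q.isArrowRep_quotMat a).arrowMap'_smul _ b m)
    (by
      rintro (a | a) m b
      · exact (Q.isArrowRep_quotMat a).arrowMap_op_smul _ (Q.simpleBimodule_isCompatible a) b m
      · exact (Q.isArrowRep_quotMat a).arrowMap'_op_smul _ b m)
  refine ⟨φ, h1, fun a h m => h2 (.inl ⟨a, h⟩) m, fun a h m => ?_⟩
  by_cases hd : Q.IsDouble a
  · rw [secondHom_of_isDouble Q h hd]
    exact h2 (.inr ⟨a, h, hd⟩) m
  · rw [secondHom_of_not_isDouble Q h hd, quotSecond,
      arrowMap'_eq_zero _ _ _ _ _ (mt (Q.simpleBimodule_isDouble_iff a).mp hd)]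
    exact map_zero φ

/-! ### The composite T → A → M₂(T) -/

section Injective

variable {Q} {ψ : Q.QuotAlg →ₙₐ[ℝ] Matrix (Fin 2) (Fin 2) Q.basic.TensorAlg}
  (h1 : ∀ i c, ψ (Q.vertexHom i c) = Q.modelVertex i c)
  (h2 : ∀ a, ψ (Q.arrowElt a) = Q.modelArrow a)

include h1 in
lemma comp_vertexHom (i : V) : ψ.comp (Q.vertexHom i) = Q.modelVertex i :=
  NonUnitalAlgHom.ext (h1 i)

include h2 in
lemma map_loopElt_arrowElt (i : V) : ψ (Q.loopElt Q.arrowElt i) = Q.modelLoop i := by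
  rw [map_loopElt, funext h2]
  exact Q.loopElt_modelArrow i

include h1 h2 in
-- By naturality the embedding may be computed in matrices over the division algebra, where b goes
-- to the matrix with corner entry b.
lemma comp_quotEmb (i : V) :
    ψ.comp (Q.quotEmb i) = (cornerSingle Q.basic.TensorAlg).comp (Q.basicHom i) := by
  refine NonUnitalAlgHom.ext fun b => ?_
  refine (map_vertexEmb _ _ _ b).trans ?_
  rw [comp_vertexHom h1, map_loopElt_arrowElt h2]
  refine (map_vertexEmb (scalarMat _) (loopMat _) (matHom (Q.basicHom i)) b).symm.trans ?_
  rw [vertexEmb_scalarMat, matHom_single]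
  rfl

include h1 h2 in
lemma map_quotRow (i : V) (k : Fin 2) :
    ψ (Q.quotRow i k) = Matrix.single 0 k (Q.basicHom i (scalarMat (Q.kind i) 1 k k)) := by
  refine (map_vertexRow _ _ _ _ k).trans ?_
  rw [comp_vertexHom h1, map_loopElt_arrowElt h2]
  refine (map_vertexRow (scalarMat _) (loopMat _) (matHom (Q.basicHom i)) _ k).symm.trans ?_
  rw [vertexRow_scalarMat, matHom_single]

include h1 h2 in
lemma map_quotCol (i : V) (k : Fin 2) :
    ψ (Q.quotCol i k) = Matrix.single k 0 (Q.basicHom i (scalarMat (Q.kind i) 1 k k)) := by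
  refine (map_vertexCol _ _ _ _ k).trans ?_
  rw [comp_vertexHom h1, map_loopElt_arrowElt h2]
  refine (map_vertexCol (scalarMat _) (loopMat _) (matHom (Q.basicHom i)) _ k).symm.trans ?_
  rw [vertexCol_scalarMat, matHom_single]

include h1 h2 in
lemma map_quotMat {a : E} (h : a ∉ Q.special) :
    (Q.quotMat a).map ψ = (Q.modelMat a h).map (cornerSingle Q.basic.TensorAlg) := by
  ext1 k l
  change ψ (Q.quotRow _ k * Q.arrowElt a * Q.quotCol _ l) = _
  rw [map_mul, map_mul, map_quotRow h1 h2, map_quotCol h1 h2, h2, modelArrow_of_notMem Q h]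
  exact (Q.isArrowRep_modelMat a h).single_mul_mul_single k l

include h1 h2 in
-- Naturality is used twice: first to push the extraction of the homomorphism through ψ, then to
-- pull it back along the corner inclusion. What remains in T is extraction from a matrix built from
-- `firstHom` and `secondHom`, which returns `firstHom`.
lemma map_quotFirst {a : E} (h : a ∉ Q.special) (m : (Q.simpleBimodule a).Carrier) :
    ψ (Q.quotFirst a m) = cornerSingle Q.basic.TensorAlg (Q.firstHom a h m) := by
  rw [quotFirst, map_arrowMap, map_quotMat h1 h2 h, comp_quotEmb h1 h2, comp_quotEmb h1 h2,
    ← map_arrowMap]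
  exact congrArg _ (arrowMap_of_hom (Q.firstHom_smul a h) (Q.firstHom_op_smul a h)
    (Q.secondHom_smul a h) (Q.secondHom_op_smul a h) m)

include h1 h2 in
lemma map_quotSecond {a : E} (h : a ∉ Q.special) (hd : Q.IsDouble a)
    (m : (Q.simpleBimodule a).Carrier) :
    ψ (Q.quotSecond a m) = cornerSingle Q.basic.TensorAlg (Q.secondHom a h m) := by
  rw [quotSecond, map_arrowMap', map_quotMat h1 h2 h, comp_quotEmb h1 h2, comp_quotEmb h1 h2,
    ← map_arrowMap']
  exact congrArg _ (arrowMap'_of_hom (Q.firstHom_smul a h) (Q.firstHom_op_smul a h)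
    (Q.secondHom_smul a h) (Q.secondHom_op_smul a h) ((Q.simpleBimodule_isDouble_iff a).mpr hd) m)

end Injective

/-! ### The decomposition of A by the elements x_k and y_k -/

section Decomposition

variable {Q}

lemma sum_quotCol_mul_quotRow : ∑ i, ∑ k, Q.quotCol i k * Q.quotRow i k = 1 := by
  rw [← sum_vertexHom_one]
  exact Finset.sum_congr rfl fun i _ => (Q.isVertexRep_quotAlg i).sum_vertexCol_mul_vertexRow

lemma quotCol_mul_quotEmb_one (i : V) (k : Fin 2) :
    Q.quotCol i k * Q.quotEmb i 1 = Q.quotCol i k :=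
  (Q.isVertexRep_quotAlg i).vertexCol_mul_emb_one k

lemma vertexHom_one_mul_quotCol (i : V) (k : Fin 2) :
    Q.vertexHom i 1 * Q.quotCol i k = Q.quotCol i k :=
  (Q.isVertexRep_quotAlg i).map_one_mul_vertexCol k

lemma quotRow_mul_vertexHom_one (i : V) (k : Fin 2) :
    Q.quotRow i k * Q.vertexHom i 1 = Q.quotRow i k :=
  (Q.isVertexRep_quotAlg i).vertexRow_mul_map_one k

/-- The trivial path at i can be split off from y_k and the one at j from x_l; both are orthogonal
to the trivial paths at other vertices. -/
lemma quotRow_mul_mul_quotCol_eq_zero {i i' j j' : V} {x : Q.QuotAlg}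
    (hx : Q.vertexHom i' 1 * x = x) (hx' : x * Q.vertexHom j' 1 = x) (h : i ≠ i' ∨ j' ≠ j)
    (k l : Fin 2) : Q.quotRow i k * x * Q.quotCol j l = 0 := by
  rcases h with h | h
  · rw [← quotRow_mul_vertexHom_one, ← hx, mul_assoc _ (Q.vertexHom i 1), ← mul_assoc _ _ x,
      vertexHom_mul_vertexHom Q h, zero_mul, mul_zero, zero_mul]
  · rw [← vertexHom_one_mul_quotCol, ← hx', ← mul_assoc, mul_assoc _ _ (Q.vertexHom j 1),
      mul_assoc x, vertexHom_mul_vertexHom Q h, mul_zero, mul_zero, zero_mul]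

end Decomposition

/-! ### The isomorphism of T onto the corner -/

section Hom

variable {Q} {φ : Q.basic.TensorAlg →ₙₐ[ℝ] Q.QuotAlg}
  (h1 : ∀ i b, φ (Q.basicHom i b) = Q.quotEmb i b)
  (h2 : ∀ a h m, φ (Q.firstHom a h m) = Q.quotFirst a m)
  (h3 : ∀ a h m, φ (Q.secondHom a h m) = Q.quotSecond a m)

include h1 h2 h3 in
-- Composing with ψ places t in the corner of a matrix, from which it can be read off. By
-- multiplicativity this needs checking only on generators.
lemma injective_of_hom [Finite E] : Function.Injective φ := by
  obtain ⟨ψ, k1, k2⟩ := Q.exists_hom_matrix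
  have key : ∀ t, ψ (φ t) = cornerSingle Q.basic.TensorAlg t := by
    refine Q.basic.tensorAlg_induction ?_ (fun x y hx hy => ?_) (fun x y hx hy => ?_)
      (fun i b => ?_) ?_
    · rw [map_zero, map_zero, map_zero]
    · rw [map_add, map_add, map_add, hx, hy]
    · rw [map_mul, map_mul, map_mul, hx, hy]
    · exact (congrArg ψ (h1 i b)).trans (DFunLike.congr_fun (comp_quotEmb k1 k2 i) b)
    · rintro (⟨a, h⟩ | ⟨a, h, hd⟩) m
      · exact (congrArg ψ (h2 a h m)).trans (map_quotFirst k1 k2 h m)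
      · have := (congrArg ψ (h3 a h m)).trans (map_quotSecond k1 k2 h hd m)
        rw [secondHom_of_isDouble Q h hd] at this
        exact this
  intro t t' h
  have := congrArg ψ h
  rw [key, key] at this
  exact congrFun (congrFun this 0) 0

include h1 h2 h3 in
-- All row and column indices are kept general, rather than only those giving ε, because the
-- induction step for products runs through all of them.
lemma quotRow_mul_mul_quotCol_mem_range (x : Q.QuotAlg) (i j : V) (k l : Fin 2) :
    ∃ t, φ t = Q.quotRow i k * x * Q.quotCol j l := by
  revert i j k l
  refine Q.quotAlg_induction (P := fun x => ∀ i j k l,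
    ∃ t, φ t = Q.quotRow i k * x * Q.quotCol j l) (fun i j k l => ⟨0, ?_⟩)
    (fun x y hx hy i j k l => ?_) (fun x y hx hy i j k l => ?_) (fun i' c i j k l => ?_)
    (fun a i j k l => ?_) x
  · rw [map_zero, mul_zero, zero_mul]
  · obtain ⟨t, ht⟩ := hx i j k l
    obtain ⟨t', ht'⟩ := hy i j k l
    exact ⟨t + t', by rw [map_add, ht, ht', mul_add, add_mul]⟩
  · choose t ht using fun p : V × Fin 2 => hx i p.1 k p.2
    choose t' ht' using fun p : V × Fin 2 => hy p.1 j p.2 l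
    -- Inserting 1 = ∑ x_p y_p between the factors x and y expresses the entry as a sum of products
    -- of entries.
    refine ⟨∑ p, t p * t' p, ?_⟩
    rw [map_sum, ← mul_one x, ← sum_quotCol_mul_quotRow, ← Fintype.sum_prod_type', Finset.mul_sum,
      Finset.sum_mul, Finset.mul_sum, Finset.sum_mul]
    refine Finset.sum_congr rfl fun p _ => ?_
    rw [map_mul, ht, ht']
    simp only [mul_assoc]
  · by_cases h : i = i' ∧ i' = j
    · obtain ⟨rfl, rfl⟩ := h
      exact ⟨_, (h1 i _).trans ((Q.isVertexRep_quotAlg i).vertexRow_mul_map_mul_vertexCol c k l).symm⟩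
    · refine ⟨0, (map_zero φ).trans (quotRow_mul_mul_quotCol_eq_zero (i' := i') (j' := i') ?_ ?_
        (not_and_or.mp h) k l).symm⟩
      · rw [← map_mul, one_mul]
      · rw [← map_mul, mul_one]
  · by_cases h : i = Q.tgt a ∧ Q.src a = j
    · obtain ⟨rfl, rfl⟩ := h
      by_cases hs : a ∈ Q.special
      -- A special loop yields no arrow of Q^b; its entries already lie in the division algebra at
      -- the vertex.
      · have := (Q.isVertexRep_quotAlg (Q.src a)).vertexRow_mul_loop_mul_vertexCol k l
        refine ⟨_, (h1 (Q.src a) _).trans (this.symm.trans ?_)⟩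
        rw [← Q.loop a hs]
        exact congrArg (fun y => Q.quotRow (Q.src a) k * y * Q.quotCol (Q.src a) l)
          (Q.loopElt_src Q.arrowElt ⟨a, hs⟩)
      · have := (Q.isArrowRep_quotMat a).eq_arrowMap_add (Q.simpleBimodule a) k l
        refine ⟨Q.firstHom a hs (arrowMat (Q.isConj a) _ k l) +
          Q.secondHom a hs (arrowMat' (Q.isConj a) _ k l), ?_⟩
        rw [map_add, h2, h3]
        exact this.symm
    · exact ⟨0, (map_zero φ).trans (quotRow_mul_mul_quotCol_eq_zero
        (Q.vertexHom_one_mul_arrowElt a) (Q.arrowElt_mul_vertexHom_one a)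
        (not_and_or.mp h) k l).symm⟩

include h1 in
lemma map_one_eq_sum : φ 1 = ∑ i, Q.quotEmb i 1 := by
  rw [← Q.basic.sum_vertexHom_one, map_sum]
  exact Finset.sum_congr rfl fun i _ => h1 i 1

include h1 h2 h3 in
-- The elements x_0 and y_0 at a vertex are both ε_i, so the entries with k = l = 0 are the
-- components of εxε.
lemma exists_eq_mul_mul (x : Q.QuotAlg) : ∃ t, φ t = φ 1 * x * φ 1 := by
  have hx (i j : V) : ∃ t, φ t = Q.quotEmb i 1 * x * Q.quotEmb j 1 := by
    have := quotRow_mul_mul_quotCol_mem_range h1 h2 h3 x i j 0 0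
    rwa [show Q.quotRow i 0 = Q.quotEmb i 1 from (Q.isVertexRep_quotAlg i).vertexRow_zero,
      show Q.quotCol j 0 = Q.quotEmb j 1 from (Q.isVertexRep_quotAlg j).vertexCol_zero] at this
  choose t ht using hx
  refine ⟨∑ i, ∑ j, t i j, ?_⟩
  simp only [map_sum, map_one_eq_sum h1, Finset.sum_mul, Finset.mul_sum, ht]
  rw [Finset.sum_comm]

include h1 in
-- Since x_k ε = x_k, the decomposition of 1 is unchanged when ε is inserted. It witnesses AεA = A
-- in the form used for the Morita equivalence.
lemma sum_quotCol_mul_mul_quotRow :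
    ∑ p : V × Fin 2, Q.quotCol p.1 p.2 * φ 1 * Q.quotRow p.1 p.2 = 1 := by
  have orth : ∀ i j, i ≠ j → Q.quotEmb i 1 * Q.quotEmb j 1 = 0 :=
    fun i j h => Q.quotEmb_mul_quotEmb h 1 1
  rw [← sum_quotCol_mul_quotRow, ← Fintype.sum_prod_type']
  refine Finset.sum_congr rfl fun p _ => ?_
  rw [map_one_eq_sum h1, mul_sum_eq_of_orthogonal orth (quotCol_mul_quotEmb_one p.1 p.2)]

end Hom

end SemilinearQuiver

end

theorem mainTheorem6 {V E : Type*} [Fintype V] [Finite E] (Q : SemilinearQuiver V E) :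
    IsMoritaEquivalent ℝ Q.QuotAlg Q.basic.TensorAlg ∧
      ∃ (ε : Q.QuotAlg) (hε : IsIdempotentElem ε),
        TwoSidedIdeal.span {ε} = ⊤ ∧ Nonempty (hε.Corner ≃ₐ[ℝ] Q.basic.TensorAlg) := by
  obtain ⟨φ, h1, h2, h3⟩ := Q.exists_hom_quotAlg
  have hε : IsIdempotentElem (φ 1) := (map_mul φ 1 1).symm.trans (congrArg φ (mul_one 1))
  have hsum := SemilinearQuiver.sum_quotCol_mul_mul_quotRow h1
  have hiso := hε.nonempty_algEquiv_corner φ rfl (SemilinearQuiver.injective_of_hom h1 h2 h3)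
    (SemilinearQuiver.exists_eq_mul_mul h1 h2 h3)
  refine ⟨?_, φ 1, hε, ?_, hiso⟩
  · obtain ⟨f⟩ := hiso
    -- The idempotent is ε = φ(1): A is Morita equivalent to its full corner εAε, which is
    -- isomorphic to T.
    exact (hε.isMoritaEquivalent_corner hsum ℝ).trans ℝ (IsMoritaEquivalent.of_algEquiv ℝ f)
  · have hmem : φ 1 ∈ TwoSidedIdeal.span {φ 1} := TwoSidedIdeal.subset_span rfl
    have hone : (1 : Q.QuotAlg) ∈ TwoSidedIdeal.span {φ 1} := by
      rw [← hsum]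
      exact sum_mem fun p _ => TwoSidedIdeal.mul_mem_right _ _ _
        (TwoSidedIdeal.mul_mem_left _ _ _ hmem)
    refine top_le_iff.mp fun x _ => ?_
    rw [← mul_one x]
    exact TwoSidedIdeal.mul_mem_left _ _ _ hone
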